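/- **Setting.** Let $\mathcal S,\mathcal A$ be finite sets, $P(s'\mid s,a)$ a transition kernel, $c:\mathcal S\times\mathcal A\to[0,1]$ a cost, $\gamma\in(0,1)$ a discount factor and $\pi$ a fixed policy; put $\mathcal Z=\mathcal S\times\mathcal A$. Let $\Phi\in\mathbb R^{|\mathcal Z|\times d}$ ($d\ge 1$) have rows $\phi(z)^T$ and full column rank. Let $s_{or}\in\mathcal S$, $f\in[0,1]$, $m\in\mathbb N$, $\varepsilon^{(\mathcal S)}\in[0,1]$, $\varepsilon^{(\mathcal A)}$ be parameters, and put $\tilde\pi^{(\mathcal S)}=(1-\varepsilon^{(\mathcal S)})\pi+\varepsilon^{(\mathcal S)}/|\mathcal A|$ and $\tilde\pi^{(\mathcal A)}=(1-\varepsilon^{(\mathcal A)})\pi+\varepsilon^{(\mathcal A)}/|\mathcal A|$. With $\kappa_q(s)=(1-\gamma)\sum_{t\ge0}\gamma^t\Pr^\pi(s_t=s\mid s_0=q)$ let $$\kappa(s)=(1-f)\,\kappa_{s_{or}}(s)+f\,|\mathcal S|^{-1}\sum_{s'\in\mathcal S}\kappa_{s'}(s),\qquad w(s,a)=\kappa(s)\,\tilde\pi^{(\mathcal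 A)}(a\mid s),\qquad W=\mathrm{diag}(w),\qquad \|u\|_W^2=\sum_z w(z)u(z)^2,$$ and $P^\pi((s,a),(s',a'))=P(s'\mid s,a)\pi(a'\mid s')$, $\Omega=\|\Phi\|_2$, $\mu=\lambda_{\min}(\Phi^TW\Phi)$. **Algorithm (single-epoch CTD).** Let $\theta_0=\mathbf 0$ and $\theta_{t+1}=\theta_t-\iota\hat F(\theta_t)$ for $t=0,\dots,2N-1$, with output $\hat Q_{N,2N}=N^{-1}\sum_{t=N}^{2N-1}\Phi\theta_t$. In every iteration $\hat F$ is sampled afresh as follows. Draw a target $\tilde s$, equal to $s_{or}$ with probability $1-f$ and uniform on $\mathcal S$ with probability $f$, and, independently, a time $\tilde t$ with $\Pr(\tilde t=j)=(1-\gamma)\gamma^j$ for $j\ge0$. If $\tilde t\ge m$, then $\hat F(\theta)=\mathbf 0$. Otherwise, from the current state of the trajectory (however it came about), follow $\tilde\pi^{(\mathcal S)}$ until $\tilde s$ is first hit, then $\pi$ for $\tilde t$ steps, reaching a state $s$; draw $a\sim\tilde\pi^{(\mathcal A)}(\cdot\mid s)$, $s'\sim P(\cdot\mid s,a)$, $a'\sim\pi(\cdot\mid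 s')$, and put $\hat F(\theta)=\phi(s,a)\,[\phi(s,a)^T\theta-c(s,a)-\gamma\,\phi(s',a')^T\theta]$. It is understood that the sampling is well defined, i.e. that the targets are hit almost surely. **Theorem.** Suppose $\min_s\kappa(s)>0$, $0<\varepsilon^{(\mathcal A)}\le\frac{(1-\gamma)\min_s\kappa(s)}{4}$, $m\ge\log_{1/\gamma}\!\big(\frac{(\Omega^2+1)|\mathcal S|^{1/2}}{\mu}\big)$ and $0<\iota\le\frac{1-\gamma}{512\,\Omega^2}$. Put $$T=\Big\lceil\frac{8}{(1-\gamma)\iota\mu}\Big\rceil,\qquad C_2(\iota,m)=\frac{6\iota|\mathcal S|^{1/2}\Omega^2\gamma^m}{\mu}\big(1+2\iota|\mathcal S|^{1/2}\Omega^2\gamma^m\big).$$ Then the projected Bellman equation $Q=\Phi[\Phi^TW\Phi]^{-1}\Phi^TW(\gamma P^\pi Q+c)$ has a unique solution $\bar Q$, and for every $N\ge1$ the output $\hat Q_{N,2N}$ is integrable and $$\big\|\mathbb E[\hat Q_{N,2N}]-\bar Q\big\|_W^2\;\le\;\frac{2^{-\lfloor N/T\rfloor}\cdot16\,\Omega^2}{(1-\gamma)^2\mu}+\frac{786\,\Omega^2T^2C_2(\iota,m)}{(1-\gamma)^2}.$$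 In particular, if $\mu\le1$, then $$\big\|\mathbb E[\hat Q_{N,2N}]-\bar Q\big\|_W^2\;\le\;\frac{2^{-\lfloor N/T\rfloor}\cdot16\,\Omega^2}{(1-\gamma)^2\mu}+\frac{786\,\Omega^2T^2C_2(\iota,m)}{(1-\gamma)^2\mu}.$$ -/

import Mathlib

namespace CTD

open scoped Matrix

/-- A finite discounted Markov decision process with costs in `[0, 1]` (the cost already contains
the regularisation of the fixed policy that is being evaluated). -/
structure MDP (S A : Type*) [Fintype S] where
  /-- `P s a s'` is the probability of moving to `s'` when action `a` is taken in state `s`. -/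
  P : S → A → S → ℝ
  P_nonneg : ∀ s a s', 0 ≤ P s a s'
  P_sum : ∀ s a, ∑ s', P s a s' = 1
  cost : S × A → ℝ
  cost_mem : ∀ z, cost z ∈ Set.Icc (0 : ℝ) 1
  /-- the discount factor -/
  γ : ℝ
  γ_nonneg : 0 ≤ γ
  γ_lt_one : γ < 1

/-- A randomised stationary policy; `prob s a` is the probability of action `a` in state `s`. -/
structure Policy (S A : Type*) [Fintype A] where
  prob : S → A → ℝ
  prob_nonneg : ∀ s a, 0 ≤ prob s a
  prob_sum : ∀ s, ∑ a, prob s a = 1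

/-- The user-chosen sampling parameters of CTD. -/
structure Params (S : Type*) where
  /-- the origin state -/
  sor : S
  /-- the frequency parameter -/
  f : ℝ
  /-- the mixing time -/
  m : ℕ
  /-- the state-exploration parameter -/
  epsS : ℝ
  /-- the action-exploration parameter -/
  epsA : ℝ

variable {S A : Type*} [Fintype S] [Fintype A] [DecidableEq S] [DecidableEq A] {d : ℕ}

noncomputable section

/-! ### Visitation distributions, weights and the projected Bellman equation -/

/-- The policy `π` mixed with the uniform distribution on actions: `(1 - ε) π + ε / |A|`. -/
def perturbed (π : Policy S A) (ε : ℝ) (s : S) (a : A) : ℝ :=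
  (1 - ε) * π.prob s a + ε / Fintype.card A

/-- The state transition matrix under `π`. -/
def stateKernel (M : MDP S A) (π : Policy S A) : Matrix S S ℝ :=
  Matrix.of fun s s' => ∑ a, π.prob s a * M.P s a s'

/-- The discounted state visitation distribution of `π` started at `q`. -/
def kappa (M : MDP S A) (π : Policy S A) (q s : S) : ℝ :=
  (1 - M.γ) * ∑' t : ℕ, M.γ ^ t * (stateKernel M π ^ t) q s

/-- The visitation distribution started at the origin state with probability `1 - f` and at a
uniformly random state with probability `f`. -/
def kappaMix (M : MDP S A) (π : Policy S A) (p : Params S) (s : S) : ℝ :=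
  (1 - p.f) * kappa M π p.sor s + p.f * ∑ s', (Fintype.card S : ℝ)⁻¹ * kappa M π s' s

/-- The weighting distribution `w` on state-action pairs. -/
def weight (M : MDP S A) (π : Policy S A) (p : Params S) (z : S × A) : ℝ :=
  kappaMix M π p z.1 * perturbed π p.epsA z.1 z.2

/-- `W = diag(w)`. -/
def weightMatrix (M : MDP S A) (π : Policy S A) (p : Params S) : Matrix (S × A) (S × A) ℝ :=
  Matrix.diagonal (weight M π p)

/-- `‖u‖_W ^ 2`. -/
def wNormSq (M : MDP S A) (π : Policy S A) (p : Params S) (u : S × A → ℝ) : ℝ :=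
  ∑ z, weight M π p z * u z ^ 2

/-- The state-action transition matrix `P^π((s,a),(s',a')) = P(s' | s,a) π(a' | s')`. -/
def pairKernel (M : MDP S A) (π : Policy S A) : Matrix (S × A) (S × A) ℝ :=
  Matrix.of fun z z' => M.P z.1 z.2 z'.1 * π.prob z'.1 z'.2

/-- The projected Bellman equation
`Q = Φ (Φᵀ W Φ)⁻¹ Φᵀ W (γ P^π Q + c)`. -/
def ProjBellman (M : MDP S A) (π : Policy S A) (p : Params S)
    (Φ : Matrix (S × A) (Fin d) ℝ) (Q : S × A → ℝ) : Prop :=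
  Q = (Φ * (Φᵀ * weightMatrix M π p * Φ)⁻¹ * Φᵀ * weightMatrix M π p) *ᵥ
    (M.γ • (pairKernel M π *ᵥ Q) + M.cost)

/-! ### Constants -/

/-- The spectral norm `‖Φ‖₂` (operator norm between Euclidean spaces). -/
def featNorm (Φ : Matrix (S × A) (Fin d) ℝ) : ℝ :=
  ‖LinearMap.toContinuousLinearMap (Matrix.toEuclideanLin Φ)‖

/-- `λ_min(Φᵀ W Φ)`, the least eigenvalue of a real symmetric matrix. -/
def lamMin (M : MDP S A) (π : Policy S A) (p : Params S)
    (Φ : Matrix (S × A) (Fin d) ℝ) : ℝ :=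
  sInf (spectrum ℝ (Φᵀ * weightMatrix M π p * Φ))

/-- The epoch length `T = ⌈8 / ((1 - γ) ι μ)⌉`. -/
def epochLen (M : MDP S A) (π : Policy S A) (p : Params S)
    (Φ : Matrix (S × A) (Fin d) ℝ) (ι : ℝ) : ℕ :=
  ⌈8 / ((1 - M.γ) * ι * lamMin M π p Φ)⌉₊

/-- `C₂(ι, m) = (6 ι |S|^{1/2} Ω² γ^m / μ) (1 + 2 ι |S|^{1/2} Ω² γ^m)`. -/
def C2 (M : MDP S A) (π : Policy S A) (p : Params S)
    (Φ : Matrix (S × A) (Fin d) ℝ) (ι : ℝ) : ℝ :=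
  6 * ι * √(Fintype.card S : ℝ) * featNorm Φ ^ 2 * M.γ ^ p.m / lamMin M π p Φ *
    (1 + 2 * ι * √(Fintype.card S : ℝ) * featNorm Φ ^ 2 * M.γ ^ p.m)

/-! ### The sampling scheme -/

/-- What is observed while one stochastic operator is built. Trajectories are lists of steps
(action taken, next state). -/
inductive Round (S A : Type*) where
  /-- The random time `delay` is at least `m`, and nothing is sampled. -/
  | skip (delay : ℕ) : Round S A
  /-- The random time is less than `m`: the sampled target state, the trajectory up to the hitting
  time of the target, the trajectory that extends it (whose length is the random time), then an
  action, the next state and the next action. -/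
  | full (target : S) (explore mixing : List (A × S)) (act : A) (next : S) (nextAct : A) :
      Round S A

/-- The last state of a trajectory started at `x`. -/
def endState : S → List (A × S) → S
  | x, [] => x
  | _, (_, y) :: l => endState y l

/-- The probability that the trajectory started at `x`, with actions drawn from `pol`, begins with
the given steps. -/
def pathProb (M : MDP S A) (pol : S → A → ℝ) : S → List (A × S) → ℝ
  | _, [] => 1
  | x, (a, y) :: l => pol x a * M.P x a y * pathProb M pol y l

/-- The probability that the trajectory started at `x`, with actions drawn from `pol` and stopped
at the first time `t ≥ 0` at which it is in state `g`, consists exactly of the given steps. -/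
def hitProb (M : MDP S A) (pol : S → A → ℝ) (g : S) : S → List (A × S) → ℝ
  | x, [] => if x = g then 1 else 0
  | x, (a, y) :: l => if x = g then 0 else pol x a * M.P x a y * hitProb M pol g y l

/-- The law of the target state: the origin state with probability `1 - f`, uniform with
probability `f`. -/
def targetProb (p : Params S) (s : S) : ℝ :=
  (1 - p.f) * (if s = p.sor then 1 else 0) + p.f / Fintype.card S

/-- The geometric law on `{0, 1, 2, …}` with success probability `1 - γ`. -/
def geoProb (γ : ℝ) (t : ℕ) : ℝ := (1 - γ) * γ ^ t

/-- The probability of observing the given round when the sampling of the round starts in the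
state `x`. -/
def roundProb (M : MDP S A) (π : Policy S A) (p : Params S) (x : S) : Round S A → ℝ
  | .skip t => if p.m ≤ t then geoProb M.γ t else 0
  | .full g e l a s' a' =>
      if l.length < p.m then
        targetProb p g * hitProb M (perturbed π p.epsS) g x e *
          (geoProb M.γ l.length * pathProb M π.prob g l) *
          (perturbed π p.epsA (endState g l) a * M.P (endState g l) a s' * π.prob s' a')
      else 0

/-- The stochastic operator: `φ(z) (φ(z)ᵀ θ - c(z) - γ φ(z')ᵀ θ)` if the random time is less
than `m`, and `0` otherwise. -/
def Fhat (M : MDP S A) (Φ : Matrix (S × A) (Fin d) ℝ) (θ : Fin d → ℝ) :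
    Round S A → (Fin d → ℝ)
  | .skip _ => 0
  | .full g _ l a s' a' =>
      (Φ (endState g l, a) ⬝ᵥ θ - M.cost (endState g l, a) - M.γ * (Φ (s', a') ⬝ᵥ θ)) •
        Φ (endState g l, a)

/-! ### The algorithm -/

/-- The iterates `θ_0 = 0`, `θ_{t+1} = θ_t - ι F̂(θ_t)`, driven by a sequence of rounds. -/
def iterate (M : MDP S A) (Φ : Matrix (S × A) (Fin d) ℝ) (ι : ℝ) (b : ℕ → Round S A) :
    ℕ → (Fin d → ℝ)
  | 0 => 0
  | t + 1 => iterate M Φ ι b t - ι • Fhat M Φ (iterate M Φ ι b t) (b t)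

/-- The output `N⁻¹ ∑_{t=N}^{2N-1} Φ θ_t`. -/
def output (M : MDP S A) (Φ : Matrix (S × A) (Fin d) ℝ) (ι : ℝ) (N : ℕ)
    (b : ℕ → Round S A) : S × A → ℝ :=
  (N : ℝ)⁻¹ • ∑ t ∈ Finset.Ico N (2 * N), Φ *ᵥ iterate M Φ ι b t

/-- The sequence of rounds `B 0, B 1, …` on a probability space, where round `k` is sampled from
state `X k`, follows the sampling scheme: given all earlier rounds and all starting states so far,
the round `B k` has the law `roundProb` for the starting state `X k`. How `X k` comes about is left
open; it may be the state in which the single trajectory stands after round `k - 1`. -/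
structure IsRun {Ω₀ : Type*} [MeasurableSpace Ω₀] (μ₀ : MeasureTheory.Measure Ω₀)
    (M : MDP S A) (π : Policy S A) (p : Params S)
    (X : ℕ → Ω₀ → S) (B : ℕ → Ω₀ → Round S A) : Prop where
  measurable_start : ∀ k x, MeasurableSet {ω | X k ω = x}
  measurable_round : ∀ k b, MeasurableSet {ω | B k ω = b}
  law : ∀ (k : ℕ) (x : ℕ → S) (b : ℕ → Round S A),
    μ₀.real {ω | (∀ i ≤ k, X i ω = x i) ∧ ∀ i ≤ k, B i ω = b i} =
      μ₀.real {ω | (∀ i ≤ k, X i ω = x i) ∧ ∀ i < k, B i ω = b i} * roundProb M π p (x k) (b k)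

end

end CTD

/-! ### Markov averages and the discounted visitation distribution -/

namespace CTD

open scoped Matrix

set_option linter.unusedSectionVars false

variable {S A : Type*} [Fintype S] [Fintype A] [DecidableEq S] [DecidableEq A] {d : ℕ}

/-! Reduction to a deterministic recursion. A round restarts at its target once the target is hit,
so the mean of its stochastic operator, given the past, does not depend on where the round began.
This mean is `meanF` with the visitation distribution `kappaTrunc`, which is cut off at time `m`
because longer delays are skipped (`hasSum_roundProb_Fhat`). It is affine in `θ`, so the expected
iterates `x t` satisfy `x (t+1) = x t - ι F_m (x t)` exactly (`IsRun.integral_iterate_succ`). The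
solution is `Φ θ₀`, where `θ₀` is the zero of the untruncated operator. The error `x t - θ₀`
therefore obeys a linear recursion with the constant forcing `ι F_m θ₀`, whose square is `O(γ^m)`.

Coercivity. The recursion contracts if the form `∑ w_m u (u - γ P u)` dominates a multiple of `(1 -
γ) ‖u‖_W²`. The cross term is handled by a potential `h`, a function whose expected increments
dominate those of `2 u (u' - u)`. Summed against the discounted weights these increments telescope,
up to a boundary term `γ^m ∑ ν_m h` (`onPolicy_kappaTrunc_ge`). Exploration of actions costs a
multiple of `ε` times the largest second moment of `u` over the states, which `ε ≤ (1 - γ) min κ /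
4` absorbs (`Exploring.form_ge`).

The choice of `m` only ensures that `η = |S|^{1/2} Ω² γ^m / μ` is at most 1. If `η ≤ 1/10`, the
potential `u²` suffices and both terms of the bound are recovered. If `η > 1/10`, the second term of
the bound is so large that it suffices that the recursion is contractive with some absolute
constant. The potential `u²` is then too big. For three or more states a supremum over paths
replaces it (`exists_pair_potential`), for two states an explicit potential does
(`exists_two_state_potential`), and for one state truncation merely rescales the weights and creates
no bias. -/

/-- The average of `g` over the actions of `π`. -/
noncomputable def polMean (π : Policy S A) (g : S × A → ℝ) (s : S) : ℝ :=
  ∑ a, π.prob s a * g (s, a)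

/-- The expected value of `v` at the next state. -/
noncomputable def nextMean (M : MDP S A) (v : S → ℝ) (z : S × A) : ℝ :=
  ∑ s', M.P z.1 z.2 s' * v s'

/-- The law of the state after `t` steps under `π` when the initial state is the target. -/
noncomputable def nu (M : MDP S A) (π : Policy S A) (p : Params S) (t : ℕ) : S → ℝ :=
  targetProb p ᵥ* stateKernel M π ^ t

/-- The discounted visitation distribution truncated at time `m`. -/
noncomputable def kappaTrunc (M : MDP S A) (π : Policy S A) (p : Params S) (m : ℕ) (s : S) : ℝ :=
  (1 - M.γ) * ∑ t ∈ Finset.range m, M.γ ^ t * nu M π p t s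

section basics

variable (M : MDP S A) (π : Policy S A) (p : Params S)

lemma pairKernel_mulVec (u : S × A → ℝ) :
    pairKernel M π *ᵥ u = nextMean M (polMean π u) := by
  funext z
  simp only [Matrix.mulVec, dotProduct, pairKernel, Matrix.of_apply, nextMean, polMean,
    Fintype.sum_prod_type, Finset.mul_sum, mul_assoc]

lemma stateKernel_mulVec (v : S → ℝ) :
    stateKernel M π *ᵥ v = polMean π (nextMean M v) := by
  funext s
  simp only [Matrix.mulVec, dotProduct, stateKernel, Matrix.of_apply, nextMean, polMean,
    Finset.mul_sum, Finset.sum_mul]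
  rw [Finset.sum_comm]
  simp only [mul_assoc]

lemma stateKernel_nonneg (s s' : S) : 0 ≤ stateKernel M π s s' :=
  Finset.sum_nonneg fun a _ => mul_nonneg (π.prob_nonneg s a) (M.P_nonneg s a s')

lemma nextMean_const (c : ℝ) : nextMean M (fun _ => c) = fun _ => c := by
  funext z; simp only [nextMean, ← Finset.sum_mul, M.P_sum, one_mul]

lemma polMean_const (c : ℝ) : polMean π (fun _ => c) = fun _ => c := by
  funext z; simp only [polMean, ← Finset.sum_mul, π.prob_sum, one_mul]

lemma polMean_mono {f g : S × A → ℝ} (h : ∀ z, f z ≤ g z) (s : S) :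
    polMean π f s ≤ polMean π g s :=
  Finset.sum_le_sum fun a _ => mul_le_mul_of_nonneg_left (h _) (π.prob_nonneg s a)

lemma nextMean_mono {f g : S → ℝ} (h : ∀ z, f z ≤ g z) (z : S × A) :
    nextMean M f z ≤ nextMean M g z :=
  Finset.sum_le_sum fun _ _ => mul_le_mul_of_nonneg_left (h _) (M.P_nonneg _ _ _)

lemma polMean_nonneg {f : S × A → ℝ} (h : ∀ z, 0 ≤ f z) (s : S) : 0 ≤ polMean π f s :=
  Finset.sum_nonneg fun a _ => mul_nonneg (π.prob_nonneg s a) (h _)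

lemma nextMean_nonneg {f : S → ℝ} (h : ∀ z, 0 ≤ f z) (z : S × A) : 0 ≤ nextMean M f z :=
  Finset.sum_nonneg fun _ _ => mul_nonneg (M.P_nonneg _ _ _) (h _)

lemma polMean_sq_le (f : S × A → ℝ) (s : S) :
    polMean π f s ^ 2 ≤ polMean π (fun z => f z ^ 2) s := by
  have h := Finset.sum_sq_le_sum_mul_sum_of_sq_le_mul Finset.univ
    (r := fun a => π.prob s a * f (s, a)) (f := fun a => π.prob s a)
    (g := fun a => π.prob s a * f (s, a) ^ 2)
    (fun a _ => π.prob_nonneg s a) (fun a _ => mul_nonneg (π.prob_nonneg s a) (sq_nonneg _))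
    (fun a _ => le_of_eq (by ring))
  rwa [π.prob_sum, one_mul] at h

lemma nextMean_sq_le (f : S → ℝ) (z : S × A) :
    nextMean M f z ^ 2 ≤ nextMean M (fun s => f s ^ 2) z := by
  have h := Finset.sum_sq_le_sum_mul_sum_of_sq_le_mul Finset.univ
    (r := fun s => M.P z.1 z.2 s * f s) (f := fun s => M.P z.1 z.2 s)
    (g := fun s => M.P z.1 z.2 s * f s ^ 2)
    (fun a _ => M.P_nonneg _ _ _) (fun a _ => mul_nonneg (M.P_nonneg _ _ _) (sq_nonneg _))
    (fun a _ => le_of_eq (by ring))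
  rwa [M.P_sum, one_mul] at h

lemma nu_zero : nu M π p 0 = targetProb p := by
  simp [nu]

lemma nu_succ (t : ℕ) : nu M π p (t + 1) = nu M π p t ᵥ* stateKernel M π := by
  simp only [nu, pow_succ, Matrix.vecMul_vecMul]

lemma nu_succ_dot (t : ℕ) (v : S → ℝ) :
    ∑ s, nu M π p (t + 1) s * v s = ∑ s, nu M π p t s * (stateKernel M π *ᵥ v) s := by
  change nu M π p (t + 1) ⬝ᵥ v = nu M π p t ⬝ᵥ (stateKernel M π *ᵥ v)
  rw [nu_succ, Matrix.dotProduct_mulVec]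

lemma nu_dot (t : ℕ) (v : S → ℝ) :
    ∑ s, nu M π p t s * v s = ∑ s, targetProb p s * (stateKernel M π ^ t *ᵥ v) s := by
  change nu M π p t ⬝ᵥ v = targetProb p ⬝ᵥ (stateKernel M π ^ t *ᵥ v)
  rw [nu, Matrix.dotProduct_mulVec]

variable {p}

lemma targetProb_nonneg (hf : p.f ∈ Set.Icc (0 : ℝ) 1) (s : S) : 0 ≤ targetProb p s := by
  have h1 : 0 ≤ 1 - p.f := by linarith [hf.2]
  have h2 := hf.1
  unfold targetProb
  split_ifs <;> positivity

variable (p) in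
lemma sum_targetProb : ∑ s, targetProb p s = 1 := by
  have : Nonempty S := ⟨p.sor⟩
  have hc : (Fintype.card S : ℝ) ≠ 0 := by simp [Fintype.card_ne_zero]
  simp only [targetProb, Finset.sum_add_distrib, ← Finset.mul_sum, Finset.sum_ite_eq',
    Finset.mem_univ, if_true, Finset.sum_const, Finset.card_univ, nsmul_eq_mul]
  field_simp
  ring

lemma nu_nonneg (hf : p.f ∈ Set.Icc (0 : ℝ) 1) (t : ℕ) (s : S) : 0 ≤ nu M π p t s := by
  induction t generalizing s with
  | zero => rw [nu_zero]; exact targetProb_nonneg hf s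
  | succ t ih =>
    rw [nu_succ]
    exact Finset.sum_nonneg fun s' _ => mul_nonneg (ih s') (stateKernel_nonneg M π s' s)

variable (p) in
lemma sum_nu (t : ℕ) : ∑ s, nu M π p t s = 1 := by
  induction t with
  | zero => rw [nu_zero]; exact sum_targetProb p
  | succ t ih =>
    have h := nu_succ_dot M π p t (fun _ => 1)
    rw [stateKernel_mulVec, nextMean_const, polMean_const] at h
    simpa [ih] using h

lemma nu_le_one (hf : p.f ∈ Set.Icc (0 : ℝ) 1) (t : ℕ) (s : S) : nu M π p t s ≤ 1 := by
  rw [← sum_nu M π p t]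
  exact Finset.single_le_sum (fun s _ => nu_nonneg M π hf t s) (Finset.mem_univ s)

/-- A power of the kernel has as its row `q` the law `nu` for the parameters with origin `q` and no
uniform restarts, so the bounds for `nu` apply. -/
lemma pow_stateKernel_mem (t : ℕ) (q s : S) :
    0 ≤ (stateKernel M π ^ t) q s ∧ (stateKernel M π ^ t) q s ≤ 1 := by
  let p' : Params S := ⟨q, 0, 0, 0, 0⟩
  have hf : p'.f ∈ Set.Icc (0 : ℝ) 1 := by simp [p']
  have h : nu M π p' t s = (stateKernel M π ^ t) q s := by
    simp [nu, Matrix.vecMul, dotProduct, targetProb, p']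
  exact h ▸ ⟨nu_nonneg M π hf t s, nu_le_one M π hf t s⟩

lemma hasSum_kappa (q s : S) :
    HasSum (fun t : ℕ => (1 - M.γ) * (M.γ ^ t * (stateKernel M π ^ t) q s)) (kappa M π q s) := by
  refine HasSum.mul_left _ (Summable.hasSum ?_)
  refine Summable.of_nonneg_of_le
    (fun t => mul_nonneg (pow_nonneg M.γ_nonneg t) (pow_stateKernel_mem M π t q s).1)
    (fun t => mul_le_of_le_one_right (pow_nonneg M.γ_nonneg t) (pow_stateKernel_mem M π t q s).2)
    (summable_geometric_of_lt_one M.γ_nonneg M.γ_lt_one)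

-- The visitation distribution is linear in the initial law, so mixing the distributions of the
-- possible starts amounts to starting from the law of the target.
variable (p) in
lemma hasSum_kappaMix (s : S) :
    HasSum (fun t : ℕ => (1 - M.γ) * (M.γ ^ t * nu M π p t s)) (kappaMix M π p s) := by
  have h := ((hasSum_kappa M π p.sor s).mul_left (1 - p.f)).add
    ((hasSum_sum (s := Finset.univ) fun s' _ =>
      (hasSum_kappa M π s' s).mul_left ((Fintype.card S : ℝ)⁻¹)).mul_left p.f)
  refine h.congr_fun ?_
  intro t
  simp only [nu, Matrix.vecMul, dotProduct, targetProb, add_mul, Finset.sum_add_distrib,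
    mul_ite, mul_one, mul_zero, ite_mul, zero_mul, Finset.sum_ite_eq', Finset.mem_univ, if_true,
    Finset.mul_sum, mul_add]
  congr 1
  · ring
  · exact Finset.sum_congr rfl fun s' _ => by ring

lemma kappaTrunc_nonneg (hf : p.f ∈ Set.Icc (0 : ℝ) 1) (m : ℕ) (s : S) :
    0 ≤ kappaTrunc M π p m s :=
  mul_nonneg (by linarith [M.γ_lt_one]) (Finset.sum_nonneg fun t _ =>
    mul_nonneg (pow_nonneg M.γ_nonneg t) (nu_nonneg M π hf t s))

lemma kappaTrunc_le (hf : p.f ∈ Set.Icc (0 : ℝ) 1) (m : ℕ) (s : S) :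
    kappaTrunc M π p m s ≤ kappaMix M π p s := by
  rw [kappaTrunc, Finset.mul_sum]
  exact sum_le_hasSum _ (fun t _ => mul_nonneg (by linarith [M.γ_lt_one])
    (mul_nonneg (pow_nonneg M.γ_nonneg t) (nu_nonneg M π hf t s))) (hasSum_kappaMix M π p s)

variable (p) in
lemma tendsto_kappaTrunc (s : S) :
    Filter.Tendsto (fun m => kappaTrunc M π p m s) Filter.atTop (nhds (kappaMix M π p s)) := by
  simp only [kappaTrunc, Finset.mul_sum]
  exact (hasSum_kappaMix M π p s).tendsto_sum_nat

variable (p) in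
lemma sum_kappaTrunc (m : ℕ) : ∑ s, kappaTrunc M π p m s = 1 - M.γ ^ m := by
  simp only [kappaTrunc, ← Finset.mul_sum]
  rw [Finset.sum_comm]
  simp only [← Finset.mul_sum, sum_nu, mul_one]
  exact mul_neg_geom_sum M.γ m

variable (p) in
lemma sum_kappaMix : ∑ s, kappaMix M π p s = 1 := by
  have h1 : Filter.Tendsto (fun m => ∑ s, kappaTrunc M π p m s) Filter.atTop
      (nhds (∑ s, kappaMix M π p s)) :=
    tendsto_finsetSum _ fun s _ => tendsto_kappaTrunc M π p s
  have h2 : Filter.Tendsto (fun m => ∑ s, kappaTrunc M π p m s) Filter.atTop (nhds (1 - 0)) := by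
    simp only [sum_kappaTrunc]
    exact tendsto_const_nhds.sub
      (tendsto_pow_atTop_nhds_zero_of_lt_one M.γ_nonneg M.γ_lt_one)
  simpa using tendsto_nhds_unique h1 h2

lemma kappaMix_nonneg (hf : p.f ∈ Set.Icc (0 : ℝ) 1) (s : S) : 0 ≤ kappaMix M π p s :=
  (kappaTrunc_nonneg M π hf 0 s).trans (kappaTrunc_le M π hf 0 s)

variable (p) in
lemma sum_kappaMix_sub (m : ℕ) :
    ∑ s, (kappaMix M π p s - kappaTrunc M π p m s) = M.γ ^ m := by
  rw [Finset.sum_sub_distrib, sum_kappaMix, sum_kappaTrunc]; ring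

/-- `γ κ K ≤ κ`. -/
lemma kappaMix_stateKernel_le (hf : p.f ∈ Set.Icc (0 : ℝ) 1) {v : S → ℝ} (hv : ∀ s, 0 ≤ v s) :
    M.γ * ∑ s, kappaMix M π p s * (stateKernel M π *ᵥ v) s ≤ ∑ s, kappaMix M π p s * v s := by
  have h1 : ∀ w : S → ℝ, HasSum (fun t => (1 - M.γ) * M.γ ^ t * ∑ s, nu M π p t s * w s)
      (∑ s, kappaMix M π p s * w s) := fun w => by
    refine (hasSum_sum (s := Finset.univ) fun s _ =>
      (hasSum_kappaMix M π p s).mul_right (w s)).congr_fun ?_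
    intro t
    rw [Finset.mul_sum]
    exact Finset.sum_congr rfl fun s _ => by ring
  have h2 := (h1 (stateKernel M π *ᵥ v)).mul_left M.γ
  -- Applying the kernel shifts the series by one step. The two sides thus differ by the term at
  -- time 0, which is nonnegative.
  have h3 := (hasSum_nat_add_iff' 1).2 (h1 v)
  have h4 : HasSum (fun t => M.γ * ((1 - M.γ) * M.γ ^ t *
      ∑ s, nu M π p t s * (stateKernel M π *ᵥ v) s))
      (∑ s, kappaMix M π p s * v s -
        ∑ i ∈ Finset.range 1, (1 - M.γ) * M.γ ^ i * ∑ s, nu M π p i s * v s) := by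
    refine h3.congr_fun ?_
    intro t
    rw [nu_succ_dot]; ring
  rw [h2.unique h4]
  simp only [Finset.range_one, Finset.sum_singleton, pow_zero, mul_one]
  have : 0 ≤ (1 - M.γ) * ∑ s, nu M π p 0 s * v s :=
    mul_nonneg (by linarith [M.γ_lt_one])
      (Finset.sum_nonneg fun s _ => mul_nonneg (nu_nonneg M π hf 0 s) (hv s))
  linarith

end basics

end CTD

/-! ### Coercivity of the Bellman form and the cost of exploring actions -/

namespace CTD

open scoped Matrix

set_option linter.unusedSectionVars false

variable {S A : Type*} [Fintype S] [Fintype A] [DecidableEq S] [DecidableEq A] {d : ℕ}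

/-- The conditions on the exploration parameters, with a lower bound `k` for the visitation
distribution. -/
structure Exploring (M : MDP S A) (π : Policy S A) (p : Params S) (k : ℝ) : Prop where
  f_mem : p.f ∈ Set.Icc (0 : ℝ) 1
  k_pos : 0 < k
  k_le : ∀ s, k ≤ kappaMix M π p s
  eps_pos : 0 < p.epsA
  eps_le : p.epsA ≤ (1 - M.γ) * k / 4

/-- The integrand `u (u - γ P^π u)` of the quadratic form of the Bellman operator. -/
noncomputable def bellForm (M : MDP S A) (π : Policy S A) (u : S × A → ℝ) (z : S × A) : ℝ :=
  u z * (u z - M.γ * nextMean M (polMean π u) z)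

/-- The second moment of `u` under the policy. -/
noncomputable def polSq (π : Policy S A) (u : S × A → ℝ) : S → ℝ :=
  polMean π fun z => u z ^ 2

/-- The weights obtained from a measure on states and the exploring policy. -/
noncomputable def pairWeight (π : Policy S A) (p : Params S) (κ : S → ℝ) (z : S × A) : ℝ :=
  κ z.1 * perturbed π p.epsA z.1 z.2

/-- The function `h` is a potential for `u`: its expected increments dominate those of
`2 u(z) (u(z') - u(z))`. -/
def IsPotential (M : MDP S A) (π : Policy S A) (u : S × A → ℝ) (h : S → ℝ) : Prop :=
  ∀ s, 2 * polMean π (fun z => u z * nextMean M (polMean π u) z - u z ^ 2) s ≤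
    (stateKernel M π *ᵥ h) s - h s

section

variable (M : MDP S A) (π : Policy S A) {p : Params S}

lemma polSq_nonneg (u : S × A → ℝ) (s : S) : 0 ≤ polSq π u s :=
  polMean_nonneg π (fun _ => sq_nonneg _) s

lemma nextMean_polMean_sq_le (u : S × A → ℝ) (z : S × A) :
    nextMean M (polMean π u) z ^ 2 ≤ nextMean M (polSq π u) z :=
  (nextMean_sq_le M _ z).trans (nextMean_mono M (fun s => polMean_sq_le π u s) z)

/-- Summation by parts, with the nonnegative initial term dropped. -/
lemma sum_discounted_increments_le {g : ℝ} {H : ℕ → ℝ} (hH : ∀ t, 0 ≤ H t) (m : ℕ) :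
    ∑ t ∈ Finset.range m, g ^ (t + 1) * (H (t + 1) - H t) ≤
      g ^ m * H m + (1 - g) * ∑ t ∈ Finset.range m, g ^ t * H t := by
  induction m with
  | zero => simpa using hH 0
  | succ m ih =>
    rw [Finset.sum_range_succ, Finset.sum_range_succ, pow_succ]
    have := hH m
    linarith

lemma sum_kappaTrunc_mul (m : ℕ) (v : S → ℝ) :
    ∑ s, kappaTrunc M π p m s * v s =
      (1 - M.γ) * ∑ t ∈ Finset.range m, M.γ ^ t * ∑ s, nu M π p t s * v s := by
  simp only [kappaTrunc, Finset.mul_sum, Finset.sum_mul]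
  rw [Finset.sum_comm]
  exact Finset.sum_congr rfl fun t _ => Finset.sum_congr rfl fun s _ => by ring

/-- The basic lower bound of the on-policy quadratic form with truncated weights. -/
lemma onPolicy_kappaTrunc_ge (hf : p.f ∈ Set.Icc (0 : ℝ) 1) {u : S × A → ℝ} {h : S → ℝ}
    (hh : IsPotential M π u h) (h0 : ∀ s, 0 ≤ h s) (m : ℕ) :
    (1 - M.γ) * (2 * ∑ s, kappaTrunc M π p m s * polSq π u s -
        (∑ s, kappaTrunc M π p m s * h s + M.γ ^ m * ∑ s, nu M π p m s * h s)) ≤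
      2 * ∑ s, kappaTrunc M π p m s * polMean π (bellForm M π u) s := by
  have hγ := M.γ_nonneg
  have hγ1 : 0 ≤ 1 - M.γ := by linarith [M.γ_lt_one]
  set H : ℕ → ℝ := fun t => ∑ s, nu M π p t s * h s with hH
  -- Splitting `u (u - γ P u) = (1 - γ) u² - γ (u P u - u²)` isolates the increment that the
  -- potential controls.
  have hpt : ∀ s, 2 * (1 - M.γ) * polSq π u s - M.γ * ((stateKernel M π *ᵥ h) s - h s) ≤
      2 * polMean π (bellForm M π u) s := by
    intro s
    have e : 2 * polMean π (bellForm M π u) s = 2 * (1 - M.γ) * polSq π u s -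
        M.γ * (2 * polMean π (fun z => u z * nextMean M (polMean π u) z - u z ^ 2) s) := by
      simp only [polMean, polSq, bellForm, Finset.mul_sum, ← Finset.sum_sub_distrib]
      exact Finset.sum_congr rfl fun a _ => by ring
    rw [e]
    have := mul_le_mul_of_nonneg_left (hh s) hγ
    linarith
  have h1 : ∑ s, kappaTrunc M π p m s *
      (2 * (1 - M.γ) * polSq π u s - M.γ * ((stateKernel M π *ᵥ h) s - h s)) ≤
      ∑ s, kappaTrunc M π p m s * (2 * polMean π (bellForm M π u) s) :=
    Finset.sum_le_sum fun s _ =>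
      mul_le_mul_of_nonneg_left (hpt s) (kappaTrunc_nonneg M π hf m s)
  have h2 : ∑ s, kappaTrunc M π p m s * (M.γ * ((stateKernel M π *ᵥ h) s - h s)) =
      (1 - M.γ) * ∑ t ∈ Finset.range m, M.γ ^ (t + 1) * (H (t + 1) - H t) := by
    rw [sum_kappaTrunc_mul]
    congr 1
    refine Finset.sum_congr rfl fun t _ => ?_
    simp only [hH, nu_succ_dot]
    rw [← Finset.sum_sub_distrib, Finset.mul_sum, Finset.mul_sum]
    exact Finset.sum_congr rfl fun s _ => by ring
  have h3 := sum_discounted_increments_le (g := M.γ)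
    (fun t => Finset.sum_nonneg fun s _ => mul_nonneg (nu_nonneg M π hf t s) (h0 s) :
      ∀ t, 0 ≤ H t) m
  have h4 := mul_le_mul_of_nonneg_left h3 hγ1
  have h5 := sum_kappaTrunc_mul M π (p := p) m h
  have e1 : ∑ s, kappaTrunc M π p m s *
      (2 * (1 - M.γ) * polSq π u s - M.γ * ((stateKernel M π *ᵥ h) s - h s)) =
      (1 - M.γ) * (2 * ∑ s, kappaTrunc M π p m s * polSq π u s) -
      ∑ s, kappaTrunc M π p m s * (M.γ * ((stateKernel M π *ᵥ h) s - h s)) := by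
    rw [Finset.mul_sum, Finset.mul_sum, ← Finset.sum_sub_distrib]
    exact Finset.sum_congr rfl fun s _ => by ring
  have e2 : ∑ s, kappaTrunc M π p m s * (2 * polMean π (bellForm M π u) s) =
      2 * ∑ s, kappaTrunc M π p m s * polMean π (bellForm M π u) s := by
    rw [Finset.mul_sum]
    exact Finset.sum_congr rfl fun s _ => by ring
  rw [e1, e2, h2] at h1
  have e3 : (1 - M.γ) * ∑ t ∈ Finset.range m, M.γ ^ t * H t = ∑ s, kappaTrunc M π p m s * h s :=
    h5.symm
  rw [e3] at h4
  linarith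

/-- Along one transition `2 u (u' - u) ≤ u'² - u²`. Jensen's inequality passes from the square of
the mean to the mean of the square. -/
lemma isPotential_polSq (u : S × A → ℝ) : IsPotential M π u (polSq π u) := by
  intro s
  rw [stateKernel_mulVec]
  simp only [polMean, polSq, ← Finset.sum_sub_distrib, Finset.mul_sum]
  refine Finset.sum_le_sum fun a _ => ?_
  have h1 := nextMean_polMean_sq_le M π u (s, a)
  have h2 := sq_nonneg (u (s, a) - nextMean M (polMean π u) (s, a))
  have h3 := mul_le_mul_of_nonneg_left
    (by linarith :
      2 * (u (s, a) * nextMean M (polMean π u) (s, a) - u (s, a) ^ 2) ≤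
      nextMean M (polSq π u) (s, a) - u (s, a) ^ 2) (π.prob_nonneg s a)
  simp only [polSq] at h3
  linarith

/-- The limit `m → ∞` of the truncated bound with potential `u²`, whose boundary term vanishes. The
difference is left unsimplified so that it has the shape expected by `Exploring.form_ge`. -/
lemma onPolicy_kappaMix_ge (hf : p.f ∈ Set.Icc (0 : ℝ) 1) (u : S × A → ℝ) :
    (1 - M.γ) * (2 * ∑ s, kappaMix M π p s * polSq π u s -
        ∑ s, kappaMix M π p s * polSq π u s) ≤
      2 * ∑ s, kappaMix M π p s * polMean π (bellForm M π u) s := by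
  have hlim : ∀ v : S → ℝ, Filter.Tendsto (fun m => ∑ s, kappaTrunc M π p m s * v s)
      Filter.atTop (nhds (∑ s, kappaMix M π p s * v s)) := fun v =>
    tendsto_finsetSum _ fun s _ => (tendsto_kappaTrunc M π p s).mul_const _
  have hz : Filter.Tendsto (fun m => M.γ ^ m * ∑ s, nu M π p m s * polSq π u s)
      Filter.atTop (nhds 0) := by
    have hb := (tendsto_pow_atTop_nhds_zero_of_lt_one M.γ_nonneg M.γ_lt_one).mul_const
      (∑ s, polSq π u s)
    rw [zero_mul] at hb
    refine squeeze_zero (fun m => mul_nonneg (pow_nonneg M.γ_nonneg m) (Finset.sum_nonneg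
      fun s _ => mul_nonneg (nu_nonneg M π hf m s) (polSq_nonneg π u s))) (fun m => ?_) hb
    exact mul_le_mul_of_nonneg_left (Finset.sum_le_sum fun s _ =>
      mul_le_of_le_one_left (polSq_nonneg π u s) (nu_le_one M π hf m s))
      (pow_nonneg M.γ_nonneg m)
  have h1 := (((hlim (polSq π u)).const_mul 2).sub
    ((hlim (polSq π u)).add hz)).const_mul (1 - M.γ)
  rw [add_zero] at h1
  exact le_of_tendsto_of_tendsto' h1 ((hlim _).const_mul 2) fun m =>
    onPolicy_kappaTrunc_ge M π hf (isPotential_polSq M π u) (polSq_nonneg π u) m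

variable {M π}

lemma Exploring.card_mul_le {k : ℝ} (hE : Exploring M π p k) : (Fintype.card S : ℝ) * k ≤ 1 := by
  rw [← sum_kappaMix M π p, ← nsmul_eq_mul, ← Finset.card_univ]
  exact Finset.card_nsmul_le_sum _ _ _ fun s _ => hE.k_le s

/-- The minimum of a probability distribution on `S` is at most `1 / |S|`. More states thus force a
smaller `ε`, which later improves the constant lost to exploration. -/
lemma Exploring.card_mul_eps_le {k : ℝ} (hE : Exploring M π p k) :
    4 * (Fintype.card S : ℝ) * p.epsA ≤ 1 := by
  have h1 := hE.card_mul_le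
  have h2 := hE.eps_le
  have h3 := M.γ_nonneg
  have h4 := hE.k_pos
  have h5 : (0 : ℝ) ≤ Fintype.card S := Nat.cast_nonneg _
  have h6 : p.epsA ≤ k / 4 := by nlinarith
  nlinarith

lemma Exploring.eps_le_quarter {k : ℝ} (hE : Exploring M π p k) : p.epsA ≤ 1 / 4 := by
  have h1 := hE.card_mul_eps_le
  have : Nonempty S := ⟨p.sor⟩
  have h2 : (1 : ℝ) ≤ Fintype.card S := by exact_mod_cast Fintype.card_pos
  nlinarith [hE.eps_pos]

lemma sum_pairWeight_mul (κ : S → ℝ) (g : S × A → ℝ) :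
    ∑ z, pairWeight π p κ z * g z = (1 - p.epsA) * ∑ s, κ s * polMean π g s +
      p.epsA * ∑ s, κ s * ∑ a, (Fintype.card A : ℝ)⁻¹ * g (s, a) := by
  rw [Fintype.sum_prod_type, Finset.mul_sum, Finset.mul_sum, ← Finset.sum_add_distrib]
  refine Finset.sum_congr rfl fun s _ => ?_
  simp only [pairWeight, perturbed, polMean, Finset.mul_sum, ← Finset.sum_add_distrib]
  exact Finset.sum_congr rfl fun a _ => by ring

lemma perturbed_nonneg {ε : ℝ} (h0 : 0 ≤ ε) (h1 : ε ≤ 1) (s : S) (a : A) :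
    0 ≤ perturbed π ε s a :=
  add_nonneg (mul_nonneg (by linarith) (π.prob_nonneg s a)) (by positivity)

lemma card_action_ne_zero (π : Policy S A) (s : S) : (Fintype.card A : ℝ) ≠ 0 := by
  intro h
  have h1 := π.prob_sum s
  rw [Nat.cast_eq_zero, Fintype.card_eq_zero_iff] at h
  simp at h1

lemma sum_perturbed (π : Policy S A) (ε : ℝ) (s : S) : ∑ a, perturbed π ε s a = 1 := by
  have := card_action_ne_zero π s
  simp only [perturbed, Finset.sum_add_distrib, ← Finset.mul_sum, π.prob_sum, Finset.sum_const,
    Finset.card_univ, nsmul_eq_mul]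
  field_simp
  ring

lemma pairWeight_nonneg (h0 : 0 ≤ p.epsA) (h1 : p.epsA ≤ 1) {κ : S → ℝ} (hκ : ∀ s, 0 ≤ κ s)
    (z : S × A) : 0 ≤ pairWeight π p κ z :=
  mul_nonneg (hκ _) (perturbed_nonneg h0 h1 _ _)

lemma sum_pairWeight (κ : S → ℝ) : ∑ z, pairWeight π p κ z = ∑ s, κ s := by
  rw [Fintype.sum_prod_type]
  simp only [pairWeight, ← Finset.mul_sum, sum_perturbed, mul_one]

/-- A lower bound of the quadratic form on the policy passes to the perturbed policy. -/
lemma perturbed_form_ge (h0 : 0 ≤ p.epsA) (h1 : p.epsA ≤ 1) {κ : S → ℝ} (hκ : ∀ s, 0 ≤ κ s)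
    (hκ1 : ∑ s, κ s ≤ 1) {u : S × A → ℝ} {b y : ℝ} (hy0 : 0 ≤ y) (hy : ∀ s, polSq π u s ≤ y)
    (hb : (1 - M.γ) * (2 * ∑ s, κ s * polSq π u s - b) ≤
      2 * ∑ s, κ s * polMean π (bellForm M π u) s) :
    (1 - M.γ) * (2 * ∑ z, pairWeight π p κ z * u z ^ 2 - (1 - p.epsA) * b) - p.epsA / 2 * y ≤
      2 * ∑ z, pairWeight π p κ z * bellForm M π u z := by
  have hγ := M.γ_nonneg
  have hγ1 := M.γ_lt_one
  have hA := card_action_ne_zero π p.sor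
  rw [sum_pairWeight_mul, sum_pairWeight_mul]
  -- Off the policy no telescoping is available. Completing the square `2γ (u - P u / 2)²` leaves a
  -- loss of `(P u)² / 2`, which is at most `y / 2`.
  have hpt : ∀ z, 2 * (1 - M.γ) * u z ^ 2 - y / 2 ≤ 2 * bellForm M π u z := by
    intro z
    have h2 : nextMean M (polMean π u) z ^ 2 ≤ y := by
      refine (nextMean_polMean_sq_le M π u z).trans ?_
      have := nextMean_mono M hy z
      rwa [nextMean_const] at this
    have h3 := mul_nonneg hγ (sq_nonneg (u z - nextMean M (polMean π u) z / 2))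
    unfold bellForm
    nlinarith
  have hs : ∀ s, 2 * (1 - M.γ) * ∑ a, (Fintype.card A : ℝ)⁻¹ * u (s, a) ^ 2 - y / 2 ≤
      2 * ∑ a, (Fintype.card A : ℝ)⁻¹ * bellForm M π u (s, a) := by
    intro s
    have h2 : ∑ a, (Fintype.card A : ℝ)⁻¹ * (2 * (1 - M.γ) * u (s, a) ^ 2 - y / 2) ≤
        ∑ a, (Fintype.card A : ℝ)⁻¹ * (2 * bellForm M π u (s, a)) :=
      Finset.sum_le_sum fun a _ => mul_le_mul_of_nonneg_left (hpt _) (by positivity)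
    have e1 : ∑ a, (Fintype.card A : ℝ)⁻¹ * (2 * (1 - M.γ) * u (s, a) ^ 2 - y / 2) =
        2 * (1 - M.γ) * ∑ a, (Fintype.card A : ℝ)⁻¹ * u (s, a) ^ 2 - y / 2 := by
      simp only [mul_sub, Finset.sum_sub_distrib, Finset.sum_const, Finset.card_univ, nsmul_eq_mul,
        Finset.mul_sum]
      congr 1
      · exact Finset.sum_congr rfl fun a _ => by ring
      · field_simp
    have e2 : ∑ a, (Fintype.card A : ℝ)⁻¹ * (2 * bellForm M π u (s, a)) =
        2 * ∑ a, (Fintype.card A : ℝ)⁻¹ * bellForm M π u (s, a) := by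
      rw [Finset.mul_sum]
      exact Finset.sum_congr rfl fun a _ => by ring
    rwa [e1, e2] at h2
  have h4 : ∑ s, κ s * (2 * (1 - M.γ) * ∑ a, (Fintype.card A : ℝ)⁻¹ * u (s, a) ^ 2 - y / 2) ≤
      ∑ s, κ s * (2 * ∑ a, (Fintype.card A : ℝ)⁻¹ * bellForm M π u (s, a)) :=
    Finset.sum_le_sum fun s _ => mul_le_mul_of_nonneg_left (hs s) (hκ s)
  have e3 : ∑ s, κ s * (2 * (1 - M.γ) * ∑ a, (Fintype.card A : ℝ)⁻¹ * u (s, a) ^ 2 - y / 2) =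
      2 * (1 - M.γ) * ∑ s, κ s * ∑ a, (Fintype.card A : ℝ)⁻¹ * u (s, a) ^ 2 -
        (∑ s, κ s) * (y / 2) := by
    rw [Finset.mul_sum, Finset.sum_mul, ← Finset.sum_sub_distrib]
    exact Finset.sum_congr rfl fun s _ => by ring
  have e4 : ∑ s, κ s * (2 * ∑ a, (Fintype.card A : ℝ)⁻¹ * bellForm M π u (s, a)) =
      2 * ∑ s, κ s * ∑ a, (Fintype.card A : ℝ)⁻¹ * bellForm M π u (s, a) := by
    rw [Finset.mul_sum]
    exact Finset.sum_congr rfl fun s _ => by ring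
  rw [e3, e4] at h4
  have h5 : (∑ s, κ s) * (y / 2) ≤ y / 2 := mul_le_of_le_one_left (by linarith) hκ1
  have h6 := mul_le_mul_of_nonneg_left (by linarith :
    2 * (1 - M.γ) * ∑ s, κ s * ∑ a, (Fintype.card A : ℝ)⁻¹ * u (s, a) ^ 2 - y / 2 ≤
      2 * ∑ s, κ s * ∑ a, (Fintype.card A : ℝ)⁻¹ * bellForm M π u (s, a)) h0
  have h7 := mul_le_mul_of_nonneg_left hb (by linarith : 0 ≤ 1 - p.epsA)
  have e5 : polMean π (fun z => u z ^ 2) = polSq π u := rfl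
  rw [e5]
  linarith

/-- `‖u‖_W²`. -/
lemma wNormSq_eq (u : S × A → ℝ) :
    wNormSq M π p u = ∑ z, pairWeight π p (kappaMix M π p) z * u z ^ 2 := rfl

lemma onPolicy_le_wNormSq {κ : S → ℝ} (h0 : 0 ≤ p.epsA) (hκ : ∀ s, 0 ≤ κ s)
    {g : S × A → ℝ} (hg : ∀ z, 0 ≤ g z) :
    (1 - p.epsA) * ∑ s, κ s * polMean π g s ≤ ∑ z, pairWeight π p κ z * g z := by
  rw [sum_pairWeight_mul]
  have : 0 ≤ p.epsA * ∑ s, κ s * ∑ a, (Fintype.card A : ℝ)⁻¹ * g (s, a) :=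
    mul_nonneg h0 (Finset.sum_nonneg fun s _ => mul_nonneg (hκ s)
      (Finset.sum_nonneg fun a _ => mul_nonneg (by positivity) (hg _)))
  linarith

/-- This compares the maximum over states with the weighted average. The factor `k` is what the
upper bound on `ε` compensates. -/
lemma Exploring.mul_polSq_le {k : ℝ} (hE : Exploring M π p k) (u : S × A → ℝ) (s : S) :
    k * polSq π u s ≤ ∑ s, kappaMix M π p s * polSq π u s :=
  (mul_le_mul_of_nonneg_right (hE.k_le s) (polSq_nonneg π u s)).trans
    (Finset.single_le_sum (f := fun s => kappaMix M π p s * polSq π u s)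
      (fun s _ => mul_nonneg (kappaMix_nonneg M π hE.f_mem s) (polSq_nonneg π u s))
      (Finset.mem_univ s))

lemma exists_polSq_max (p : Params S) (u : S × A → ℝ) :
    ∃ s₀, ∀ s, polSq π u s ≤ polSq π u s₀ := by
  have : Nonempty S := ⟨p.sor⟩
  exact Finite.exists_max (polSq π u)

lemma wNormSq_nonneg {k : ℝ} (hE : Exploring M π p k) (u : S × A → ℝ) : 0 ≤ wNormSq M π p u :=
  Finset.sum_nonneg fun z _ => mul_nonneg (pairWeight_nonneg hE.eps_pos.le
    (by linarith [hE.eps_le_quarter]) (kappaMix_nonneg M π hE.f_mem) z) (sq_nonneg _)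

/-- The loss due to the exploration of actions is absorbed by `‖u‖_W²`. -/
lemma Exploring.form_ge {k : ℝ} (hE : Exploring M π p k) {κ : S → ℝ} (hκ : ∀ s, 0 ≤ κ s)
    (hκ1 : ∑ s, κ s ≤ 1) {u : S × A → ℝ} {b δ : ℝ} (hδ : 1 ≤ 8 * δ * (1 - p.epsA))
    (hb : (1 - M.γ) * (2 * ∑ s, κ s * polSq π u s - b) ≤
      2 * ∑ s, κ s * polMean π (bellForm M π u) s) :
    (1 - M.γ) * (2 * ∑ z, pairWeight π p κ z * u z ^ 2 - (1 - p.epsA) * b -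
        δ * wNormSq M π p u) ≤
      2 * ∑ z, pairWeight π p κ z * bellForm M π u z := by
  obtain ⟨s₀, hs₀⟩ := exists_polSq_max (π := π) p u
  have hε := hE.eps_le_quarter
  have hε0 := hE.eps_pos
  have h1 := perturbed_form_ge (M := M) hε0.le (by linarith) hκ hκ1
    (polSq_nonneg π u s₀) hs₀ hb
  have h2 := hE.mul_polSq_le u s₀
  have h3 : (1 - p.epsA) * ∑ s, kappaMix M π p s * polSq π u s ≤ wNormSq M π p u :=
    onPolicy_le_wNormSq hε0.le (kappaMix_nonneg M π hE.f_mem) fun _ => sq_nonneg _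
  have hy0 := polSq_nonneg π u s₀
  have hγ : 0 ≤ 1 - M.γ := by linarith [M.γ_lt_one]
  have hE0 := wNormSq_nonneg hE u
  set E := wNormSq M π p u
  set y := polSq π u s₀
  have h5 : 0 ≤ 1 - p.epsA := by linarith
  -- Multiply `(1 - ε) k y ≤ E` by `8 δ` and use `8 δ (1 - ε) ≥ 1`. The value `δ = 1/6` is
  -- admissible for `ε ≤ 1/4`, and `δ = 1/7` for `ε ≤ 1/8`.
  have h4 : k * y ≤ 8 * δ * E := by
    have hky : 0 ≤ k * y := mul_nonneg hE.k_pos.le hy0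
    have hδ0 : 0 ≤ 8 * δ := by
      by_contra hneg
      push Not at hneg
      nlinarith
    nlinarith [mul_le_mul_of_nonneg_left h2 h5, mul_le_mul_of_nonneg_right hδ hky,
      mul_le_mul_of_nonneg_left ((mul_le_mul_of_nonneg_left h2 h5).trans h3) hδ0]
  have h6 : p.epsA / 2 * y ≤ (1 - M.γ) * (δ * E) := by
    have := mul_le_mul_of_nonneg_right hE.eps_le hy0
    have := mul_le_mul_of_nonneg_left h4 hγ
    nlinarith
  linarith

/-- Coercivity of the Bellman operator. -/
lemma Exploring.form_kappaMix_ge {k : ℝ} (hE : Exploring M π p k) (u : S × A → ℝ) :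
    (1 - M.γ) * (5 / 6 * wNormSq M π p u) ≤
      2 * ∑ z, weight M π p z * bellForm M π u z := by
  have hε := hE.eps_le_quarter
  have h1 := hE.form_ge (kappaMix_nonneg M π hE.f_mem) (sum_kappaMix M π p).le (δ := 1 / 6)
    (by linarith) (onPolicy_kappaMix_ge M π hE.f_mem u)
  have h3 : (1 - p.epsA) * ∑ s, kappaMix M π p s * polSq π u s ≤ wNormSq M π p u :=
    onPolicy_le_wNormSq hE.eps_pos.le (kappaMix_nonneg M π hE.f_mem) fun _ => sq_nonneg _
  have hγ : 0 ≤ 1 - M.γ := by linarith [M.γ_lt_one]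
  rw [← wNormSq_eq] at h1
  refine le_trans ?_ h1
  exact mul_le_mul_of_nonneg_left (by linarith) hγ

/-- `γ² ‖P^π u‖_W² ≤ (4/3) ‖u‖_W²`. -/
lemma Exploring.wNormSq_pairKernel_le {k : ℝ} (hE : Exploring M π p k) (u : S × A → ℝ) :
    M.γ ^ 2 * wNormSq M π p (nextMean M (polMean π u)) ≤ 4 / 3 * wNormSq M π p u := by
  obtain ⟨s₀, hs₀⟩ := exists_polSq_max (π := π) p u
  have hε := hE.eps_le_quarter
  have hε0 := hE.eps_pos
  have hκ0 := kappaMix_nonneg M π hE.f_mem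
  have hγ0 := M.γ_nonneg
  have hγ1 := M.γ_lt_one
  have hA := card_action_ne_zero π p.sor
  have hy0 := polSq_nonneg π u s₀
  have h1 : wNormSq M π p (nextMean M (polMean π u)) ≤
      ∑ z, pairWeight π p (kappaMix M π p) z * nextMean M (polSq π u) z :=
    Finset.sum_le_sum fun z _ => mul_le_mul_of_nonneg_left (nextMean_polMean_sq_le M π u z)
      (pairWeight_nonneg hε0.le (by linarith) hκ0 z)
  rw [sum_pairWeight_mul] at h1
  have h2 := kappaMix_stateKernel_le M π hE.f_mem (polSq_nonneg π u)
  rw [stateKernel_mulVec] at h2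
  have h3 : ∑ s, kappaMix M π p s *
      ∑ a, (Fintype.card A : ℝ)⁻¹ * nextMean M (polSq π u) (s, a) ≤ polSq π u s₀ := by
    have : ∀ s, ∑ a, (Fintype.card A : ℝ)⁻¹ * nextMean M (polSq π u) (s, a) ≤ polSq π u s₀ := by
      intro s
      have h : ∀ a, nextMean M (polSq π u) (s, a) ≤ polSq π u s₀ := fun a => by
        have := nextMean_mono M hs₀ (s, a)
        rwa [nextMean_const] at this
      refine (Finset.sum_le_sum fun a _ => mul_le_mul_of_nonneg_left (h a) (by positivity)).trans ?_
      rw [Finset.sum_const, Finset.card_univ, nsmul_eq_mul, mul_inv_cancel_left₀ hA]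
    refine (Finset.sum_le_sum fun s _ => mul_le_mul_of_nonneg_left (this s) (hκ0 s)).trans ?_
    rw [← Finset.sum_mul, sum_kappaMix, one_mul]
  have h4 := hE.mul_polSq_le u s₀
  have h5 : (1 - p.epsA) * ∑ s, kappaMix M π p s * polSq π u s ≤ wNormSq M π p u :=
    onPolicy_le_wNormSq hε0.le hκ0 fun _ => sq_nonneg _
  -- With `Y` the on-policy second moment, the on-policy part is at most `(1 - ε) Y ≤ E` and the
  -- uniform part at most `Y / 4 ≤ E / 3`. Together they give `4/3`.
  have h6 : p.epsA * polSq π u s₀ ≤ (1 / 4) * ∑ s, kappaMix M π p s * polSq π u s := by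
    have h7 := mul_le_mul_of_nonneg_right hE.eps_le hy0
    have h8 : 0 ≤ k * polSq π u s₀ := mul_nonneg hE.k_pos.le hy0
    nlinarith
  have h7 := mul_le_mul_of_nonneg_left h3 hε0.le
  have h8 := mul_le_mul_of_nonneg_left h2 (by linarith : 0 ≤ 1 - p.epsA)
  set Y := ∑ s, kappaMix M π p s * polSq π u s
  set E := wNormSq M π p u
  set D := ∑ s, kappaMix M π p s * polMean π (nextMean M (polSq π u)) s
  set U := ∑ s, kappaMix M π p s * ∑ a, (Fintype.card A : ℝ)⁻¹ * nextMean M (polSq π u) (s, a)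
  set V := wNormSq M π p (nextMean M (polMean π u))
  have hY : Y ≤ 4 / 3 * E := by
    have hY0 : 0 ≤ Y := Finset.sum_nonneg fun s _ => mul_nonneg (hκ0 s) (polSq_nonneg π u s)
    nlinarith
  have hV0 : 0 ≤ V := wNormSq_nonneg hE _
  have hU0 : 0 ≤ U := Finset.sum_nonneg fun s _ => mul_nonneg (hκ0 s)
    (Finset.sum_nonneg fun a _ => mul_nonneg (by positivity)
      (nextMean_nonneg M (polSq_nonneg π u) _))
  have h9 : M.γ ^ 2 * V ≤ M.γ * V := by nlinarith [mul_nonneg hγ0 hV0]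
  have h10 : M.γ * V ≤ M.γ * ((1 - p.epsA) * D + p.epsA * U) := mul_le_mul_of_nonneg_left h1 hγ0
  have h11 : M.γ * (p.epsA * U) ≤ p.epsA * U :=
    mul_le_of_le_one_left (mul_nonneg hε0.le hU0) hγ1.le
  nlinarith

/-- `‖u - γ P^π u‖_W² ≤ 5 ‖u‖_W²`. -/
lemma Exploring.wNormSq_bellman_le {k : ℝ} (hE : Exploring M π p k) (u : S × A → ℝ) :
    wNormSq M π p (fun z => u z - M.γ * nextMean M (polMean π u) z) ≤ 5 * wNormSq M π p u := by
  have h1 := hE.wNormSq_pairKernel_le u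
  have h2 : wNormSq M π p (fun z => u z - M.γ * nextMean M (polMean π u) z) ≤
      2 * wNormSq M π p u + 2 * (M.γ ^ 2 * wNormSq M π p (nextMean M (polMean π u))) := by
    simp only [wNormSq_eq, Finset.mul_sum, ← Finset.sum_add_distrib]
    refine Finset.sum_le_sum fun z _ => ?_
    have := pairWeight_nonneg (π := π) hE.eps_pos.le (by linarith [hE.eps_le_quarter])
      (kappaMix_nonneg M π hE.f_mem) z
    nlinarith [mul_nonneg this (sq_nonneg (u z + M.γ * nextMean M (polMean π u) z))]
  have := wNormSq_nonneg hE u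
  linarith

end

end CTD

namespace CTD

open scoped Matrix

set_option linter.unusedSectionVars false

/-! ### A potential defined by paths -/

section paths

variable {Z : Type*} [Fintype Z] [DecidableEq Z] (u : Z → ℝ)

/-- The left Riemann sum of `2 u du` along a path. -/
def pathSum (z : ℕ → Z) (m : ℕ) : ℝ :=
  ∑ t ∈ Finset.range m, 2 * u (z t) * (u (z (t + 1)) - u (z t))

/-- Each step satisfies `2 u (u' - u) ≤ u'² - u²`. In particular a closed loop contributes nothing
positive. -/
lemma pathSum_sub_le (z : ℕ → Z) {j m : ℕ} (hj : j ≤ m) :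
    pathSum u z m ≤ pathSum u z j + (u (z m) ^ 2 - u (z j) ^ 2) := by
  induction m, hj using Nat.le_induction with
  | base => simp
  | succ n _ ih =>
    have : pathSum u z (n + 1) = pathSum u z n + 2 * u (z n) * (u (z (n + 1)) - u (z n)) :=
      Finset.sum_range_succ _ _
    nlinarith [sq_nonneg (u (z (n + 1)) - u (z n))]

lemma pathSum_le_sq (z : ℕ → Z) (m : ℕ) : pathSum u z m ≤ u (z m) ^ 2 := by
  have h := pathSum_sub_le u z (Nat.zero_le m)
  have h0 : pathSum u z 0 = 0 := rfl
  nlinarith [sq_nonneg (u (z 0))]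

/-- Loops may be cut out, so the endpoint may be assumed to be new. Removing it from the set of
available points then charges each point only once, which makes the bound independent of the length
of the path. -/
lemma pathSum_le_of_mem (z : ℕ → Z) (m : ℕ) (F : Finset Z) (hF : ∀ t ≤ m, z t ∈ F) :
    pathSum u z m ≤ 1 / 3 * u (z m) ^ 2 + 4 / 3 * ∑ x ∈ F.erase (z m), u x ^ 2 := by
  induction m using Nat.strong_induction_on generalizing F with
  | _ m ih =>
    by_cases hloop : ∃ j < m, z j = z m
    · obtain ⟨j, hj, hjm⟩ := hloop
      have h1 := ih j hj F fun t ht => hF t (ht.trans hj.le)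
      have h2 := pathSum_sub_le u z hj.le
      rw [hjm] at h1 h2
      linarith
    · push Not at hloop
      rcases m with _ | n
      · have h0 : pathSum u z 0 = 0 := rfl
        rw [h0]
        positivity
      · have h1 := ih n n.lt_succ_self (F.erase (z (n + 1))) fun t ht =>
          Finset.mem_erase.2 ⟨hloop t (by omega), hF t (by omega)⟩
        have h2 : pathSum u z (n + 1) = pathSum u z n + 2 * u (z n) * (u (z (n + 1)) - u (z n)) :=
          Finset.sum_range_succ _ _
        have h3 : z n ∈ F.erase (z (n + 1)) :=
          Finset.mem_erase.2 ⟨hloop n (by omega), hF n (by omega)⟩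
        rw [← Finset.add_sum_erase _ _ h3]
        -- The last step needs `2ab ≤ b²/3 + 3a²`. The coefficients `1/3` and `4/3` are chosen so
        -- that this is a perfect square.
        nlinarith [sq_nonneg (3 * u (z n) - u (z (n + 1)))]

/-- The potential at `z` is the supremum of the path sums over all paths ending at `z`; appending a
step gives the increment inequality. The gain over `u²` is the constant `4/3` in place of `2` when
both points coincide. -/
lemma exists_pair_potential :
    ∃ h : Z → ℝ, (∀ z, 0 ≤ h z) ∧ (∀ z, h z ≤ u z ^ 2) ∧
      (∀ z₁ z₂, u z₁ ^ 2 + h z₂ ≤ 4 / 3 * ∑ z, u z ^ 2) ∧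
      ∀ z z', 2 * u z * (u z' - u z) ≤ h z' - h z := by
  let V : Z → Set ℝ := fun x => {r | ∃ (z : ℕ → Z) (m : ℕ), z m = x ∧ pathSum u z m = r}
  have hmem0 : ∀ x, (0 : ℝ) ∈ V x := fun x => ⟨fun _ => x, 0, rfl, rfl⟩
  have hb1 : ∀ x, ∀ r ∈ V x, r ≤ u x ^ 2 := by
    rintro x r ⟨z, m, rfl, rfl⟩
    exact pathSum_le_sq u z m
  have hb2 : ∀ x, ∀ r ∈ V x, r ≤ 1 / 3 * u x ^ 2 + 4 / 3 * ∑ y ∈ Finset.univ.erase x, u y ^ 2 := by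
    rintro x r ⟨z, m, rfl, rfl⟩
    exact pathSum_le_of_mem u z m _ fun _ _ => Finset.mem_univ _
  have hbdd : ∀ x, BddAbove (V x) := fun x => ⟨_, hb1 x⟩
  have hsup1 : ∀ x, sSup (V x) ≤ u x ^ 2 := fun x => csSup_le ⟨0, hmem0 x⟩ (hb1 x)
  refine ⟨fun x => sSup (V x), fun x => le_csSup (hbdd x) (hmem0 x), hsup1,
    fun z₁ z₂ => ?_, fun x y => ?_⟩
  · have hN : 0 ≤ ∑ z, u z ^ 2 := Finset.sum_nonneg fun z _ => sq_nonneg _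
    by_cases hz : z₁ = z₂
    · subst hz
      have h1 := csSup_le ⟨0, hmem0 z₁⟩ (hb2 z₁)
      have h2 := Finset.add_sum_erase Finset.univ (fun z => u z ^ 2) (Finset.mem_univ z₁)
      linarith
    · have h1 := hsup1 z₂
      have h2 := Finset.add_le_sum (f := fun z => u z ^ 2) (fun z _ => sq_nonneg _)
        (Finset.mem_univ z₁) (Finset.mem_univ z₂) hz
      linarith
  · have : sSup (V x) ≤ sSup (V y) - 2 * u x * (u y - u x) := by
      refine csSup_le ⟨0, hmem0 x⟩ ?_
      rintro r ⟨z, m, rfl, rfl⟩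
      have h1 : pathSum u z m + 2 * u (z m) * (u y - u (z m)) ∈ V y := by
        refine ⟨Function.update z (m + 1) y, m + 1, Function.update_self .., ?_⟩
        have e : ∀ t ≤ m, Function.update z (m + 1) y t = z t := fun t ht =>
          Function.update_of_ne (by omega) _ _
        rw [pathSum, Finset.sum_range_succ, Function.update_self, e m le_rfl]
        congr 1
        refine Finset.sum_congr rfl fun t ht => ?_
        rw [Finset.mem_range] at ht
        rw [e t (by omega), e (t + 1) (by omega)]
      have := le_csSup (hbdd y) h1
      linarith
    linarith

end paths

/-! ### Coercivity with truncated weights -/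

variable {S A : Type*} [Fintype S] [Fintype A] [DecidableEq S] [DecidableEq A] {d : ℕ}
  {M : MDP S A} {π : Policy S A} {p : Params S}

lemma polMean_le_of_le {g : S × A → ℝ} {c : ℝ} (h : ∀ z, g z ≤ c) (s : S) : polMean π g s ≤ c := by
  have := polMean_mono π h s
  rwa [polMean_const] at this

/-- A potential for every single transition between pairs becomes a potential in expectation,
because the left side is affine in `u z'`. -/
lemma isPotential_polMean {u h : S × A → ℝ}
    (hh : ∀ z z', 2 * u z * (u z' - u z) ≤ h z' - h z) : IsPotential M π u (polMean π h) := by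
  have key : ∀ z, 2 * (u z * nextMean M (polMean π u) z - u z ^ 2) ≤
      nextMean M (polMean π h) z - h z := by
    intro z
    have h1 : ∀ s', 2 * u z * polMean π u s' - 2 * u z ^ 2 + h z ≤ polMean π h s' := by
      intro s'
      have := polMean_mono π (f := fun z' => 2 * u z * (u z' - u z) + h z) (g := h)
        (fun z' => by linarith [hh z z']) s'
      refine le_trans (le_of_eq ?_) this
      have e := congrFun (polMean_const π (h z - 2 * u z ^ 2)) s'
      simp only [polMean] at e ⊢
      rw [show 2 * u z * ∑ a, π.prob s' a * u (s', a) - 2 * u z ^ 2 + h z =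
        2 * u z * ∑ a, π.prob s' a * u (s', a) + (h z - 2 * u z ^ 2) by ring, ← e, Finset.mul_sum,
        ← Finset.sum_add_distrib]
      exact Finset.sum_congr rfl fun a _ => by ring
    have h2 := nextMean_mono M h1 z
    have e : nextMean M (fun s' => 2 * u z * polMean π u s' - 2 * u z ^ 2 + h z) z =
        2 * u z * nextMean M (polMean π u) z + (h z - 2 * u z ^ 2) := by
      have e := congrFun (nextMean_const M (h z - 2 * u z ^ 2)) z
      rw [← e]
      simp only [nextMean]
      rw [Finset.mul_sum, ← Finset.sum_add_distrib]
      exact Finset.sum_congr rfl fun a _ => by ring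
    rw [e] at h2
    linarith
  intro s
  rw [stateKernel_mulVec]
  have h3 := polMean_mono π key s
  have e1 : polMean π (fun z => 2 * (u z * nextMean M (polMean π u) z - u z ^ 2)) s =
      2 * polMean π (fun z => u z * nextMean M (polMean π u) z - u z ^ 2) s := by
    simp only [polMean, Finset.mul_sum]
    exact Finset.sum_congr rfl fun a _ => by ring
  have e2 : polMean π (fun z => nextMean M (polMean π h) z - h z) s =
      polMean π (nextMean M (polMean π h)) s - polMean π h s := by
    simp only [polMean, ← Finset.sum_sub_distrib]
    exact Finset.sum_congr rfl fun a _ => by ring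
  rwa [e1, e2] at h3

/-- Truncation removes total mass `γ^m` from the state distribution, so it costs at most `γ^m` times
the largest second moment at a state. -/
lemma Exploring.wNormSq_sub_le {k : ℝ} (hE : Exploring M π p k) {u : S × A → ℝ} {c : ℝ}
    (hc : ∀ s, ∑ a, perturbed π p.epsA s a * u (s, a) ^ 2 ≤ c) (m : ℕ) :
    wNormSq M π p u - M.γ ^ m * c ≤
      ∑ z, pairWeight π p (kappaTrunc M π p m) z * u z ^ 2 := by
  have h1 : wNormSq M π p u - ∑ z, pairWeight π p (kappaTrunc M π p m) z * u z ^ 2 =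
      ∑ s, (kappaMix M π p s - kappaTrunc M π p m s) *
        ∑ a, perturbed π p.epsA s a * u (s, a) ^ 2 := by
    rw [wNormSq_eq, ← Finset.sum_sub_distrib, Fintype.sum_prod_type]
    refine Finset.sum_congr rfl fun s _ => ?_
    rw [Finset.mul_sum]
    exact Finset.sum_congr rfl fun a _ => by simp only [pairWeight]; ring
  have h2 : ∑ s, (kappaMix M π p s - kappaTrunc M π p m s) *
        ∑ a, perturbed π p.epsA s a * u (s, a) ^ 2 ≤
      ∑ s, (kappaMix M π p s - kappaTrunc M π p m s) * c :=
    Finset.sum_le_sum fun s _ => mul_le_mul_of_nonneg_left (hc s)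
      (by linarith [kappaTrunc_le M π hE.f_mem m s])
  rw [← Finset.sum_mul, sum_kappaMix_sub] at h2
  linarith

lemma Exploring.sum_perturbed_mul_le {k : ℝ} (hE : Exploring M π p k) {g : S × A → ℝ} {c : ℝ}
    (hc : ∀ z, g z ≤ c) (s : S) : ∑ a, perturbed π p.epsA s a * g (s, a) ≤ c := by
  refine (Finset.sum_le_sum fun a _ => mul_le_mul_of_nonneg_left (hc (s, a))
    (perturbed_nonneg hE.eps_pos.le (by linarith [hE.eps_le_quarter]) s a)).trans ?_
  rw [← Finset.sum_mul, sum_perturbed, one_mul]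

lemma sum_nu_mul_le (hf : p.f ∈ Set.Icc (0 : ℝ) 1) {h : S → ℝ} {c : ℝ} (hc : ∀ s, h s ≤ c) (m : ℕ) :
    ∑ s, nu M π p m s * h s ≤ c := by
  refine (Finset.sum_le_sum fun s _ => mul_le_mul_of_nonneg_left (hc s)
    (nu_nonneg M π hf m s)).trans ?_
  rw [← Finset.sum_mul, sum_nu, one_mul]

lemma sum_kappaTrunc_le_one (m : ℕ) : ∑ s, kappaTrunc M π p m s ≤ 1 := by
  rw [sum_kappaTrunc]
  linarith [pow_nonneg M.γ_nonneg m]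

/-- Coercivity with truncated weights from a potential that is dominated by `u²`. -/
lemma Exploring.form_kappaTrunc_ge {k : ℝ} (hE : Exploring M π p k) {u h : S × A → ℝ} {c₁ c₂ δ : ℝ}
    (hδ : 1 ≤ 8 * δ * (1 - p.epsA)) (h0 : ∀ z, 0 ≤ h z) (hu : ∀ z, h z ≤ u z ^ 2)
    (hh : IsPotential M π u (polMean π h)) (hc1 : ∀ z, u z ^ 2 ≤ c₁) (hc2 : ∀ z, h z ≤ c₂) (m : ℕ) :
    (1 - M.γ) * ((1 - δ) * wNormSq M π p u - M.γ ^ m * (c₁ + c₂)) ≤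
      2 * ∑ z, pairWeight π p (kappaTrunc M π p m) z * bellForm M π u z := by
  have hε := hE.eps_le_quarter
  have hε0 := hE.eps_pos
  have hκ := kappaTrunc_nonneg M π hE.f_mem m
  have h1 := hE.form_ge hκ (sum_kappaTrunc_le_one m) hδ
    (onPolicy_kappaTrunc_ge M π hE.f_mem hh (fun s => polMean_nonneg π h0 s) m)
  refine le_trans (mul_le_mul_of_nonneg_left ?_ (by linarith [M.γ_lt_one])) h1
  have h2 := hE.wNormSq_sub_le (hE.sum_perturbed_mul_le hc1) m
  have h3 : (1 - p.epsA) * ∑ s, kappaTrunc M π p m s * polMean π h s ≤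
      ∑ z, pairWeight π p (kappaTrunc M π p m) z * u z ^ 2 := by
    refine le_trans (mul_le_mul_of_nonneg_left ?_ (by linarith)) (onPolicy_le_wNormSq hε0.le hκ
      fun z => sq_nonneg (u z))
    exact Finset.sum_le_sum fun s _ => mul_le_mul_of_nonneg_left (polMean_mono π hu s) (hκ s)
  have h4 : ∑ s, nu M π p m s * polMean π h s ≤ c₂ :=
    sum_nu_mul_le hE.f_mem (polMean_le_of_le hc2) m
  have h5 : 0 ≤ M.γ ^ m * ∑ s, nu M π p m s * polMean π h s :=
    mul_nonneg (pow_nonneg M.γ_nonneg m) (Finset.sum_nonneg fun s _ =>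
      mul_nonneg (nu_nonneg M π hE.f_mem m s) (polMean_nonneg π h0 s))
  have h6 := mul_le_mul_of_nonneg_left h4 (pow_nonneg M.γ_nonneg m)
  have h7 := mul_nonneg hε0.le h5
  linarith

lemma sq_le_sum_sq {Z : Type*} [Fintype Z] (u : Z → ℝ) (z : Z) : u z ^ 2 ≤ ∑ z, u z ^ 2 :=
  Finset.single_le_sum (f := fun z => u z ^ 2) (fun _ _ => sq_nonneg _) (Finset.mem_univ z)

/-- With potential `u²` and `δ = 1/6` the constant is at least `1 - 1/6 - 2/10`, which exceeds
`3/5`. -/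
lemma Exploring.form_kappaTrunc_ge_of_small {k : ℝ} (hE : Exploring M π p k) {u : S × A → ℝ} {m : ℕ}
    (hm : 10 * (M.γ ^ m * ∑ z, u z ^ 2) ≤ wNormSq M π p u) :
    (1 - M.γ) * (3 / 5 * wNormSq M π p u) ≤
      2 * ∑ z, pairWeight π p (kappaTrunc M π p m) z * bellForm M π u z := by
  have h1 := hE.form_kappaTrunc_ge (u := u) (h := fun z => u z ^ 2) (δ := 1 / 6)
    (by linarith [hE.eps_le_quarter]) (fun _ => sq_nonneg _) (fun _ => le_rfl)
    (isPotential_polSq M π u) (sq_le_sum_sq u) (sq_le_sum_sq u) m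
  refine le_trans (mul_le_mul_of_nonneg_left ?_ (by linarith [M.γ_lt_one])) h1
  have := wNormSq_nonneg hE u
  linarith

/-- The path potential has a boundary loss of `4/3`, and the factor `√|S| ≥ 1.73` pays for it: `1 -
1/7 - (4/3)/1.73 > 1/20`. With two states `√2` would not suffice. -/
lemma Exploring.form_kappaTrunc_ge_of_three_le {k : ℝ} (hE : Exploring M π p k) {u : S × A → ℝ}
    {m : ℕ} (hS : 3 ≤ Fintype.card S)
    (hm : √(Fintype.card S : ℝ) * (M.γ ^ m * ∑ z, u z ^ 2) ≤ wNormSq M π p u) :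
    (1 - M.γ) * (1 / 20 * wNormSq M π p u) ≤
      2 * ∑ z, pairWeight π p (kappaTrunc M π p m) z * bellForm M π u z := by
  have hS' : (3 : ℝ) ≤ Fintype.card S := by exact_mod_cast hS
  have hε : 1 ≤ 8 * (1 / 7) * (1 - p.epsA) := by
    have := hE.card_mul_eps_le
    nlinarith [hE.eps_pos]
  have hsqrt : (1.73 : ℝ) ≤ √(Fintype.card S : ℝ) := Real.le_sqrt_of_sq_le (by norm_num; linarith)
  have hpos : 0 ≤ M.γ ^ m * ∑ z, u z ^ 2 :=
    mul_nonneg (pow_nonneg M.γ_nonneg m) (Finset.sum_nonneg fun z _ => sq_nonneg _)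
  have hne : Nonempty (S × A) := by
    have h := card_action_ne_zero π p.sor
    rw [Nat.cast_ne_zero] at h
    exact ⟨p.sor, (Fintype.card_pos_iff.1 (Nat.pos_of_ne_zero h)).some⟩
  obtain ⟨h, h0, hu, hb, hh⟩ := exists_pair_potential u
  obtain ⟨z₁, hz₁⟩ := Finite.exists_max fun z => u z ^ 2
  obtain ⟨z₂, hz₂⟩ := Finite.exists_max h
  have h1 := hE.form_kappaTrunc_ge hε h0 hu (isPotential_polMean hh) hz₁ hz₂ m
  refine le_trans (mul_le_mul_of_nonneg_left ?_ (by linarith [M.γ_lt_one])) h1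
  have h2 := mul_le_mul_of_nonneg_left (hb z₁ z₂) (pow_nonneg M.γ_nonneg m)
  have h3 := mul_le_mul_of_nonneg_right hsqrt hpos
  have := wNormSq_nonneg hE u
  linarith

/-! ### Chains with two states -/

lemma sum_pair {s₁ s₂ : S} (hne : s₁ ≠ s₂) (hall : ∀ s, s = s₁ ∨ s = s₂) (g : S → ℝ) :
    ∑ s, g s = g s₁ + g s₂ := by
  rw [← Finset.sum_pair hne]
  refine (Finset.sum_subset (Finset.subset_univ _) fun s _ hs => ?_).symm
  rcases hall s with h | h <;> simp [h] at hs

lemma stateKernel_row_sum (M : MDP S A) (π : Policy S A) (s : S) :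
    ∑ s', stateKernel M π s s' = 1 := by
  have h := congrFun (stateKernel_mulVec M π (fun _ => 1)) s
  rw [nextMean_const, polMean_const] at h
  simpa [Matrix.mulVec, dotProduct] using h

/-- The expected increment at `s₁` in a chain with two states. -/
lemma exists_two_state_increment_le {s₁ s₂ : S} (hne : s₁ ≠ s₂) (hall : ∀ s, s = s₁ ∨ s = s₂)
    (M : MDP S A) (π : Policy S A) (u : S × A → ℝ) :
    ∃ x : ℝ, x ^ 2 ≤ ∑ a, u (s₁, a) ^ 2 ∧
      2 * polMean π (fun z => u z * nextMean M (polMean π u) z - u z ^ 2) s₁ ≤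
        stateKernel M π s₁ s₂ * (2 * x * (polMean π u s₂ - polMean π u s₁) -
          2 * (x - polMean π u s₁) ^ 2) := by
  set q : A → ℝ := fun a => π.prob s₁ a * M.P s₁ a s₂ with hq
  have hq0 : ∀ a, 0 ≤ q a := fun a => mul_nonneg (π.prob_nonneg _ _) (M.P_nonneg _ _ _)
  have hK : stateKernel M π s₁ s₂ = ∑ a, q a := rfl
  set K := ∑ a, q a with hKdef
  have hK0 : 0 ≤ K := Finset.sum_nonneg fun a _ => hq0 a
  set b₁ := polMean π u s₁ with hb₁
  set b₂ := polMean π u s₂ with hb₂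
  set F := ∑ a, q a * u (s₁, a) with hF
  have hP : ∀ a, M.P s₁ a s₁ = 1 - M.P s₁ a s₂ := fun a => by
    have h := M.P_sum s₁ a
    rw [sum_pair hne hall] at h
    linarith
  have hb1sum : ∑ a, π.prob s₁ a * u (s₁, a) = b₁ := rfl
  have hone := π.prob_sum s₁
  -- The value `P u` at `s₁` is `b₁` plus the probability of a jump times `b₂ - b₁`. The increment
  -- is therefore a jump term minus the variance of `u` at `s₁`.
  have e1 : polMean π (fun z => u z * nextMean M (polMean π u) z - u z ^ 2) s₁ =
      (b₂ - b₁) * F - ∑ a, π.prob s₁ a * (u (s₁, a) - b₁) ^ 2 := by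
    have e : ∑ a, π.prob s₁ a * (u (s₁, a) - b₁) ^ 2 =
        ∑ a, π.prob s₁ a * u (s₁, a) ^ 2 - b₁ * b₁ := by
      have : ∑ a, π.prob s₁ a * (u (s₁, a) - b₁) ^ 2 = ∑ a, π.prob s₁ a * u (s₁, a) ^ 2 -
          2 * b₁ * ∑ a, π.prob s₁ a * u (s₁, a) + b₁ ^ 2 * ∑ a, π.prob s₁ a := by
        simp only [Finset.mul_sum, ← Finset.sum_sub_distrib, ← Finset.sum_add_distrib]
        exact Finset.sum_congr rfl fun a _ => by ring
      rw [this, hb1sum, hone]; ring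
    rw [e]
    have : b₁ * b₁ = ∑ a, π.prob s₁ a * u (s₁, a) * b₁ := by
      rw [← Finset.sum_mul, hb1sum]
    rw [this, hF, Finset.mul_sum, ← Finset.sum_sub_distrib, ← Finset.sum_sub_distrib]
    refine Finset.sum_congr rfl fun a _ => ?_
    simp only [nextMean]
    rw [sum_pair hne hall, hP a]
    simp only [hq]
    ring
  have hvar : ∑ a, q a * (u (s₁, a) - b₁) ^ 2 ≤ ∑ a, π.prob s₁ a * (u (s₁, a) - b₁) ^ 2 := by
    refine Finset.sum_le_sum fun a _ => mul_le_mul_of_nonneg_right ?_ (sq_nonneg _)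
    exact mul_le_of_le_one_right (π.prob_nonneg _ _)
      (by linarith [hP a, M.P_nonneg s₁ a s₁])
  rw [e1, hK]
  rcases hK0.eq_or_lt with h0 | hpos
  · have hz : ∀ a, q a = 0 := fun a =>
      (Finset.sum_eq_zero_iff_of_nonneg fun a _ => hq0 a).1 h0.symm a (Finset.mem_univ a)
    have hF0 : F = 0 := Finset.sum_eq_zero fun a _ => by rw [hz a, zero_mul]
    refine ⟨b₁, (polMean_sq_le π u s₁).trans (Finset.sum_le_sum fun a _ => ?_), ?_⟩
    · refine mul_le_of_le_one_left (sq_nonneg _) ?_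
      rw [← hone]
      exact Finset.single_le_sum (fun a _ => π.prob_nonneg s₁ a) (Finset.mem_univ a)
    · rw [hF0, ← h0]
      have : 0 ≤ ∑ a, π.prob s₁ a * (u (s₁, a) - b₁) ^ 2 :=
        Finset.sum_nonneg fun a _ => mul_nonneg (π.prob_nonneg _ _) (sq_nonneg _)
      linarith
  -- The witness is the mean of `u (s₁, ·)` conditioned on a jump to `s₂`. Jensen's inequality for
  -- this conditional law bounds `x²` and the part of the variance due to jumps.
  · refine ⟨F / K, ?_, ?_⟩
    · have h1 : F ^ 2 ≤ K * ∑ a, q a * u (s₁, a) ^ 2 :=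
        Finset.sum_sq_le_sum_mul_sum_of_sq_le_mul _ (fun a _ => hq0 a)
          (fun a _ => mul_nonneg (hq0 a) (sq_nonneg _)) fun a _ => le_of_eq (by ring)
      have h2 : ∑ a, q a * u (s₁, a) ^ 2 ≤ K * ∑ a, u (s₁, a) ^ 2 := by
        rw [Finset.mul_sum]
        exact Finset.sum_le_sum fun a _ => mul_le_mul_of_nonneg_right
          (Finset.single_le_sum (fun a _ => hq0 a) (Finset.mem_univ a)) (sq_nonneg _)
      rw [div_pow, div_le_iff₀ (by positivity)]
      nlinarith
    · have h1 : (F - K * b₁) ^ 2 ≤ K * ∑ a, q a * (u (s₁, a) - b₁) ^ 2 := by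
        have : F - K * b₁ = ∑ a, q a * (u (s₁, a) - b₁) := by
          rw [hF, hKdef, Finset.sum_mul, ← Finset.sum_sub_distrib]
          exact Finset.sum_congr rfl fun a _ => by ring
        rw [this]
        exact Finset.sum_sq_le_sum_mul_sum_of_sq_le_mul _ (fun a _ => hq0 a)
          (fun a _ => mul_nonneg (hq0 a) (sq_nonneg _)) fun a _ => le_of_eq (by ring)
      have h2 : K * (F / K - b₁) ^ 2 ≤ ∑ a, q a * (u (s₁, a) - b₁) ^ 2 := by
        have : K * (F / K - b₁) ^ 2 = (F - K * b₁) ^ 2 / K := by field_simp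
        rw [this, div_le_iff₀ hpos]
        linarith
      have e2 : K * (2 * (F / K) * (b₂ - b₁) - 2 * (F / K - b₁) ^ 2) =
          2 * F * (b₂ - b₁) - 2 * (K * (F / K - b₁) ^ 2) := by field_simp
      rw [e2]
      linarith

/-- For a function supported at `s₂` the expected increment is `K₁₂ v` at `s₁` and `-K₂₁ v` at `s₂`.
Hence `w ≤ -v` is exactly what the second state needs. -/
lemma isPotential_two_state {s₁ s₂ : S} (hne : s₁ ≠ s₂) (hall : ∀ s, s = s₁ ∨ s = s₂)
    {u : S × A → ℝ} {v w : ℝ}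
    (h1 : 2 * polMean π (fun z => u z * nextMean M (polMean π u) z - u z ^ 2) s₁ ≤
      stateKernel M π s₁ s₂ * v)
    (h2 : 2 * polMean π (fun z => u z * nextMean M (polMean π u) z - u z ^ 2) s₂ ≤
      stateKernel M π s₂ s₁ * w) (hvw : v + w ≤ 0) :
    IsPotential M π u fun s => if s = s₂ then v else 0 := by
  have hr1 := stateKernel_row_sum M π s₂
  rw [sum_pair hne hall] at hr1
  have hn := stateKernel_nonneg M π s₂ s₁
  intro s
  simp only [Matrix.mulVec, dotProduct]
  rw [sum_pair hne hall]
  rcases hall s with rfl | rfl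
  · simp only [hne, if_true, if_false]
    linarith
  · simp only [hne, if_true, if_false]
    have h3 := mul_le_mul_of_nonneg_left (by linarith : w ≤ -v) hn
    have h4 : stateKernel M π s s = 1 - stateKernel M π s s₁ := by linarith
    rw [h4]
    linarith

/-- The increments per jump out of the two states have nonpositive sum, so at most one of them is
positive. The potential sits at the state reached by that jump; if neither is positive, zero works.
-/
lemma exists_two_state_potential (hS : Fintype.card S = 2) (M : MDP S A) (π : Policy S A)
    (u : S × A → ℝ) :
    ∃ s₁ s₂ : S, s₁ ≠ s₂ ∧ (∀ s, s = s₁ ∨ s = s₂) ∧ ∃ v x : ℝ, 0 ≤ v ∧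
      v ≤ 2 * x * polMean π u s₂ - 3 / 2 * x ^ 2 ∧ x ^ 2 ≤ ∑ a, u (s₁, a) ^ 2 ∧
      IsPotential M π u fun s => if s = s₂ then v else 0 := by
  obtain ⟨s₁, s₂, hne, hpair⟩ := Finset.card_eq_two.1 (Finset.card_univ.trans hS)
  have huniv : ∀ s, s = s₁ ∨ s = s₂ := fun s => by
    have h := Finset.mem_univ s
    rw [hpair] at h
    simpa using h
  have huniv' : ∀ s, s = s₂ ∨ s = s₁ := fun s => (huniv s).symm
  obtain ⟨x, hx, hxv⟩ := exists_two_state_increment_le hne huniv M π u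
  obtain ⟨y, hy, hyv⟩ := exists_two_state_increment_le hne.symm huniv' M π u
  set b₁ := polMean π u s₁
  set b₂ := polMean π u s₂
  set v := 2 * x * (b₂ - b₁) - 2 * (x - b₁) ^ 2 with hv
  set w := 2 * y * (b₁ - b₂) - 2 * (y - b₂) ^ 2 with hw
  have hvw : v + w ≤ 0 := by
    rw [hv, hw]
    -- The sum `v + w` is minus the sum of these three squares.
    nlinarith [sq_nonneg ((b₂ - b₁) - ((x - b₁) - (y - b₂))), sq_nonneg (b₂ - b₁),
      sq_nonneg ((x - b₁) + (y - b₂))]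
  by_cases hv0 : 0 ≤ v
  · refine ⟨s₁, s₂, hne, huniv, v, x, hv0, ?_, hx, isPotential_two_state hne huniv hxv hyv hvw⟩
    rw [hv]
    nlinarith [sq_nonneg (2 * b₁ - x)]
  by_cases hw0 : 0 ≤ w
  · refine ⟨s₂, s₁, hne.symm, huniv', w, y, hw0, ?_, hy,
      isPotential_two_state hne.symm huniv' hyv hxv (by linarith)⟩
    rw [hw]
    nlinarith [sq_nonneg (2 * b₂ - y)]
  push Not at hv0 hw0
  refine ⟨s₁, s₂, hne, huniv, 0, 0, le_rfl, by simp,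
    by simpa using Finset.sum_nonneg fun a _ => sq_nonneg (u (s₁, a)),
    isPotential_two_state hne huniv (v := 0) (w := 0) (hxv.trans ?_) (hyv.trans ?_) (by simp)⟩
  · exact mul_le_mul_of_nonneg_left hv0.le (stateKernel_nonneg M π _ _)
  · exact mul_le_mul_of_nonneg_left hw0.le (stateKernel_nonneg M π _ _)

/-- The numerical inequality behind the two-state case, where `χ` is the ratio of the potential to
the second moment `η²` at its state. The constant `253/140 = 2 - 1/7 - 1/20` is what remains after
the exploration loss and the target constant, and `1.414` stands for `√2`. -/
lemma two_state_margin {χ η x c n₁ n₂ : ℝ} (hχ1 : χ ≤ 2 / 3)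
    (hx : χ * η ^ 2 ≤ 2 * x * η - 3 / 2 * x ^ 2) (hn1 : x ^ 2 ≤ n₁) (hn2 : η ^ 2 ≤ n₂)
    (hc : c = n₁ ∨ c = n₂) :
    (2 - χ) * c + χ * η ^ 2 ≤ (253 / 140 - χ) * (1.414 * (n₁ + n₂)) := by
  have hη := sq_nonneg η
  have hx0 := sq_nonneg x
  rcases hc with rfl | rfl
  · nlinarith [mul_nonneg (sub_nonneg.2 hχ1) (sub_nonneg.2 hn2),
      mul_nonneg (sub_nonneg.2 hχ1) (hx0.trans hn1), mul_nonneg (sub_nonneg.2 hχ1) hη]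
  · have key : 2 * η ^ 2 ≤ (253 / 140 - χ) * (1.414 * (x ^ 2 + η ^ 2)) := by
      rcases hη.eq_or_lt with h0 | hpos
      · rw [← h0]
        nlinarith
      · have h1 : 2 * η ^ 2 * η ^ 2 ≤
            (253 / 140 * η ^ 2 - (2 * x * η - 3 / 2 * x ^ 2)) * (1.414 * (x ^ 2 + η ^ 2)) := by
          -- A quartic in `x / η` that is tight near `x = 0.385 η`, to which the second square is
          -- fitted.
          nlinarith [sq_nonneg (x ^ 2 - 2 / 3 * x * η + 1 / 10 * η ^ 2),
            sq_nonneg (η * (x - 0.385 * η)), sq_nonneg (η ^ 2), sq_nonneg (x * η)]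
        have h2 : (253 / 140 * η ^ 2 - (2 * x * η - 3 / 2 * x ^ 2)) * (1.414 * (x ^ 2 + η ^ 2)) ≤
            (253 / 140 - χ) * (1.414 * (x ^ 2 + η ^ 2)) * η ^ 2 := by
          nlinarith [mul_le_mul_of_nonneg_right hx (by positivity : 0 ≤ 1.414 * (x ^ 2 + η ^ 2))]
        exact le_of_mul_le_mul_right (h1.trans h2) hpos
    nlinarith [mul_nonneg (sub_nonneg.2 hχ1) (sub_nonneg.2 hn2),
      mul_nonneg (sub_nonneg.2 hχ1) (sub_nonneg.2 hn1)]

lemma Exploring.form_kappaTrunc_ge_of_two {k : ℝ} (hE : Exploring M π p k) {u : S × A → ℝ}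
    {m : ℕ} (hS : Fintype.card S = 2)
    (hm : √(Fintype.card S : ℝ) * (M.γ ^ m * ∑ z, u z ^ 2) ≤ wNormSq M π p u) :
    (1 - M.γ) * (1 / 20 * wNormSq M π p u) ≤
      2 * ∑ z, pairWeight π p (kappaTrunc M π p m) z * bellForm M π u z := by
  have hε0 := hE.eps_pos
  have hε1 := hE.eps_le_quarter
  have hε : 1 ≤ 8 * (1 / 7) * (1 - p.epsA) := by
    have := hE.card_mul_eps_le
    rw [hS] at this
    push_cast at this
    linarith
  have hκ := kappaTrunc_nonneg M π hE.f_mem m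
  obtain ⟨s₁, s₂, hne, hall, v, x, hv0, hvx, hx, hpot⟩ := exists_two_state_potential hS M π u
  have h1 := hE.form_ge hκ (sum_kappaTrunc_le_one m) hε
    (onPolicy_kappaTrunc_ge M π hE.f_mem hpot (fun s => by split_ifs <;> simp [hv0]) m)
  refine le_trans (mul_le_mul_of_nonneg_left ?_ (by linarith [M.γ_lt_one])) h1
  have hsum : ∀ g : S → ℝ, ∑ s, g s * (if s = s₂ then v else 0) = g s₂ * v := fun g => by
    rw [sum_pair hne hall]; simp [hne]
  rw [hsum, hsum]
  set y := polSq π u s₂ with hy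
  have hy0 : 0 ≤ y := polSq_nonneg π u s₂
  have hby : polMean π u s₂ ^ 2 ≤ y := polMean_sq_le π u s₂
  set b := polMean π u s₂
  set n₁ := ∑ a, u (s₁, a) ^ 2 with hn₁
  set n₂ := ∑ a, u (s₂, a) ^ 2 with hn₂
  have hN : ∑ z, u z ^ 2 = n₁ + n₂ := by
    rw [Fintype.sum_prod_type, sum_pair hne hall]
  have hyn : y ≤ n₂ := Finset.sum_le_sum fun a _ => mul_le_of_le_one_left (sq_nonneg _) (by
    rw [← π.prob_sum s₂]
    exact Finset.single_le_sum (fun a _ => π.prob_nonneg s₂ a) (Finset.mem_univ a))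
  have hvy : v ≤ 2 / 3 * y := by nlinarith [sq_nonneg (2 * b - 3 * x)]
  -- Writing `v = χ y` lets the part of the loss weighted by `kappaTrunc` be absorbed as `χ Em`,
  -- which leaves the coefficient `2 - χ`.
  obtain ⟨χ, hχ0, hχ1, hχv⟩ : ∃ χ : ℝ, 0 ≤ χ ∧ χ ≤ 2 / 3 ∧ χ * y = v := by
    rcases hy0.eq_or_lt with h | h
    · exact ⟨0, le_rfl, by norm_num, by rw [← h] at hvy; linarith⟩
    · exact ⟨v / y, by positivity, by rwa [div_le_iff₀ h], by field_simp⟩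
  set Em := ∑ z, pairWeight π p (kappaTrunc M π p m) z * u z ^ 2 with hEm
  have h2 : (1 - p.epsA) * (kappaTrunc M π p m s₂ * y) ≤ Em := by
    refine le_trans (mul_le_mul_of_nonneg_left ?_ (by linarith)) (onPolicy_le_wNormSq hε0.le hκ
      fun z => sq_nonneg (u z))
    exact Finset.single_le_sum (f := fun s => kappaTrunc M π p m s * polSq π u s)
      (fun s _ => mul_nonneg (hκ s) (polSq_nonneg π u s)) (Finset.mem_univ s₂)
  have hpert : ∀ s, ∑ a, perturbed π p.epsA s a * u (s, a) ^ 2 ≤ ∑ a, u (s, a) ^ 2 := fun s =>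
    Finset.sum_le_sum fun a _ => mul_le_of_le_one_left (sq_nonneg _) (by
      rw [← sum_perturbed π p.epsA s]
      exact Finset.single_le_sum
        (fun a _ => perturbed_nonneg (π := π) hε0.le (by linarith) s a) (Finset.mem_univ a))
  have h3 : wNormSq M π p u - M.γ ^ m * max n₁ n₂ ≤ Em := by
    refine hE.wNormSq_sub_le (fun s => (hpert s).trans ?_) m
    rcases hall s with rfl | rfl
    · exact le_max_left _ _
    · exact le_max_right _ _
  have hmargin := two_state_margin (x := |x|) (η := √y) (n₁ := n₁) (n₂ := n₂) hχ1 (by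
    rw [Real.sq_sqrt hy0, hχv, sq_abs]
    have : x * b ≤ |x| * √y := by
      rw [← Real.sqrt_sq_eq_abs x, ← Real.sqrt_mul (sq_nonneg x)]
      refine Real.le_sqrt_of_sq_le ?_
      rw [mul_pow]
      exact mul_le_mul_of_nonneg_left hby (sq_nonneg x)
    linarith) (by rwa [sq_abs]) (by rwa [Real.sq_sqrt hy0])
    (max_choice n₁ n₂)
  rw [Real.sq_sqrt hy0, hχv] at hmargin
  have hsqrt : (1.414 : ℝ) ≤ √(Fintype.card S : ℝ) := by
    rw [hS]; exact Real.le_sqrt_of_sq_le (by norm_num)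
  have hT : 0 ≤ M.γ ^ m := pow_nonneg M.γ_nonneg m
  have hnn : 0 ≤ n₁ + n₂ := by
    have := sq_nonneg x
    linarith
  rw [hN] at hm
  set T := M.γ ^ m
  set E := wNormSq M π p u
  have h4 : T * (1.414 * (n₁ + n₂)) ≤ E := by
    have := mul_le_mul_of_nonneg_right hsqrt (mul_nonneg hT hnn)
    linarith
  have h5 : T * ((2 - χ) * max n₁ n₂ + v) ≤ (253 / 140 - χ) * E := by
    have := mul_le_mul_of_nonneg_left hmargin hT
    have := mul_le_mul_of_nonneg_left h4 (by linarith : 0 ≤ 253 / 140 - χ)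
    linarith
  have h6 := mul_le_mul_of_nonneg_left h2 hχ0
  have h7 := mul_le_mul_of_nonneg_left h3 (by linarith : 0 ≤ 2 - χ)
  have h8 : (1 - p.epsA) * (T * (nu M π p m s₂ * v)) ≤ T * v := by
    have h9 : nu M π p m s₂ * v ≤ v := mul_le_of_le_one_left hv0 (nu_le_one M π hE.f_mem m s₂)
    have h10 : 0 ≤ nu M π p m s₂ * v := mul_nonneg (nu_nonneg M π hE.f_mem m s₂) hv0
    have h11 := mul_le_mul_of_nonneg_left h9 hT
    have h12 := mul_nonneg hε0.le (mul_nonneg hT h10)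
    linarith
  have h9 : (1 - p.epsA) * (kappaTrunc M π p m s₂ * v) ≤ χ * Em := by
    rw [← hχv]
    linarith
  linarith

/-! ### Spectral bounds for the features and their Gram matrix -/

lemma sum_sq_mulVec_le (Φ : Matrix (S × A) (Fin d) ℝ) (θ : Fin d → ℝ) :
    ∑ z, (Φ *ᵥ θ) z ^ 2 ≤ featNorm Φ ^ 2 * ∑ i, θ i ^ 2 := by
  have h := (LinearMap.toContinuousLinearMap (Matrix.toEuclideanLin Φ)).le_opNorm
    (WithLp.toLp 2 θ)
  have h2 := pow_le_pow_left₀ (norm_nonneg _) h 2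
  rw [mul_pow, EuclideanSpace.norm_sq_eq, EuclideanSpace.norm_sq_eq] at h2
  simpa [featNorm, Matrix.toLpLin_apply] using h2

/-- A matrix and its transpose have the same norm: for `a = Φᵀ v` one has `|a|² = ⟨v, Φ a⟩`, and
Cauchy–Schwarz applies. -/
lemma sum_sq_transpose_mulVec_le (Φ : Matrix (S × A) (Fin d) ℝ) (v : S × A → ℝ) :
    ∑ i, (Φᵀ *ᵥ v) i ^ 2 ≤ featNorm Φ ^ 2 * ∑ z, v z ^ 2 := by
  set a := Φᵀ *ᵥ v with ha
  have h1 : ∑ i, a i ^ 2 = ∑ z, v z * (Φ *ᵥ a) z := by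
    have : a ⬝ᵥ a = v ⬝ᵥ (Φ *ᵥ a) := by
      rw [dotProduct_comm v, ← Matrix.vecMul_transpose, ← Matrix.dotProduct_mulVec]
    simpa [dotProduct, sq] using this
  have h2 := Finset.sum_mul_sq_le_sq_mul_sq Finset.univ v (Φ *ᵥ a)
  rw [← h1] at h2
  have h3 := sum_sq_mulVec_le Φ a
  have hv : 0 ≤ ∑ z, v z ^ 2 := Finset.sum_nonneg fun z _ => sq_nonneg _
  have ha0 : 0 ≤ ∑ i, a i ^ 2 := Finset.sum_nonneg fun z _ => sq_nonneg _
  rcases ha0.eq_or_lt with h0 | hpos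
  · rw [← h0]
    positivity
  · have := mul_le_mul_of_nonneg_left h3 hv
    nlinarith

lemma mulVec_eq_zero_of_rank {Φ : Matrix (S × A) (Fin d) ℝ} (hΦ : Φ.rank = d) {θ : Fin d → ℝ}
    (h : Φ *ᵥ θ = 0) : θ = 0 := by
  have h1 := LinearMap.finrank_range_add_finrank_ker (Matrix.mulVecLin Φ)
  have h2 : Module.finrank ℝ (LinearMap.range (Matrix.mulVecLin Φ)) = d := hΦ
  rw [h2] at h1
  simp only [Module.finrank_fintype_fun_eq_card, Fintype.card_fin] at h1
  have h3 : LinearMap.ker (Matrix.mulVecLin Φ) = ⊥ :=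
    Submodule.finrank_eq_zero.1 (by omega)
  have h4 : θ ∈ LinearMap.ker (Matrix.mulVecLin Φ) := by simpa using h
  simpa [h3] using h4

lemma dotProduct_gram (Φ : Matrix (S × A) (Fin d) ℝ) (θ : Fin d → ℝ) :
    θ ⬝ᵥ ((Φᵀ * weightMatrix M π p * Φ) *ᵥ θ) = wNormSq M π p (Φ *ᵥ θ) := by
  rw [← Matrix.mulVec_mulVec, ← Matrix.mulVec_mulVec, Matrix.dotProduct_mulVec,
    Matrix.vecMul_transpose]
  simp only [weightMatrix, dotProduct, Matrix.mulVec_diagonal, wNormSq]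
  exact Finset.sum_congr rfl fun z _ => by ring

lemma gram_isHermitian (Φ : Matrix (S × A) (Fin d) ℝ) :
    (Φᵀ * weightMatrix M π p * Φ).IsHermitian := by
  simp [Matrix.IsHermitian, weightMatrix,
    Matrix.mul_assoc, Matrix.conjTranspose_eq_transpose_of_trivial, Matrix.transpose_mul]

lemma sum_weight (M : MDP S A) (π : Policy S A) (p : Params S) : ∑ z, weight M π p z = 1 :=
  (sum_pairWeight _).trans (sum_kappaMix M π p)

lemma Exploring.weight_pos {k : ℝ} (hE : Exploring M π p k) (z : S × A) : 0 < weight M π p z := by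
  have hA : Nonempty A := ⟨z.2⟩
  have hc : (0 : ℝ) < Fintype.card A := by exact_mod_cast Fintype.card_pos
  refine mul_pos (hE.k_pos.trans_le (hE.k_le _)) ?_
  exact add_pos_of_nonneg_of_pos
    (mul_nonneg (by linarith [hE.eps_le_quarter]) (π.prob_nonneg _ _)) (div_pos hE.eps_pos hc)

lemma Exploring.weight_le_one {k : ℝ} (hE : Exploring M π p k) (z : S × A) :
    weight M π p z ≤ 1 := by
  rw [← sum_weight M π p]
  exact Finset.single_le_sum (fun z _ => (hE.weight_pos z).le) (Finset.mem_univ z)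

lemma Exploring.wNormSq_le_sum_sq {k : ℝ} (hE : Exploring M π p k) (u : S × A → ℝ) :
    wNormSq M π p u ≤ ∑ z, u z ^ 2 :=
  Finset.sum_le_sum fun z _ => mul_le_of_le_one_left (sq_nonneg _) (hE.weight_le_one z)

lemma Exploring.wNormSq_mulVec_le {k : ℝ} (hE : Exploring M π p k) (Φ : Matrix (S × A) (Fin d) ℝ)
    (θ : Fin d → ℝ) : wNormSq M π p (Φ *ᵥ θ) ≤ featNorm Φ ^ 2 * ∑ i, θ i ^ 2 :=
  (hE.wNormSq_le_sum_sq _).trans (sum_sq_mulVec_le Φ θ)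

lemma Exploring.eq_zero_of_wNormSq_mulVec {k : ℝ} (hE : Exploring M π p k)
    {Φ : Matrix (S × A) (Fin d) ℝ} (hΦ : Φ.rank = d) {θ : Fin d → ℝ}
    (h : wNormSq M π p (Φ *ᵥ θ) ≤ 0) : θ = 0 := by
  refine mulVec_eq_zero_of_rank hΦ (funext fun z => ?_)
  have h1 := (Finset.sum_eq_zero_iff_of_nonneg fun z _ =>
    mul_nonneg (hE.weight_pos z).le (sq_nonneg ((Φ *ᵥ θ) z))).1
    (le_antisymm h (wNormSq_nonneg hE _)) z (Finset.mem_univ z)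
  rcases mul_eq_zero.1 h1 with h2 | h2
  · exact absurd h2 (hE.weight_pos z).ne'
  · simpa using h2

/-- The Gram matrix minus `μ` times the identity has nonnegative spectrum, hence is positive
semidefinite. -/
lemma lamMin_mul_le (Φ : Matrix (S × A) (Fin d) ℝ) (θ : Fin d → ℝ) :
    lamMin M π p Φ * ∑ i, θ i ^ 2 ≤ wNormSq M π p (Φ *ᵥ θ) := by
  set G := Φᵀ * weightMatrix M π p * Φ with hG
  have hH : G.IsHermitian := gram_isHermitian Φ
  have hps : (G - lamMin M π p Φ • (1 : Matrix (Fin d) (Fin d) ℝ)).PosSemidef := by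
    have hH' : (G - lamMin M π p Φ • (1 : Matrix (Fin d) (Fin d) ℝ)).IsHermitian := by
      refine hH.sub ?_
      simp [Matrix.IsHermitian]
    rw [Matrix.posSemidef_iff_isHermitian_and_spectrum_nonneg]
    refine ⟨hH', fun r hr => ?_⟩
    have h1 : r + lamMin M π p Φ ∈ spectrum ℝ G := by
      have := spectrum.sub_singleton_eq (R := ℝ) G (lamMin M π p Φ)
      rw [Algebra.algebraMap_eq_smul_one] at this
      rw [← this] at hr
      obtain ⟨x, hx, y, hy, hxy⟩ := hr
      rw [Set.mem_singleton_iff] at hy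
      subst hy
      rw [← hxy]
      simpa using hx
    have h2 : lamMin M π p Φ ≤ r + lamMin M π p Φ :=
      csInf_le (Matrix.finite_spectrum G).bddBelow h1
    simp only [Set.mem_ofPred_eq]
    linarith
  have h := hps.dotProduct_mulVec_nonneg θ
  rw [Matrix.sub_mulVec, Matrix.smul_mulVec, Matrix.one_mulVec, dotProduct_sub, dotProduct_smul,
    star_trivial, dotProduct_gram] at h
  have e : θ ⬝ᵥ θ = ∑ i, θ i ^ 2 := by simp [dotProduct, sq]
  rw [e, smul_eq_mul] at h
  linarith

/-- The infimum of a finite nonempty spectrum is attained. The condition `0 < d` matters, since for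
an empty spectrum `sInf` would be the default value 0. -/
lemma exists_lamMin_eigenvector (hd : 0 < d) (Φ : Matrix (S × A) (Fin d) ℝ) :
    ∃ θ : Fin d → ℝ, θ ≠ 0 ∧ wNormSq M π p (Φ *ᵥ θ) = lamMin M π p Φ * ∑ i, θ i ^ 2 := by
  have : Nonempty (Fin d) := ⟨⟨0, hd⟩⟩
  set G := Φᵀ * weightMatrix M π p * Φ with hG
  have hH : G.IsHermitian := gram_isHermitian Φ
  have hne : (spectrum ℝ G).Nonempty := ⟨_, hH.eigenvalues_mem_spectrum_real (Classical.arbitrary _)⟩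
  have hmem : lamMin M π p Φ ∈ spectrum ℝ G := hne.csInf_mem (Matrix.finite_spectrum G)
  rw [← Matrix.spectrum_toLin', ← Module.End.hasEigenvalue_iff_mem_spectrum] at hmem
  obtain ⟨θ, hθ⟩ := hmem.exists_hasEigenvector
  refine ⟨θ, hθ.2, ?_⟩
  have h := hθ.apply_eq_smul
  rw [Matrix.toLin'_apply] at h
  rw [← dotProduct_gram, ← hG, h, dotProduct_smul, smul_eq_mul]
  simp [dotProduct, sq]

lemma sum_sq_pos {θ : Fin d → ℝ} (h : θ ≠ 0) : 0 < ∑ i, θ i ^ 2 := by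
  obtain ⟨i, hi⟩ := Function.ne_iff.1 h
  exact Finset.sum_pos' (fun i _ => sq_nonneg _) ⟨i, Finset.mem_univ i, sq_pos_of_ne_zero hi⟩

lemma Exploring.lamMin_pos {k : ℝ} (hE : Exploring M π p k) (hd : 0 < d)
    {Φ : Matrix (S × A) (Fin d) ℝ} (hΦ : Φ.rank = d) : 0 < lamMin M π p Φ := by
  obtain ⟨θ, hθ, h⟩ := exists_lamMin_eigenvector (M := M) (π := π) (p := p) hd Φ
  by_contra hneg
  push Not at hneg
  have := sum_sq_pos hθ
  exact hθ (hE.eq_zero_of_wNormSq_mulVec hΦ (by rw [h]; nlinarith))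

lemma Exploring.lamMin_le {k : ℝ} (hE : Exploring M π p k) (hd : 0 < d)
    (Φ : Matrix (S × A) (Fin d) ℝ) : lamMin M π p Φ ≤ featNorm Φ ^ 2 := by
  obtain ⟨θ, hθ, h⟩ := exists_lamMin_eigenvector (M := M) (π := π) (p := p) hd Φ
  have h1 := hE.wNormSq_mulVec_le Φ θ
  rw [h] at h1
  exact le_of_mul_le_mul_right h1 (sum_sq_pos hθ)

/-! ### The mean operator and the projected Bellman equation -/

/-- `u - γ P^π u`. -/
noncomputable def bell (M : MDP S A) (π : Policy S A) (u : S × A → ℝ) (z : S × A) : ℝ :=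
  u z - M.γ * nextMean M (polMean π u) z

/-- The linear part `Φᵀ W (1 - γ P^π) Φ θ` of the projected Bellman operator, with the weights
given by a measure on states. -/
noncomputable def bellLin (M : MDP S A) (π : Policy S A) (p : Params S)
    (Φ : Matrix (S × A) (Fin d) ℝ) (κ : S → ℝ) (θ : Fin d → ℝ) : Fin d → ℝ :=
  Φᵀ *ᵥ fun z => pairWeight π p κ z * bell M π (Φ *ᵥ θ) z

/-- The operator `Φᵀ W ((1 - γ P^π) Φ θ - c)`. -/
noncomputable def meanF (M : MDP S A) (π : Policy S A) (p : Params S)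
    (Φ : Matrix (S × A) (Fin d) ℝ) (κ : S → ℝ) (θ : Fin d → ℝ) : Fin d → ℝ :=
  Φᵀ *ᵥ fun z => pairWeight π p κ z * (bell M π (Φ *ᵥ θ) z - M.cost z)

lemma bell_eq (u : S × A → ℝ) : bell M π u = u - M.γ • (pairKernel M π *ᵥ u) := by
  rw [pairKernel_mulVec]; rfl

lemma bell_sub (u v : S × A → ℝ) (z : S × A) :
    bell M π (u - v) z = bell M π u z - bell M π v z := by
  simp only [bell_eq, Matrix.mulVec_sub, Pi.sub_apply, Pi.smul_apply, smul_eq_mul]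
  ring

lemma meanF_eq_add (Φ : Matrix (S × A) (Fin d) ℝ) (κ : S → ℝ) (θ θ' : Fin d → ℝ) :
    meanF M π p Φ κ θ = bellLin M π p Φ κ (θ - θ') + meanF M π p Φ κ θ' := by
  rw [meanF, meanF, bellLin, ← Matrix.mulVec_add]
  congr 1
  funext z
  rw [Pi.add_apply, Matrix.mulVec_sub, bell_sub]
  ring

/-- The matrix of `bellLin`. -/
noncomputable def bellMatrix (M : MDP S A) (π : Policy S A) (p : Params S)
    (Φ : Matrix (S × A) (Fin d) ℝ) (κ : S → ℝ) : Matrix (Fin d) (Fin d) ℝ :=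
  Φᵀ * Matrix.diagonal (pairWeight π p κ) * (1 - M.γ • pairKernel M π) * Φ

lemma bellMatrix_mulVec (Φ : Matrix (S × A) (Fin d) ℝ) (κ : S → ℝ) (θ : Fin d → ℝ) :
    bellMatrix M π p Φ κ *ᵥ θ = bellLin M π p Φ κ θ := by
  simp only [bellMatrix, ← Matrix.mulVec_mulVec, bellLin]
  congr 1
  funext z
  rw [Matrix.mulVec_diagonal, bell_eq, Matrix.sub_mulVec, Matrix.one_mulVec, Matrix.smul_mulVec]

lemma sum_mul_bellLin (Φ : Matrix (S × A) (Fin d) ℝ) (κ : S → ℝ) (θ : Fin d → ℝ) :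
    ∑ i, θ i * bellLin M π p Φ κ θ i =
      ∑ z, pairWeight π p κ z * bellForm M π (Φ *ᵥ θ) z := by
  have h : θ ⬝ᵥ bellLin M π p Φ κ θ =
      (Φ *ᵥ θ) ⬝ᵥ fun z => pairWeight π p κ z * bell M π (Φ *ᵥ θ) z := by
    rw [bellLin, Matrix.dotProduct_mulVec, Matrix.vecMul_transpose]
  refine h.trans (Finset.sum_congr rfl fun z _ => ?_)
  simp only [bellForm, bell]; ring

/-- Coercivity makes the linear part injective, and in finite dimension an injective endomorphism is
surjective. -/
lemma exists_meanF_eq_zero {k : ℝ} (hE : Exploring M π p k) {Φ : Matrix (S × A) (Fin d) ℝ}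
    (hΦ : Φ.rank = d) :
    ∃ θ₀ : Fin d → ℝ, meanF M π p Φ (kappaMix M π p) θ₀ = 0 ∧
      ∀ θ, meanF M π p Φ (kappaMix M π p) θ = 0 → θ = θ₀ := by
  set κ := kappaMix M π p
  set G := bellMatrix M π p Φ κ
  have hG : ∀ θ, G *ᵥ θ = bellLin M π p Φ κ θ := bellMatrix_mulVec Φ κ
  have hγ : 0 < 1 - M.γ := by linarith [M.γ_lt_one]
  have hker : ∀ θ, bellLin M π p Φ κ θ = 0 → θ = 0 := by
    intro θ h0
    have h1 := sum_mul_bellLin (M := M) (π := π) (p := p) Φ κ θ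
    rw [h0] at h1
    have h2 : (1 - M.γ) * (5 / 6 * wNormSq M π p (Φ *ᵥ θ)) ≤
        2 * ∑ z, pairWeight π p κ z * bellForm M π (Φ *ᵥ θ) z := hE.form_kappaMix_ge (Φ *ᵥ θ)
    rw [← h1] at h2
    simp only [Pi.zero_apply, mul_zero, Finset.sum_const_zero] at h2
    refine hE.eq_zero_of_wNormSq_mulVec hΦ ?_
    by_contra hneg
    push Not at hneg
    nlinarith [mul_pos hγ hneg]
  have hinj : Function.Injective (Matrix.mulVecLin G) := by
    rw [← LinearMap.ker_eq_bot, LinearMap.ker_eq_bot']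
    intro θ h
    exact hker θ (by rw [← hG]; simpa using h)
  obtain ⟨θ₀, hθ₀⟩ := LinearMap.injective_iff_surjective.1 hinj (-meanF M π p Φ κ 0)
  rw [Matrix.mulVecLin_apply, hG] at hθ₀
  have h0 : meanF M π p Φ κ θ₀ = 0 := by
    rw [meanF_eq_add Φ κ θ₀ 0, sub_zero, hθ₀, neg_add_cancel]
  refine ⟨θ₀, h0, fun θ h => ?_⟩
  rw [meanF_eq_add Φ κ θ θ₀, h0, add_zero] at h
  exact sub_eq_zero.1 (hker _ h)

/-- Every solution lies in the range of `Φ`. On that range, multiplying by the invertible Gram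
matrix turns the equation into the vanishing of `meanF`. -/
lemma projBellman_iff {k : ℝ} (hE : Exploring M π p k) {Φ : Matrix (S × A) (Fin d) ℝ}
    (hΦ : Φ.rank = d) {θ₀ : Fin d → ℝ} (h0 : meanF M π p Φ (kappaMix M π p) θ₀ = 0)
    (huniq : ∀ θ, meanF M π p Φ (kappaMix M π p) θ = 0 → θ = θ₀) (Q : S × A → ℝ) :
    ProjBellman M π p Φ Q ↔ Q = Φ *ᵥ θ₀ := by
  set G := Φᵀ * weightMatrix M π p * Φ with hG
  have hunit : IsUnit G.det := by
    rw [← Matrix.isUnit_iff_isUnit_det, ← Matrix.mulVec_injective_iff_isUnit]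
    intro θ θ' h
    have h1 : G *ᵥ (θ - θ') = 0 := by rw [Matrix.mulVec_sub]; exact sub_eq_zero.2 h
    have h2 := dotProduct_gram (M := M) (π := π) (p := p) Φ (θ - θ')
    rw [← hG, h1, dotProduct_zero] at h2
    exact sub_eq_zero.1 (hE.eq_zero_of_wNormSq_mulVec hΦ h2.ge)
  have key : ∀ θ, meanF M π p Φ (kappaMix M π p) θ = G *ᵥ θ - Φᵀ *ᵥ (weightMatrix M π p *ᵥ
      (M.γ • (pairKernel M π *ᵥ (Φ *ᵥ θ)) + M.cost)) := by
    intro θ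
    rw [hG, ← Matrix.mulVec_mulVec, ← Matrix.mulVec_mulVec, ← Matrix.mulVec_sub,
      ← Matrix.mulVec_sub, meanF]
    congr 1
    funext z
    rw [weightMatrix, Matrix.mulVec_diagonal, bell_eq]
    simp only [Pi.sub_apply, Pi.add_apply, pairWeight, weight]
    ring
  have hproj : ∀ Q, (Φ * G⁻¹ * Φᵀ * weightMatrix M π p) *ᵥ
      (M.γ • (pairKernel M π *ᵥ Q) + M.cost) = Φ *ᵥ (G⁻¹ *ᵥ (Φᵀ *ᵥ (weightMatrix M π p *ᵥ
      (M.γ • (pairKernel M π *ᵥ Q) + M.cost)))) := by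
    intro Q
    simp only [← Matrix.mulVec_mulVec]
  rw [ProjBellman, ← hG, hproj]
  constructor
  · intro h
    set θ := G⁻¹ *ᵥ (Φᵀ *ᵥ (weightMatrix M π p *ᵥ (M.γ • (pairKernel M π *ᵥ Q) + M.cost))) with hθ
    have h1 : G *ᵥ θ = Φᵀ *ᵥ (weightMatrix M π p *ᵥ (M.γ • (pairKernel M π *ᵥ Q) + M.cost)) := by
      rw [hθ, Matrix.mulVec_mulVec, Matrix.mul_nonsing_inv G hunit, Matrix.one_mulVec]
    rw [h, huniq θ]
    rw [key, ← h, h1, sub_self]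
  · rintro rfl
    rw [key, sub_eq_zero] at h0
    rw [← h0, Matrix.mulVec_mulVec (M := G⁻¹), Matrix.nonsing_inv_mul G hunit, Matrix.one_mulVec]

/-- Of the two factors `ω`, one is bounded by the weight, which produces the `W`-norm, and the other
by `c`. For the truncation error `c` is `γ^m`. -/
lemma sum_weight_mul_sq_le (Φ : Matrix (S × A) (Fin d) ℝ) {ω : S × A → ℝ} {c : ℝ} (h0 : ∀ z, 0 ≤ ω z)
    (h1 : ∀ z, ω z ≤ weight M π p z) (h2 : ∀ z, ω z ≤ c) (v : S × A → ℝ) :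
    ∑ i, (Φᵀ *ᵥ fun z => ω z * v z) i ^ 2 ≤ featNorm Φ ^ 2 * (c * wNormSq M π p v) := by
  refine (sum_sq_transpose_mulVec_le Φ _).trans
    (mul_le_mul_of_nonneg_left ?_ (sq_nonneg _))
  rw [wNormSq, Finset.mul_sum]
  refine Finset.sum_le_sum fun z _ => ?_
  have h3 : ω z ^ 2 ≤ c * weight M π p z := by
    rw [sq]
    exact mul_le_mul (h2 z) (h1 z) (h0 z) ((h0 z).trans (h2 z))
  have := mul_le_mul_of_nonneg_right h3 (sq_nonneg (v z))
  nlinarith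

lemma Exploring.pairWeight_kappaTrunc_le {k : ℝ} (hE : Exploring M π p k) (m : ℕ) (z : S × A) :
    pairWeight π p (kappaTrunc M π p m) z ≤ weight M π p z :=
  mul_le_mul_of_nonneg_right (kappaTrunc_le M π hE.f_mem m z.1)
    (perturbed_nonneg hE.eps_pos.le (by linarith [hE.eps_le_quarter]) _ _)

/-! ### Contraction and bias of the mean recursion -/

/-- One step of the linear iteration. -/
lemma Exploring.sum_sq_step_le {k : ℝ} (hE : Exploring M π p k) (Φ : Matrix (S × A) (Fin d) ℝ)
    {κ : S → ℝ} {ι a b : ℝ} {θ : Fin d → ℝ} (hι : 0 < ι)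
    (hι' : 512 * featNorm Φ ^ 2 * ι ≤ 1 - M.γ)
    (ha : (1 - M.γ) * (a * wNormSq M π p (Φ *ᵥ θ)) ≤
      2 * ∑ z, pairWeight π p κ z * bellForm M π (Φ *ᵥ θ) z)
    (hb : ∑ i, bellLin M π p Φ κ θ i ^ 2 ≤
      featNorm Φ ^ 2 * (b * wNormSq M π p (bell M π (Φ *ᵥ θ)))) (hb0 : 0 ≤ b) :
    ∑ i, (θ - ι • bellLin M π p Φ κ θ) i ^ 2 ≤
      ∑ i, θ i ^ 2 - ι * (1 - M.γ) * ((a - b / 100) * wNormSq M π p (Φ *ᵥ θ)) := by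
  have e : ∑ i, (θ - ι • bellLin M π p Φ κ θ) i ^ 2 = ∑ i, θ i ^ 2 -
      ι * (2 * ∑ i, θ i * bellLin M π p Φ κ θ i) + ι ^ 2 * ∑ i, bellLin M π p Φ κ θ i ^ 2 := by
    simp only [Finset.mul_sum, ← Finset.sum_sub_distrib, ← Finset.sum_add_distrib]
    refine Finset.sum_congr rfl fun i _ => ?_
    simp only [Pi.sub_apply, Pi.smul_apply, smul_eq_mul]
    ring
  rw [e, sum_mul_bellLin]
  have h1 : wNormSq M π p (bell M π (Φ *ᵥ θ)) ≤ 5 * wNormSq M π p (Φ *ᵥ θ) :=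
    hE.wNormSq_bellman_le (Φ *ᵥ θ)
  have h0 := wNormSq_nonneg hE (Φ *ᵥ θ)
  set E := wNormSq M π p (Φ *ᵥ θ)
  have h2 : ι ^ 2 * ∑ i, bellLin M π p Φ κ θ i ^ 2 ≤
      ι ^ 2 * (featNorm Φ ^ 2 * (b * (5 * E))) :=
    mul_le_mul_of_nonneg_left (hb.trans (mul_le_mul_of_nonneg_left
      (mul_le_mul_of_nonneg_left h1 hb0) (sq_nonneg _))) (sq_nonneg _)
  -- The quadratic term is at most `5 b / 512` relative to `ι (1 - γ) E`, hence below `b / 100`.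
  have h3 : ι * (b * E) * (512 * featNorm Φ ^ 2 * ι) ≤ ι * (b * E) * (1 - M.γ) :=
    mul_le_mul_of_nonneg_left hι' (by positivity)
  have h4 := mul_le_mul_of_nonneg_left ha hι.le
  have h5 : 0 ≤ ι * (b * E) * (1 - M.γ) :=
    mul_nonneg (by positivity) (by linarith [M.γ_lt_one])
  nlinarith

lemma sum_sq_sub_le {q : ℝ} (hq : 0 < q) (x y : Fin d → ℝ) :
    ∑ i, (x - y) i ^ 2 ≤ (1 + q / 2) * ∑ i, x i ^ 2 + (1 + 2 / q) * ∑ i, y i ^ 2 := by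
  rw [Finset.mul_sum, Finset.mul_sum, ← Finset.sum_add_distrib]
  refine Finset.sum_le_sum fun i _ => ?_
  have h : 0 ≤ q / 2 * (x i + 2 / q * y i) ^ 2 := by positivity
  have e : q / 2 * (x i + 2 / q * y i) ^ 2 =
      q / 2 * x i ^ 2 + 2 * (x i * y i) + 2 / q * y i ^ 2 := by
    field_simp; ring
  simp only [Pi.sub_apply]
  rw [e] at h
  linarith

/-- A contraction with a constant perturbation. -/
lemma sum_sq_perturbed_iterate_le {q R : ℝ} (hq : 0 < q) (hq1 : q ≤ 1)
    {B : (Fin d → ℝ) → Fin d → ℝ} (hB : ∀ x, ∑ i, B x i ^ 2 ≤ (1 - q) * ∑ i, x i ^ 2)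
    {r : Fin d → ℝ} (hr : ∑ i, r i ^ 2 ≤ R) {e : ℕ → Fin d → ℝ}
    (he : ∀ t, e (t + 1) = B (e t) - r) (t : ℕ) :
    ∑ i, e t i ^ 2 ≤ (1 - q / 2) ^ t * ∑ i, e 0 i ^ 2 + 6 * R / q ^ 2 := by
  have hR : 0 ≤ R := (Finset.sum_nonneg fun i _ => sq_nonneg (r i)).trans hr
  induction t with
  | zero =>
    have : 0 ≤ 6 * R / q ^ 2 := by positivity
    simp only [pow_zero, one_mul]
    linarith
  | succ t ih =>
    rw [he]
    have h1 := sum_sq_sub_le hq (B (e t)) r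
    have hx : 0 ≤ ∑ i, e t i ^ 2 := Finset.sum_nonneg fun i _ => sq_nonneg _
    have h2 : (1 + q / 2) * ∑ i, B (e t) i ^ 2 ≤ (1 - q / 2) * ∑ i, e t i ^ 2 := by
      have := mul_le_mul_of_nonneg_left (hB (e t)) (by linarith : 0 ≤ 1 + q / 2)
      nlinarith [mul_nonneg (mul_nonneg hq.le hq.le) hx]
    have h3 : (1 + 2 / q) * ∑ i, r i ^ 2 ≤ 3 / q * R := by
      refine mul_le_mul ?_ hr (Finset.sum_nonneg fun i _ => sq_nonneg _) (by positivity)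
      have : 1 ≤ 1 / q := by rw [le_div_iff₀ hq]; linarith
      have e3 : 3 / q = 1 / q + 2 / q := by ring
      linarith
    have h4 := mul_le_mul_of_nonneg_left ih (by linarith : 0 ≤ 1 - q / 2)
    -- `6 R / q²` is the fixed point of `x ↦ (1 - q/2) x + 3 R / q`.
    have h5 : (1 - q / 2) * (6 * R / q ^ 2) + 3 / q * R = 6 * R / q ^ 2 := by
      field_simp; ring
    rw [pow_succ]
    linarith

/-- Convexity of the square: a bound for every averaged iterate passes to the average. -/
lemma Exploring.wNormSq_average_le {k : ℝ} (hE : Exploring M π p k) {F : Finset ℕ}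
    (hF : F.Nonempty) {v : ℕ → S × A → ℝ} {b : ℝ} (hv : ∀ t ∈ F, wNormSq M π p (v t) ≤ b) :
    wNormSq M π p ((F.card : ℝ)⁻¹ • ∑ t ∈ F, v t) ≤ b := by
  have hc : (0 : ℝ) < F.card := by exact_mod_cast hF.card_pos
  have h1 : wNormSq M π p ((F.card : ℝ)⁻¹ • ∑ t ∈ F, v t) ≤
      (F.card : ℝ)⁻¹ * ∑ t ∈ F, wNormSq M π p (v t) := by
    simp only [wNormSq]
    rw [Finset.sum_comm, Finset.mul_sum]
    refine Finset.sum_le_sum fun z _ => ?_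
    rw [← Finset.mul_sum, mul_left_comm]
    refine mul_le_mul_of_nonneg_left ?_ (hE.weight_pos z).le
    simp only [Pi.smul_apply, Finset.sum_apply, smul_eq_mul]
    have h := sq_sum_le_card_mul_sum_sq (s := F) (f := fun t => v t z)
    rw [mul_pow]
    have h2 := mul_le_mul_of_nonneg_left h (by positivity : 0 ≤ (F.card : ℝ)⁻¹ ^ 2)
    refine h2.trans (le_of_eq ?_)
    field_simp
  refine h1.trans ?_
  have h3 := mul_le_mul_of_nonneg_left (Finset.sum_le_card_nsmul F _ _ hv) (inv_pos.2 hc).le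
  refine h3.trans (le_of_eq ?_)
  rw [nsmul_eq_mul]
  field_simp

lemma perturbed_le_one {ε : ℝ} (h0 : 0 ≤ ε) (h1 : ε ≤ 1) (s : S) (a : A) :
    perturbed π ε s a ≤ 1 := by
  rw [← sum_perturbed π ε s]
  exact Finset.single_le_sum (fun a _ => perturbed_nonneg (π := π) h0 h1 s a) (Finset.mem_univ a)

/-- The solution of the projected Bellman equation has `‖Q‖_W² ≤ (144 / 25) / (1 - γ)²`. -/
lemma Exploring.wNormSq_solution_le {k : ℝ} (hE : Exploring M π p k)
    {Φ : Matrix (S × A) (Fin d) ℝ} {θ₀ : Fin d → ℝ}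
    (h0 : meanF M π p Φ (kappaMix M π p) θ₀ = 0) :
    (1 - M.γ) ^ 2 * wNormSq M π p (Φ *ᵥ θ₀) ≤ 144 / 25 := by
  set Q := Φ *ᵥ θ₀ with hQ
  have h1 : ∑ z, weight M π p z * bellForm M π Q z = ∑ z, weight M π p z * (Q z * M.cost z) := by
    have h2 : θ₀ ⬝ᵥ meanF M π p Φ (kappaMix M π p) θ₀ =
        Q ⬝ᵥ fun z => weight M π p z * (bell M π Q z - M.cost z) := by
      rw [meanF, Matrix.dotProduct_mulVec, Matrix.vecMul_transpose]
      rfl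
    rw [h0, dotProduct_zero] at h2
    rw [← sub_eq_zero, ← Finset.sum_sub_distrib, h2]
    refine Finset.sum_congr rfl fun z _ => ?_
    simp only [bellForm, bell]
    ring
  have h2 : (∑ z, weight M π p z * (Q z * M.cost z)) ^ 2 ≤ wNormSq M π p Q * 1 := by
    have h3 := Finset.sum_sq_le_sum_mul_sum_of_sq_le_mul Finset.univ
      (r := fun z => weight M π p z * (Q z * M.cost z)) (f := fun z => weight M π p z * Q z ^ 2)
      (g := fun z => weight M π p z * M.cost z ^ 2)
      (fun z _ => mul_nonneg (hE.weight_pos z).le (sq_nonneg _))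
      (fun z _ => mul_nonneg (hE.weight_pos z).le (sq_nonneg _)) fun z _ => le_of_eq (by ring)
    refine h3.trans (mul_le_mul_of_nonneg_left ?_ (wNormSq_nonneg hE Q))
    rw [← sum_weight M π p]
    refine Finset.sum_le_sum fun z _ => mul_le_of_le_one_right (hE.weight_pos z).le ?_
    exact pow_le_one₀ (M.cost_mem z).1 (M.cost_mem z).2
  -- Testing the equation with its solution gives `(5/6)(1 - γ) E ≤ 2 √E`, and `144/25 = (12/5)²`.
  have h3 := hE.form_kappaMix_ge Q
  rw [h1] at h3
  have hE0 := wNormSq_nonneg hE Q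
  have hγ : 0 < 1 - M.γ := by linarith [M.γ_lt_one]
  set E := wNormSq M π p Q
  set F := ∑ z, weight M π p z * (Q z * M.cost z)
  rcases hE0.eq_or_lt with h | hpos
  · rw [← h]; norm_num
  · have h4 : 0 ≤ (1 - M.γ) * (5 / 6 * E) := by positivity
    have h5 := pow_le_pow_left₀ h4 h3 2
    have h6 : ((1 - M.γ) ^ 2 * E) * E ≤ 144 / 25 * E := by nlinarith
    exact le_of_mul_le_mul_right h6 hpos

lemma sum_sq_neg_eq (x : Fin d → ℝ) : ∑ i, (-x) i ^ 2 = ∑ i, x i ^ 2 := by simp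

/-- The bias caused by the truncation. -/
lemma Exploring.sum_sq_meanF_kappaTrunc_le {k : ℝ} (hE : Exploring M π p k)
    {Φ : Matrix (S × A) (Fin d) ℝ} {θ₀ : Fin d → ℝ}
    (h0 : meanF M π p Φ (kappaMix M π p) θ₀ = 0) (m : ℕ) :
    ∑ i, meanF M π p Φ (kappaTrunc M π p m) θ₀ i ^ 2 ≤
      60 * featNorm Φ ^ 2 * M.γ ^ m / (1 - M.γ) ^ 2 := by
  have hε0 := hE.eps_pos
  have hε1 := hE.eps_le_quarter
  have hγ : 0 < 1 - M.γ := by linarith [M.γ_lt_one]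
  set Q := Φ *ᵥ θ₀ with hQ
  set ω : S × A → ℝ := fun z => weight M π p z - pairWeight π p (kappaTrunc M π p m) z with hω
  have h1 : meanF M π p Φ (kappaTrunc M π p m) θ₀ =
      -(Φᵀ *ᵥ fun z => ω z * (bell M π Q z - M.cost z)) := by
    -- Since `θ₀` annihilates the full operator, its image under the truncated one involves only the
    -- removed weights `ω`.
    rw [← sub_zero (meanF M π p Φ (kappaTrunc M π p m) θ₀), ← h0, meanF, meanF,
      ← Matrix.mulVec_sub, ← Matrix.mulVec_neg]
    congr 1
    funext z
    simp only [Pi.sub_apply, Pi.neg_apply, hω, weight, pairWeight]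
    ring
  have hω0 : ∀ z, 0 ≤ ω z := fun z => sub_nonneg.2 (hE.pairWeight_kappaTrunc_le m z)
  have hω1 : ∀ z, ω z ≤ weight M π p z := fun z => sub_le_self _
    (pairWeight_nonneg hε0.le (by linarith) (kappaTrunc_nonneg M π hE.f_mem m) z)
  have hω2 : ∀ z, ω z ≤ M.γ ^ m := fun z => by
    have e : ω z = (kappaMix M π p z.1 - kappaTrunc M π p m z.1) *
        perturbed π p.epsA z.1 z.2 := by
      simp only [hω, weight, pairWeight]; ring
    have h2 : ∀ s, 0 ≤ kappaMix M π p s - kappaTrunc M π p m s := fun s =>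
      sub_nonneg.2 (kappaTrunc_le M π hE.f_mem m s)
    rw [e, ← sum_kappaMix_sub M π p m]
    refine (mul_le_of_le_one_right (h2 _)
      (perturbed_le_one hε0.le (by linarith) _ _)).trans ?_
    exact Finset.single_le_sum (f := fun s => kappaMix M π p s - kappaTrunc M π p m s)
      (fun s _ => h2 s) (Finset.mem_univ z.1)
  rw [h1, sum_sq_neg_eq]
  refine (sum_weight_mul_sq_le Φ hω0 hω1 hω2 _).trans ?_
  have h2 : wNormSq M π p (fun z => bell M π Q z - M.cost z) ≤
      2 * wNormSq M π p (bell M π Q) + 2 := by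
    have h3 : wNormSq M π p (fun z => bell M π Q z - M.cost z) ≤
        ∑ z, (2 * (weight M π p z * bell M π Q z ^ 2) + 2 * weight M π p z) := by
      refine Finset.sum_le_sum fun z _ => ?_
      have h4 : M.cost z ^ 2 ≤ 1 := pow_le_one₀ (M.cost_mem z).1 (M.cost_mem z).2
      have h5 : (bell M π Q z - M.cost z) ^ 2 ≤ 2 * bell M π Q z ^ 2 + 2 := by
        nlinarith [sq_nonneg (bell M π Q z + M.cost z)]
      have := mul_le_mul_of_nonneg_left h5 (hE.weight_pos z).le
      linarith
    refine h3.trans (le_of_eq ?_)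
    rw [Finset.sum_add_distrib, ← Finset.mul_sum, ← Finset.mul_sum, sum_weight, mul_one]
    rfl
  have h3 : wNormSq M π p (bell M π Q) ≤ 5 * wNormSq M π p Q := hE.wNormSq_bellman_le Q
  have h4 := hE.wNormSq_solution_le h0
  have h5 : wNormSq M π p (fun z => bell M π Q z - M.cost z) ≤ 60 / (1 - M.γ) ^ 2 := by
    rw [le_div_iff₀ (by positivity)]
    have h6 : (1 - M.γ) ^ 2 ≤ 1 := pow_le_one₀ hγ.le (by linarith [M.γ_nonneg])
    have h7 := mul_le_mul_of_nonneg_right (h2.trans (by linarith :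
      _ ≤ 10 * wNormSq M π p Q + 2)) (sq_nonneg (1 - M.γ))
    nlinarith
  have h6 := mul_le_mul_of_nonneg_left h5
    (by have := M.γ_nonneg; positivity : 0 ≤ featNorm Φ ^ 2 * M.γ ^ m)
  calc _ = featNorm Φ ^ 2 * M.γ ^ m * wNormSq M π p (fun z => bell M π Q z - M.cost z) := by ring
    _ ≤ _ := h6
    _ = _ := by ring

/-- The error of the averaged iteration, under a coercivity assumption with constant `a`. -/
lemma Exploring.sum_sq_error_le {k : ℝ} (hE : Exploring M π p k) (hd : 0 < d)
    {Φ : Matrix (S × A) (Fin d) ℝ} (hΦ : Φ.rank = d) {ι a : ℝ} (hι : 0 < ι)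
    (hι' : 512 * featNorm Φ ^ 2 * ι ≤ 1 - M.γ) {θ₀ : Fin d → ℝ}
    (h0 : meanF M π p Φ (kappaMix M π p) θ₀ = 0) {m : ℕ} (ha0 : 0 < a) (ha1 : a ≤ 1)
    (ha : ∀ θ, (1 - M.γ) * ((a + 1 / 100) * wNormSq M π p (Φ *ᵥ θ)) ≤
      2 * ∑ z, pairWeight π p (kappaTrunc M π p m) z * bellForm M π (Φ *ᵥ θ) z)
    {θ : ℕ → Fin d → ℝ} (hθ0 : θ 0 = 0)
    (hθ : ∀ t, θ (t + 1) = θ t - ι • meanF M π p Φ (kappaTrunc M π p m) (θ t)) (t : ℕ) :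
    ∑ i, (θ t - θ₀) i ^ 2 ≤ (1 - a * ((1 - M.γ) * ι * lamMin M π p Φ) / 2) ^ t *
        (144 / 25 / ((1 - M.γ) ^ 2 * lamMin M π p Φ)) +
      360 / a ^ 2 * (featNorm Φ ^ 2 * M.γ ^ m / ((1 - M.γ) ^ 4 * lamMin M π p Φ ^ 2)) := by
  have hγ : 0 < 1 - M.γ := by linarith [M.γ_lt_one]
  have hγ1 : 1 - M.γ ≤ 1 := by linarith [M.γ_nonneg]
  have hμ := hE.lamMin_pos hd hΦ
  have hμΩ := hE.lamMin_le hd Φ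
  set μ := lamMin M π p Φ with hμdef
  set κ := kappaTrunc M π p m with hκ
  set q := a * ((1 - M.γ) * ι * μ) with hq
  have hq0 : 0 < q := by positivity
  have hιμ : ι * μ ≤ 1 := by
    have : ι * μ ≤ ι * featNorm Φ ^ 2 := mul_le_mul_of_nonneg_left hμΩ hι.le
    nlinarith
  have hq1 : q ≤ 1 := by
    have h1 : (1 - M.γ) * (ι * μ) ≤ 1 := mul_le_one₀ hγ1 (by positivity) hιμ
    have h2 : a * ((1 - M.γ) * (ι * μ)) ≤ 1 := mul_le_one₀ ha1 (by positivity) h1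
    rw [hq]; linarith
  have hκle : ∀ z, pairWeight π p κ z ≤ weight M π p z := hE.pairWeight_kappaTrunc_le m
  have hκ0 : ∀ z, 0 ≤ pairWeight π p κ z := pairWeight_nonneg hE.eps_pos.le
    (by linarith [hE.eps_le_quarter]) (kappaTrunc_nonneg M π hE.f_mem m)
  have hB : ∀ x : Fin d → ℝ, ∑ i, (x - ι • bellLin M π p Φ κ x) i ^ 2 ≤
      (1 - q) * ∑ i, x i ^ 2 := by
    intro x
    have h1 := hE.sum_sq_step_le Φ hι hι' (ha x) (b := 1)
      (sum_weight_mul_sq_le Φ hκ0 hκle (fun z => (hκle z).trans (hE.weight_le_one z)) _)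
      zero_le_one
    have h2 : ι * (1 - M.γ) * (a * (μ * ∑ i, x i ^ 2)) ≤
        ι * (1 - M.γ) * (a * wNormSq M π p (Φ *ᵥ x)) :=
      mul_le_mul_of_nonneg_left (mul_le_mul_of_nonneg_left (lamMin_mul_le Φ x) ha0.le)
        (by positivity)
    rw [hq]
    linarith
  have hr : ∑ i, (ι • meanF M π p Φ κ θ₀) i ^ 2 ≤
      ι ^ 2 * (60 * featNorm Φ ^ 2 * M.γ ^ m / (1 - M.γ) ^ 2) := by
    have h1 := mul_le_mul_of_nonneg_left (hE.sum_sq_meanF_kappaTrunc_le h0 m) (sq_nonneg ι)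
    refine le_trans (le_of_eq ?_) h1
    rw [Finset.mul_sum]
    exact Finset.sum_congr rfl fun i _ => by simp only [Pi.smul_apply, smul_eq_mul]; ring
  have he : ∀ t, θ (t + 1) - θ₀ = ((θ t - θ₀) - ι • bellLin M π p Φ κ (θ t - θ₀)) -
      ι • meanF M π p Φ κ θ₀ := by
    intro t
    rw [hθ, meanF_eq_add Φ κ (θ t) θ₀, smul_add]
    abel
  have h1 := sum_sq_perturbed_iterate_le hq0 hq1 hB hr (e := fun t => θ t - θ₀) he t
  refine h1.trans (add_le_add ?_ (le_of_eq ?_))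
  · refine mul_le_mul_of_nonneg_left ?_ (pow_nonneg (by linarith) t)
    rw [hθ0, zero_sub, sum_sq_neg_eq, le_div_iff₀ (by positivity)]
    have h2 := hE.wNormSq_solution_le h0
    have h3 := mul_le_mul_of_nonneg_left (lamMin_mul_le (M := M) (π := π) (p := p) Φ θ₀)
      (sq_nonneg (1 - M.γ))
    linarith
  · rw [hq]
    field_simp
    ring

/-- With a single state the truncation only rescales the weights. -/
lemma Exploring.sum_sq_error_le_of_card_eq_one {k : ℝ} (hE : Exploring M π p k) (hd : 0 < d)
    (hS : Fintype.card S = 1)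
    {Φ : Matrix (S × A) (Fin d) ℝ} (hΦ : Φ.rank = d) {ι : ℝ} (hι : 0 < ι)
    (hι' : 512 * featNorm Φ ^ 2 * ι ≤ 1 - M.γ) {θ₀ : Fin d → ℝ}
    (h0 : meanF M π p Φ (kappaMix M π p) θ₀ = 0) {m : ℕ}
    {θ : ℕ → Fin d → ℝ} (hθ0 : θ 0 = 0)
    (hθ : ∀ t, θ (t + 1) = θ t - ι • meanF M π p Φ (kappaTrunc M π p m) (θ t)) (t : ℕ) :
    ∑ i, (θ t - θ₀) i ^ 2 ≤ 144 / 25 / ((1 - M.γ) ^ 2 * lamMin M π p Φ) := by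
  have hγ : 0 < 1 - M.γ := by linarith [M.γ_lt_one]
  have hμ := hE.lamMin_pos hd hΦ
  set b := 1 - M.γ ^ m with hb
  have hb0 : 0 ≤ b := sub_nonneg.2 (pow_le_one₀ M.γ_nonneg M.γ_lt_one.le)
  have hb1 : b ≤ 1 := sub_le_self _ (pow_nonneg M.γ_nonneg m)
  have hsub : ∀ s : S, s = p.sor := fun s =>
    (Fintype.card_le_one_iff_subsingleton.1 hS.le).elim s _
  have hsum : ∀ g : S → ℝ, ∑ s, g s = g p.sor := fun g =>
    Fintype.sum_eq_single p.sor fun s hs => absurd (hsub s) hs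
  have hκ : kappaTrunc M π p m = fun s => b * kappaMix M π p s := by
    funext s
    have h1 := sum_kappaTrunc M π p m
    have h2 := sum_kappaMix M π p
    rw [hsum] at h1 h2
    rw [hsub s, h1, h2, mul_one]
  have hw : ∀ z, pairWeight π p (kappaTrunc M π p m) z = b * weight M π p z := fun z => by
    rw [hκ, pairWeight, weight, mul_assoc]
  have hF0 : meanF M π p Φ (kappaTrunc M π p m) θ₀ = 0 := by
    have : meanF M π p Φ (kappaTrunc M π p m) θ₀ = b • meanF M π p Φ (kappaMix M π p) θ₀ := by
      rw [meanF, meanF, ← Matrix.mulVec_smul]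
      congr 1
      funext z
      rw [hw z]
      simp only [Pi.smul_apply, smul_eq_mul, weight, pairWeight]
      ring
    rw [this, h0, smul_zero]
  induction t with
  | zero =>
    rw [hθ0, zero_sub, sum_sq_neg_eq, le_div_iff₀ (by positivity)]
    have h2 := hE.wNormSq_solution_le h0
    have h3 := mul_le_mul_of_nonneg_left (lamMin_mul_le (M := M) (π := π) (p := p) Φ θ₀)
      (sq_nonneg (1 - M.γ))
    linarith
  | succ t ih =>
    refine le_trans ?_ ih
    have he : θ (t + 1) - θ₀ = (θ t - θ₀) -
        ι • bellLin M π p Φ (kappaTrunc M π p m) (θ t - θ₀) := by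
      rw [hθ, meanF_eq_add Φ _ (θ t) θ₀, hF0, add_zero]
      abel
    rw [he]
    have hκle : ∀ z, pairWeight π p (kappaTrunc M π p m) z ≤ weight M π p z :=
      hE.pairWeight_kappaTrunc_le m
    have hκ0 : ∀ z, 0 ≤ pairWeight π p (kappaTrunc M π p m) z :=
      pairWeight_nonneg hE.eps_pos.le (by linarith [hE.eps_le_quarter])
        (kappaTrunc_nonneg M π hE.f_mem m)
    have hform : (1 - M.γ) * (b * (5 / 6) * wNormSq M π p (Φ *ᵥ (θ t - θ₀))) ≤
        2 * ∑ z, pairWeight π p (kappaTrunc M π p m) z * bellForm M π (Φ *ᵥ (θ t - θ₀)) z := by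
      have h1 := mul_le_mul_of_nonneg_left (hE.form_kappaMix_ge (Φ *ᵥ (θ t - θ₀))) hb0
      have h2 : ∑ z, pairWeight π p (kappaTrunc M π p m) z * bellForm M π (Φ *ᵥ (θ t - θ₀)) z =
          b * ∑ z, weight M π p z * bellForm M π (Φ *ᵥ (θ t - θ₀)) z := by
        rw [Finset.mul_sum]
        exact Finset.sum_congr rfl fun z _ => by rw [hw z, mul_assoc]
      rw [h2]
      linarith
    have h1 := hE.sum_sq_step_le Φ hι hι' hform (b := b)
      (sum_weight_mul_sq_le Φ hκ0 hκle
        (fun z => by rw [hw z]; exact mul_le_of_le_one_right hb0 (hE.weight_le_one z)) _) hb0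
    refine h1.trans (sub_le_self _ (mul_nonneg (by positivity) (mul_nonneg (by linarith)
      (wNormSq_nonneg hE _))))

/-! ### Comparison with the two terms of the bound -/

lemma one_sub_pow_le_half_pow {x : ℝ} (hx0 : 0 ≤ x) (hx1 : x ≤ 1) {T : ℕ} (hT : 1 ≤ T * x) {N t : ℕ}
    (ht : N ≤ t) : (1 - x) ^ t ≤ (1 / 2 : ℝ) ^ (N / T) := by
  have h0 : 0 ≤ 1 - x := by linarith
  have h1 : (1 - x) ^ T ≤ 1 / 2 := by
    have h2 : (1 - x) ^ T ≤ Real.exp (-x) ^ T :=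
      pow_le_pow_left₀ h0 (Real.one_sub_le_exp_neg x) T
    rw [← Real.exp_nat_mul] at h2
    have h3 : Real.exp (T * -x) ≤ Real.exp (-1) := Real.exp_le_exp.2 (by linarith)
    have h4 : Real.exp (-1) ≤ 1 / 2 := by
      rw [Real.exp_neg, one_div]
      exact inv_anti₀ (by norm_num) (by linarith [Real.add_one_le_exp (1 : ℝ)])
    exact h2.trans (h3.trans h4)
  calc (1 - x) ^ t ≤ (1 - x) ^ (T * (N / T)) :=
        pow_le_pow_of_le_one h0 (by linarith) ((Nat.mul_div_le N T).trans ht)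
    _ = ((1 - x) ^ T) ^ (N / T) := pow_mul _ _ _
    _ ≤ _ := pow_le_pow_left₀ (pow_nonneg h0 T) h1 _

/-- The second term of the error bound in terms of the relative size of the truncation. -/
lemma second_term_ge {g ι μ O2 s T c : ℝ} (hg : 0 < g) (hg1 : g ≤ 1) (hι : 0 < ι) (hμ : 0 < μ)
    (hO : 0 < O2) (hs : 0 ≤ s) (hc : 0 ≤ c) (hι' : 512 * O2 * ι ≤ g) (hT : 8 / (g * ι * μ) ≤ T) :
    10 ^ 8 * (s * O2 * c / μ) * (O2 ^ 2 / (g ^ 4 * μ ^ 2)) ≤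
      786 * O2 * T ^ 2 * (6 * ι * s * O2 * c / μ * (1 + 2 * ι * s * O2 * c)) / g ^ 2 := by
  have h1 : (8 / (g * ι * μ)) ^ 2 ≤ T ^ 2 := pow_le_pow_left₀ (by positivity) hT 2
  have h2 : 6 * ι * s * O2 * c / μ * 1 ≤
      6 * ι * s * O2 * c / μ * (1 + 2 * ι * s * O2 * c) :=
    mul_le_mul_of_nonneg_left (by linarith [show 0 ≤ 2 * ι * s * O2 * c by positivity])
      (by positivity)
  have h3 : 786 * O2 * (8 / (g * ι * μ)) ^ 2 * (6 * ι * s * O2 * c / μ * 1) / g ^ 2 ≤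
      -- The lower bound for the epoch length gives `786 · 64 · 6 = 301824` and leaves a factor `1 /
      -- ι ≥ 512 Ω²`. Their product exceeds `10^8`.
      786 * O2 * T ^ 2 * (6 * ι * s * O2 * c / μ * (1 + 2 * ι * s * O2 * c)) / g ^ 2 := by
    gcongr
  refine le_trans ?_ h3
  have e1 : 786 * O2 * (8 / (g * ι * μ)) ^ 2 * (6 * ι * s * O2 * c / μ * 1) / g ^ 2 =
      301824 * (s * O2 * c / μ) * (O2 / (g ^ 4 * μ ^ 2)) * (1 / ι) := by
    field_simp; ring
  have h4 : 512 * O2 ≤ 1 / ι := by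
    rw [le_div_iff₀ hι]; linarith
  have e2 : 10 ^ 8 * (s * O2 * c / μ) * (O2 ^ 2 / (g ^ 4 * μ ^ 2)) =
      10 ^ 8 * (s * O2 * c / μ) * (O2 / (g ^ 4 * μ ^ 2)) * O2 := by ring
  rw [e1, e2]
  have h5 : 0 ≤ (s * O2 * c / μ) * (O2 / (g ^ 4 * μ ^ 2)) := by positivity
  have h6 := mul_le_mul_of_nonneg_left h4 (mul_nonneg (by norm_num : (0 : ℝ) ≤ 301824) h5)
  have h7 : 0 ≤ (s * O2 * c / μ) * (O2 / (g ^ 4 * μ ^ 2)) * O2 := by positivity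
  nlinarith

/-- Coercivity with truncated weights when there are at least two states. -/
lemma Exploring.form_kappaTrunc_ge_of_two_le {k : ℝ} (hE : Exploring M π p k) {u : S × A → ℝ}
    {m : ℕ} (hS : 2 ≤ Fintype.card S)
    (hm : √(Fintype.card S : ℝ) * (M.γ ^ m * ∑ z, u z ^ 2) ≤ wNormSq M π p u) :
    (1 - M.γ) * (1 / 20 * wNormSq M π p u) ≤
      2 * ∑ z, pairWeight π p (kappaTrunc M π p m) z * bellForm M π u z := by
  rcases hS.eq_or_lt with h | h
  · exact hE.form_kappaTrunc_ge_of_two h.symm hm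
  · exact hE.form_kappaTrunc_ge_of_three_le h hm

lemma Exploring.iterate_error_le {k : ℝ} (hE : Exploring M π p k) (hd : 0 < d)
    {Φ : Matrix (S × A) (Fin d) ℝ} (hΦ : Φ.rank = d) {ι : ℝ} (hι : 0 < ι)
    (hι' : 512 * featNorm Φ ^ 2 * ι ≤ 1 - M.γ) {θ₀ : Fin d → ℝ}
    (h0 : meanF M π p Φ (kappaMix M π p) θ₀ = 0)
    (hm : √(Fintype.card S : ℝ) * featNorm Φ ^ 2 * M.γ ^ p.m ≤ lamMin M π p Φ)
    {θ : ℕ → Fin d → ℝ} (hθ0 : θ 0 = 0)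
    (hθ : ∀ t, θ (t + 1) = θ t - ι • meanF M π p Φ (kappaTrunc M π p p.m) (θ t)) {N t : ℕ}
    (ht : N ≤ t) :
    wNormSq M π p (Φ *ᵥ (θ t - θ₀)) ≤
      (1 / 2 : ℝ) ^ (N / epochLen M π p Φ ι) * (16 * featNorm Φ ^ 2) /
          ((1 - M.γ) ^ 2 * lamMin M π p Φ) +
        786 * featNorm Φ ^ 2 * (epochLen M π p Φ ι : ℝ) ^ 2 * C2 M π p Φ ι / (1 - M.γ) ^ 2 := by
  have hg : 0 < 1 - M.γ := by linarith [M.γ_lt_one]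
  have hg1 : 1 - M.γ ≤ 1 := by linarith [M.γ_nonneg]
  have hμ := hE.lamMin_pos hd hΦ
  have hμO := hE.lamMin_le hd Φ
  have hc : 0 ≤ M.γ ^ p.m := pow_nonneg M.γ_nonneg _
  have hne : Nonempty S := ⟨p.sor⟩
  have hs : 1 ≤ √(Fintype.card S : ℝ) := by
    rw [Real.one_le_sqrt]; exact_mod_cast Fintype.card_pos
  have hT : 8 / ((1 - M.γ) * ι * lamMin M π p Φ) ≤ epochLen M π p Φ ι := Nat.le_ceil _
  have hO : 0 < featNorm Φ ^ 2 := hμ.trans_le hμO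
  have hD := second_term_ge hg hg1 hι hμ hO (zero_le_one.trans hs) hc hι' hT
  have hgram : ∀ x, lamMin M π p Φ * ∑ i, x i ^ 2 ≤ wNormSq M π p (Φ *ᵥ x) := lamMin_mul_le Φ
  have hop := sum_sq_mulVec_le Φ
  have herr := hE.wNormSq_mulVec_le Φ (θ t - θ₀)
  refine herr.trans ?_
  rw [C2]
  set T := epochLen M π p Φ ι
  set μ := lamMin M π p Φ
  set O2 := featNorm Φ ^ 2
  set s := √(Fintype.card S : ℝ)
  set c := M.γ ^ p.m
  set g := 1 - M.γ
  set D := 786 * O2 * (T : ℝ) ^ 2 * (6 * ι * s * O2 * c / μ * (1 + 2 * ι * s * O2 * c)) / g ^ 2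
  set η := s * O2 * c / μ with hη
  set b := O2 ^ 2 / (g ^ 4 * μ ^ 2) with hb
  have hb0 : 0 ≤ b := by positivity
  have hη0 : 0 ≤ η := by positivity
  have hηc : c ≤ η := by
    rw [hη, le_div_iff₀ hμ]
    have : μ ≤ s * O2 := by nlinarith
    nlinarith
  have hb1 : O2 * (144 / 25 / (g ^ 2 * μ)) ≤ 6 * b := by
    have h1 : O2 * (144 / 25 / (g ^ 2 * μ)) = 144 / 25 * b * (g ^ 2 * (μ / O2)) := by
      rw [hb]; field_simp
    have h2 : g ^ 2 * (μ / O2) ≤ 1 :=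
      mul_le_one₀ (pow_le_one₀ hg.le hg1) (by positivity) ((div_le_one hO).2 hμO)
    rw [h1]
    nlinarith [mul_le_mul_of_nonneg_left h2 (by positivity : 0 ≤ 144 / 25 * b)]
  have hfirst : 0 ≤ (1 / 2 : ℝ) ^ (N / T) * (16 * O2) / (g ^ 2 * μ) := by positivity
  have hterm : O2 * (O2 * c / (g ^ 4 * μ ^ 2)) ≤ η * b := by
    have : O2 * (O2 * c / (g ^ 4 * μ ^ 2)) = c * b := by rw [hb]; ring
    rw [this]
    exact mul_le_mul_of_nonneg_right hηc hb0
  have hx0 : 0 < g * ι * μ := by positivity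
  have hx1 : g * ι * μ ≤ 1 := by
    have h1 : ι * μ ≤ 1 := by nlinarith [mul_le_mul_of_nonneg_left hμO hι.le]
    have := mul_le_one₀ hg1 (by positivity) h1
    linarith
  -- For small `η` the decay over epochs must be kept, and the bias is at most `1440 η b`. For large
  -- `η` the term `D ≥ 10^8 η b` dominates the whole error without any decay in `t`.
  rcases le_or_gt η (1 / 10) with hsmall | hlarge
  · have hm' : 10 * (O2 * c) ≤ μ := by
      rw [hη, div_le_iff₀ hμ] at hsmall
      nlinarith [mul_nonneg hO.le hc]
    have ha : ∀ x, g * ((1 / 2 + 1 / 100) * wNormSq M π p (Φ *ᵥ x)) ≤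
        2 * ∑ z, pairWeight π p (kappaTrunc M π p p.m) z * bellForm M π (Φ *ᵥ x) z := by
      intro x
      have h1 : 10 * (c * ∑ z, (Φ *ᵥ x) z ^ 2) ≤ wNormSq M π p (Φ *ᵥ x) := by
        have hx : 0 ≤ ∑ i, x i ^ 2 := Finset.sum_nonneg fun i _ => sq_nonneg _
        have h2 := mul_le_mul_of_nonneg_left (hop x) hc
        have h3 := mul_le_mul_of_nonneg_right hm' hx
        have h4 := hgram x
        linarith
      refine le_trans (mul_le_mul_of_nonneg_left ?_ hg.le) (hE.form_kappaTrunc_ge_of_small h1)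
      have := wNormSq_nonneg hE (Φ *ᵥ x)
      linarith
    have h1 : ∑ i, (θ t - θ₀) i ^ 2 ≤ (1 - 1 / 2 * (g * ι * μ) / 2) ^ t *
        (144 / 25 / (g ^ 2 * μ)) + 360 / (1 / 2) ^ 2 * (O2 * c / (g ^ 4 * μ ^ 2)) :=
        hE.sum_sq_error_le hd hΦ hι hι' h0 (a := 1 / 2) (by norm_num) (by norm_num) ha
      hθ0 hθ t
    have h2 : (1 - 1 / 2 * (g * ι * μ) / 2) ^ t ≤ (1 / 2 : ℝ) ^ (N / T) := by
      have hT' : 8 ≤ T * (g * ι * μ) := by rwa [div_le_iff₀ hx0] at hT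
      exact one_sub_pow_le_half_pow (by positivity) (by linarith) (by linarith) ht
    have h3 := mul_le_mul_of_nonneg_left h1 hO.le
    have h4 : O2 * ((1 - 1 / 2 * (g * ι * μ) / 2) ^ t * (144 / 25 / (g ^ 2 * μ))) ≤
        (1 / 2 : ℝ) ^ (N / T) * (16 * O2) / (g ^ 2 * μ) := by
      have h5 := mul_le_mul_of_nonneg_right h2
        (by positivity : 0 ≤ O2 * (144 / 25 / (g ^ 2 * μ)))
      have h6 : (1 / 2 : ℝ) ^ (N / T) * (O2 * (144 / 25 / (g ^ 2 * μ))) =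
          144 / 400 * ((1 / 2 : ℝ) ^ (N / T) * (16 * O2) / (g ^ 2 * μ)) := by
        field_simp; ring
      rw [h6] at h5
      linarith
    have h7 : 0 ≤ η * b := by positivity
    rw [mul_add] at h3
    linarith
  · have hηb : b ≤ 10 * (η * b) := by nlinarith
    rcases Nat.lt_or_ge (Fintype.card S) 2 with hS | hS
    · have hS1 : Fintype.card S = 1 := by
        have := Fintype.card_pos (α := S)
        omega
      have h1 := hE.sum_sq_error_le_of_card_eq_one hd hS1 hΦ hι hι' h0 hθ0 hθ t
      have h2 := mul_le_mul_of_nonneg_left h1 hO.le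
      linarith
    -- Here `1/25 + 1/100 = 1/20` is the constant of the coercivity bound for at least two states.
    -- It yields a bias of at most `225000 η b`.
    · have ha : ∀ x, g * ((1 / 25 + 1 / 100) * wNormSq M π p (Φ *ᵥ x)) ≤
          2 * ∑ z, pairWeight π p (kappaTrunc M π p p.m) z * bellForm M π (Φ *ᵥ x) z := by
        intro x
        have h1 : s * (c * ∑ z, (Φ *ᵥ x) z ^ 2) ≤ wNormSq M π p (Φ *ᵥ x) := by
          have hx : 0 ≤ ∑ i, x i ^ 2 := Finset.sum_nonneg fun i _ => sq_nonneg _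
          have h2 := mul_le_mul_of_nonneg_left (hop x)
            (mul_nonneg (zero_le_one.trans hs) hc)
          have h3 := mul_le_mul_of_nonneg_right hm hx
          have h4 := hgram x
          linarith
        refine le_trans (le_of_eq ?_) (hE.form_kappaTrunc_ge_of_two_le hS h1)
        norm_num [g]
      have h1 : ∑ i, (θ t - θ₀) i ^ 2 ≤ (1 - 1 / 25 * (g * ι * μ) / 2) ^ t *
        (144 / 25 / (g ^ 2 * μ)) + 360 / (1 / 25) ^ 2 * (O2 * c / (g ^ 4 * μ ^ 2)) :=
        hE.sum_sq_error_le hd hΦ hι hι' h0 (a := 1 / 25) (by norm_num) (by norm_num) ha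
        hθ0 hθ t
      have h2 : (1 - 1 / 25 * (g * ι * μ) / 2) ^ t ≤ 1 :=
        pow_le_one₀ (by linarith) (by linarith)
      have h3 := mul_le_mul_of_nonneg_left h1 hO.le
      have h4 := mul_le_mul_of_nonneg_right h2
        (by positivity : 0 ≤ O2 * (144 / 25 / (g ^ 2 * μ)))
      rw [mul_add] at h3
      linarith

lemma mulVec_average_sub (Φ : Matrix (S × A) (Fin d) ℝ) (θ : ℕ → Fin d → ℝ) (θ₀ : Fin d → ℝ)
    {F : Finset ℕ} (hF : F.Nonempty) :
    (F.card : ℝ)⁻¹ • ∑ t ∈ F, Φ *ᵥ θ t - Φ *ᵥ θ₀ =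
      (F.card : ℝ)⁻¹ • ∑ t ∈ F, Φ *ᵥ (θ t - θ₀) := by
  have hc : (F.card : ℝ) ≠ 0 := by exact_mod_cast hF.card_pos.ne'
  simp only [Matrix.mulVec_sub, Finset.sum_sub_distrib, Finset.sum_const, smul_sub]
  rw [← Nat.cast_smul_eq_nsmul ℝ, smul_smul, inv_mul_cancel₀ hc, one_smul]

end CTD

/-! ### The law of one round -/

namespace CTD

open scoped Matrix

set_option linter.unusedSectionVars false

lemma hasSum_indicator_range {β γ : Type*} {j : β → γ} (hj : Function.Injective j) {f : γ → ℝ} {c : ℝ}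
    (h : HasSum (fun b => f (j b)) c) : HasSum (Set.indicator (Set.range j) f) c := by
  rw [← hj.hasSum_iff fun x hx => Set.indicator_of_notMem hx f]
  refine h.congr_fun fun b => ?_
  simp

/-- A sum over lists splits into the empty list and the possible heads. This is first-step analysis
for trajectories. -/
lemma hasSum_list {α : Type*} [Fintype α] {f : List α → ℝ} {c : α → ℝ}
    (h : ∀ a, HasSum (fun l => f (a :: l)) (c a)) : HasSum f (f [] + ∑ a, c a) := by
  classical
  have h1 := (hasSum_ite_eq ([] : List α) (f [])).add (hasSum_sum (s := Finset.univ) fun a _ =>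
    hasSum_indicator_range (List.cons_injective (a := a)) (h a))
  refine h1.congr_fun fun l => ?_
  cases l with
  | nil => simp
  | cons b l => simp [Set.indicator_apply, eq_comm (b := b)]

lemma hasSum_mul_prod {α β : Type*} {f : α → ℝ} {g : β → ℝ} {s t : ℝ} (hf : HasSum f s)
    (hg : HasSum g t) : HasSum (fun x : α × β => f x.1 * g x.2) (s * t) :=
  hf.mul hg (summable_mul_of_summable_norm hf.summable.norm hg.summable.norm)

variable {S A : Type*} [Fintype S] [Fintype A] [DecidableEq S] [DecidableEq A] {d : ℕ}

lemma hasSum_round {f : Round S A → ℝ} {c₀ : ℝ} {c : S × A × S × A → ℝ}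
    (h0 : HasSum (fun t => f (.skip t)) c₀)
    (h : ∀ q, HasSum (fun el : List (A × S) × List (A × S) =>
      f (.full q.1 el.1 el.2 q.2.1 q.2.2.1 q.2.2.2)) (c q)) : HasSum f (c₀ + ∑ q, c q) := by
  have hinj : ∀ q : S × A × S × A, Function.Injective
      fun el : List (A × S) × List (A × S) =>
        (Round.full q.1 el.1 el.2 q.2.1 q.2.2.1 q.2.2.2 : Round S A) := by
    rintro q ⟨e, l⟩ ⟨e', l'⟩ heq
    simp only [Round.full.injEq] at heq
    simp [heq.2.1, heq.2.2.1]
  have h1 := (hasSum_indicator_range (j := (Round.skip : ℕ → Round S A))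
    (fun a b h => by simpa using h) h0).add
    (hasSum_sum (s := Finset.univ) fun q _ => hasSum_indicator_range (hinj q) (h q))
  refine h1.congr_fun fun b => ?_
  cases b with
  | skip t => simp
  | full g e l a s' a' =>
    rw [Finset.sum_eq_single (g, a, s', a')]
    · simp
    · rintro ⟨g₂, a₂, s₂, a₂'⟩ - hne
      refine Set.indicator_of_notMem ?_ f
      rintro ⟨el, heq⟩
      simp only [Round.full.injEq] at heq
      exact hne (by simp [heq])
    · simp

section paths

variable (M : MDP S A) (π : Policy S A)

lemma hasSum_pathProb (F : S → ℝ) (t : ℕ) (x : S) :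
    HasSum (fun l : List (A × S) =>
      if l.length = t then pathProb M π.prob x l * F (endState x l) else 0)
      ((stateKernel M π ^ t *ᵥ F) x) := by
  induction t generalizing x with
  | zero =>
    have h := hasSum_list (α := A × S) (f := fun l =>
      if l.length = 0 then pathProb M π.prob x l * F (endState x l) else 0) (c := fun _ => 0)
      (fun a => by simp)
    simpa [pathProb, endState] using h
  | succ t ih =>
    have h := hasSum_list (α := A × S) (f := fun l =>
      if l.length = t + 1 then pathProb M π.prob x l * F (endState x l) else 0)
      (c := fun ay => π.prob x ay.1 * M.P x ay.1 ay.2 * (stateKernel M π ^ t *ᵥ F) ay.2)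
      (fun ay => by
        refine ((ih ay.2).mul_left (π.prob x ay.1 * M.P x ay.1 ay.2)).congr_fun fun l => ?_
        simp only [List.length_cons, Nat.add_right_cancel_iff, pathProb, endState, mul_ite,
          mul_zero, mul_assoc])
    convert h using 1
    rw [pow_succ', ← Matrix.mulVec_mulVec, stateKernel_mulVec]
    simp [polMean, nextMean, Fintype.sum_prod_type, Finset.mul_sum, mul_assoc]

/-- The delay is recorded as the length of the mixing trajectory, so summing over trajectories also
sums over the delays below `m`. -/
lemma hasSum_mixing (F : S → ℝ) (m : ℕ) (x : S) :
    HasSum (fun l : List (A × S) => if l.length < m then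
      geoProb M.γ l.length * (pathProb M π.prob x l * F (endState x l)) else 0)
      (∑ t ∈ Finset.range m, geoProb M.γ t * (stateKernel M π ^ t *ᵥ F) x) := by
  refine (hasSum_sum fun t _ =>
    (hasSum_pathProb M π F t x).mul_left (geoProb M.γ t)).congr_fun fun l => ?_
  simp [mul_ite, Finset.sum_ite_eq]

variable {M} {pol : S → A → ℝ}

lemma hitProb_nonneg (h0 : ∀ s a, 0 ≤ pol s a) (g x : S) (l : List (A × S)) :
    0 ≤ hitProb M pol g x l := by
  induction l generalizing x with
  | nil => unfold hitProb; split_ifs <;> norm_num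
  | cons ay l ih =>
    obtain ⟨a, y⟩ := ay
    unfold hitProb
    split_ifs
    · exact le_rfl
    · exact mul_nonneg (mul_nonneg (h0 _ _) (M.P_nonneg _ _ _)) (ih y)

lemma exists_hasSum_hitProb_truncated (h0 : ∀ s a, 0 ≤ pol s a) (h1 : ∀ s, ∑ a, pol s a = 1)
    (g : S) (n : ℕ) (x : S) :
    ∃ c ≤ 1, HasSum (fun l => if l.length ≤ n then hitProb M pol g x l else 0) c := by
  induction n generalizing x with
  | zero =>
    have h := hasSum_list (α := A × S) (f := fun l =>
      if l.length ≤ 0 then hitProb M pol g x l else 0) (c := fun _ => 0)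
      (fun a => by simp)
    refine ⟨_, ?_, h⟩
    simp only [List.length_nil, le_refl, if_true, hitProb, Finset.sum_const_zero, add_zero]
    split_ifs <;> norm_num
  | succ n ih =>
    choose c hc1 hc using ih
    by_cases hx : x = g
    · have h := hasSum_list (α := A × S) (f := fun l =>
        if l.length ≤ n + 1 then hitProb M pol g x l else 0) (c := fun _ => 0)
        (fun a => by simp [hitProb, hx])
      exact ⟨_, by simp [hitProb, hx], h⟩
    · have h := hasSum_list (α := A × S) (f := fun l =>
        if l.length ≤ n + 1 then hitProb M pol g x l else 0)
        (c := fun ay => pol x ay.1 * M.P x ay.1 ay.2 * c ay.2)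
        (fun ay => by
          refine ((hc ay.2).mul_left (pol x ay.1 * M.P x ay.1 ay.2)).congr_fun fun l => ?_
          simp [hitProb, hx])
      refine ⟨_, ?_, h⟩
      simp only [List.length_nil, Nat.zero_le, if_true, hitProb, hx, if_false, zero_add,
        Fintype.sum_prod_type]
      rw [← h1 x]
      refine Finset.sum_le_sum fun a _ => ?_
      calc ∑ y, pol x a * M.P x a y * c y ≤ ∑ y, pol x a * M.P x a y :=
            Finset.sum_le_sum fun y _ => mul_le_of_le_one_right
              (mul_nonneg (h0 _ _) (M.P_nonneg _ _ _)) (hc1 y)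
        _ = pol x a := by rw [← Finset.mul_sum, M.P_sum, mul_one]

/-- Only an upper bound is available in general, because a target may be missed. The lists in a
finite set have bounded length, which reduces the claim to the truncated version. -/
lemma exists_hasSum_hitProb (h0 : ∀ s a, 0 ≤ pol s a) (h1 : ∀ s, ∑ a, pol s a = 1)
    (g x : S) : ∃ c ≤ 1, HasSum (hitProb M pol g x) c := by
  have hb : ∀ F : Finset (List (A × S)), ∑ l ∈ F, hitProb M pol g x l ≤ 1 := by
    intro F
    obtain ⟨c, hc, h⟩ := exists_hasSum_hitProb_truncated (M := M) h0 h1 g (F.sup List.length) x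
    refine le_trans (le_of_eq ?_) ((sum_le_hasSum F (fun l _ => ?_) h).trans hc)
    · refine Finset.sum_congr rfl fun l hl => ?_
      rw [if_pos (Finset.le_sup (f := List.length) hl)]
    · split_ifs
      · exact hitProb_nonneg h0 g x l
      · exact le_rfl
  have hs := summable_of_sum_le (fun l => hitProb_nonneg (M := M) h0 g x l) hb
  exact ⟨_, hasSum_le_of_sum_le hs.hasSum hb, hs.hasSum⟩

end paths

section round

variable {M : MDP S A} {π : Policy S A} {p : Params S}

lemma hasSum_skip (M : MDP S A) (π : Policy S A) (p : Params S) (x : S) :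
    HasSum (fun t => roundProb M π p x (.skip t)) (M.γ ^ p.m) := by
  have h1 : HasSum (geoProb M.γ) 1 := by
    have h := (hasSum_geometric_of_lt_one M.γ_nonneg M.γ_lt_one).mul_left (1 - M.γ)
    rwa [mul_inv_cancel₀ (by linarith [M.γ_lt_one])] at h
  have h2 : HasSum (fun t => if t < p.m then geoProb M.γ t else 0)
      (∑ t ∈ Finset.range p.m, geoProb M.γ t) := by
    have h : HasSum (fun t => if t < p.m then geoProb M.γ t else 0)
        (∑ t ∈ Finset.range p.m, if t < p.m then geoProb M.γ t else 0) :=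
      hasSum_sum_of_ne_finset_zero fun t ht => if_neg (by simpa using ht)
    rwa [Finset.sum_congr rfl fun t ht => if_pos (Finset.mem_range.1 ht)] at h
  have h3 : ∑ t ∈ Finset.range p.m, geoProb M.γ t = 1 - M.γ ^ p.m := by
    simp only [geoProb, ← Finset.mul_sum]
    exact mul_neg_geom_sum M.γ p.m
  have h4 := h1.sub h2
  rw [h3, sub_sub_cancel] at h4
  refine h4.congr_fun fun t => ?_
  simp only [roundProb]
  split_ifs <;> first | omega | simp

/-- The contribution of one final action, next state and next action to `sampleMean`. -/
noncomputable def sampleTerm (M : MDP S A) (π : Policy S A) (p : Params S)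
    (F : S → A → S → A → ℝ) (q : A × S × A) (s : S) : ℝ :=
  perturbed π p.epsA s q.1 * M.P s q.1 q.2.1 * π.prob q.2.1 q.2.2 * F s q.1 q.2.1 q.2.2

/-- The average over the final action and transition of a round. -/
noncomputable def sampleMean (M : MDP S A) (π : Policy S A) (p : Params S)
    (F : S → A → S → A → ℝ) (s : S) : ℝ :=
  ∑ q : A × S × A, sampleTerm M π p F q s

/-- The hitting trajectory and the continuation from the target have product weights. The starting
state thus enters only through the hitting probabilities `H`. -/
lemma hasSum_roundProb_of_hit (x : S) {H : S → ℝ}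
    (hH : ∀ g, HasSum (hitProb M (perturbed π p.epsS) g x) (H g)) {f : Round S A → ℝ} {f₀ : ℝ}
    {F : S → A → S → A → ℝ} (hf0 : ∀ t, f (.skip t) = f₀)
    (hfF : ∀ g e l a s' a', f (.full g e l a s' a') = F (endState g l) a s' a') :
    HasSum (fun b => roundProb M π p x b * f b) (M.γ ^ p.m * f₀ +
      ∑ g, targetProb p g * H g * ∑ t ∈ Finset.range p.m, geoProb M.γ t *
        (stateKernel M π ^ t *ᵥ sampleMean M π p F) g) := by
  have h0 : HasSum (fun t => roundProb M π p x (.skip t) * f (.skip t)) (M.γ ^ p.m * f₀) := by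
    simp only [hf0]
    exact (hasSum_skip M π p x).mul_right f₀
  have h1 : ∀ q : S × A × S × A, HasSum (fun el : List (A × S) × List (A × S) =>
      roundProb M π p x (.full q.1 el.1 el.2 q.2.1 q.2.2.1 q.2.2.2) *
        f (.full q.1 el.1 el.2 q.2.1 q.2.2.1 q.2.2.2))
      (targetProb p q.1 * H q.1 * ∑ t ∈ Finset.range p.m, geoProb M.γ t *
        (stateKernel M π ^ t *ᵥ sampleTerm M π p F q.2) q.1) := by
    rintro ⟨g, a, s', a'⟩
    have ha := (hH g).mul_left (targetProb p g)
    have hb := hasSum_mixing M π (sampleTerm M π p F (a, s', a')) p.m g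
    have hab := hasSum_mul_prod ha hb
    refine hab.congr_fun fun el => ?_
    obtain ⟨e, l⟩ := el
    by_cases hl : l.length < p.m
    · simp only [hfF, roundProb, if_pos hl, sampleTerm]
      ring
    · simp only [roundProb, if_neg hl, zero_mul, mul_zero]
  have h2 := hasSum_round (f := fun b => roundProb M π p x b * f b) h0 h1
  have h3 : ∀ g, ∑ q : A × S × A, targetProb p g * H g * ∑ t ∈ Finset.range p.m, geoProb M.γ t *
      (stateKernel M π ^ t *ᵥ sampleTerm M π p F q) g =
      targetProb p g * H g * ∑ t ∈ Finset.range p.m, geoProb M.γ t *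
        (stateKernel M π ^ t *ᵥ sampleMean M π p F) g := by
    intro g
    rw [← Finset.mul_sum, Finset.sum_comm]
    congr 1
    refine Finset.sum_congr rfl fun t _ => ?_
    rw [← Finset.mul_sum]
    congr 1
    simp only [Matrix.mulVec, dotProduct, sampleMean, Finset.mul_sum]
    exact Finset.sum_comm
  rw [Fintype.sum_prod_type, Finset.sum_congr rfl fun g _ => h3 g] at h2
  exact h2

lemma sampleMean_one (M : MDP S A) (π : Policy S A) (p : Params S) :
    sampleMean M π p (fun _ _ _ _ => 1) = fun _ => 1 := by
  funext s
  simp only [sampleMean, sampleTerm, mul_one, Fintype.sum_prod_type, ← Finset.mul_sum, π.prob_sum, M.P_sum,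
    sum_perturbed]

/-- If the round is well defined, then its law gives the expected values under the truncated
visitation distribution. -/
lemma hasSum_roundProb (hf : p.f ∈ Set.Icc (0 : ℝ) 1) (hS : p.epsS ∈ Set.Icc (0 : ℝ) 1) {x : S}
    (hx : HasSum (roundProb M π p x) 1) {f : Round S A → ℝ} {f₀ : ℝ}
    {F : S → A → S → A → ℝ} (hf0 : ∀ t, f (.skip t) = f₀)
    (hfF : ∀ g e l a s' a', f (.full g e l a s' a') = F (endState g l) a s' a') :
    HasSum (fun b => roundProb M π p x b * f b) (M.γ ^ p.m * f₀ +
      ∑ s, kappaTrunc M π p p.m s * sampleMean M π p F s) := by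
  have hpol := perturbed_nonneg (π := π) hS.1 hS.2
  choose H hH1 hH using fun g => exists_hasSum_hitProb (M := M) hpol (sum_perturbed π p.epsS) g x
  have hgeo : ∑ t ∈ Finset.range p.m, geoProb M.γ t = 1 - M.γ ^ p.m := by
    simp only [geoProb, ← Finset.mul_sum]
    exact mul_neg_geom_sum M.γ p.m
  have hK : ∀ t : ℕ, stateKernel M π ^ t *ᵥ (fun _ => (1 : ℝ)) = fun _ => 1 := by
    intro t
    induction t with
    | zero => simp
    | succ t ih => rw [pow_succ, ← Matrix.mulVec_mulVec, stateKernel_mulVec, nextMean_const,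
        polMean_const, ih]
  -- The total mass 1 of the round forces every target of positive probability to be hit almost
  -- surely. Almost sure hitting is thereby derived from the law being well defined.
  have htot := hasSum_roundProb_of_hit (M := M) (π := π) (p := p) x hH (f := fun _ => 1) (f₀ := 1)
    (F := fun _ _ _ _ => 1) (fun _ => rfl) (fun _ _ _ _ _ _ => rfl)
  simp only [mul_one, sampleMean_one, hK, hgeo] at htot
  have htot' := htot.unique hx
  rw [← Finset.sum_mul] at htot'
  have hmain := hasSum_roundProb_of_hit (M := M) (π := π) (p := p) x hH hf0 hfF
  convert hmain using 2
  rw [sum_kappaTrunc_mul]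
  simp only [nu_dot, Finset.mul_sum]
  rw [Finset.sum_comm]
  refine Finset.sum_congr rfl fun g _ => ?_
  -- For `m = 0` every round is skipped and the total mass says nothing about hitting, but then the
  -- sum over delays is empty.
  rcases Nat.eq_zero_or_pos p.m with hm | hm
  · simp [hm]
  · have hγm : M.γ ^ p.m < 1 := pow_lt_one₀ M.γ_nonneg M.γ_lt_one hm.ne'
    have hsum : ∑ g, targetProb p g * H g = 1 := by
      have : (∑ g, targetProb p g * H g) * (1 - M.γ ^ p.m) = 1 * (1 - M.γ ^ p.m) := by linarith
      exact mul_right_cancel₀ (by linarith) this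
    have hg : targetProb p g * H g = targetProb p g := by
      have h1 : ∀ g ∈ Finset.univ, targetProb p g * H g ≤ targetProb p g := fun g _ =>
        mul_le_of_le_one_right (targetProb_nonneg hf g) (hH1 g)
      exact (Finset.sum_eq_sum_iff_of_le h1).1 (by rw [hsum, sum_targetProb]) g
        (Finset.mem_univ g)
    rw [hg]
    refine Finset.sum_congr rfl fun t _ => ?_
    simp only [geoProb]
    ring

lemma bell_sub_eq_sum (M : MDP S A) (π : Policy S A) (u : S × A → ℝ) (c : ℝ) (s : S) (a : A) :
    bell M π u (s, a) - c =
      ∑ s', ∑ a', M.P s a s' * π.prob s' a' * (u (s, a) - c - M.γ * u (s', a')) := by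
  have h : ∀ s', ∑ a', M.P s a s' * π.prob s' a' * (u (s, a) - c - M.γ * u (s', a')) =
      M.P s a s' * (u (s, a) - c) - M.γ * (M.P s a s' * ∑ a', π.prob s' a' * u (s', a')) := by
    intro s'
    have h1 : ∑ a', M.P s a s' * (u (s, a) - c) * π.prob s' a' = M.P s a s' * (u (s, a) - c) := by
      rw [← Finset.mul_sum, π.prob_sum, mul_one]
    rw [← h1, Finset.mul_sum, Finset.mul_sum, ← Finset.sum_sub_distrib]
    exact Finset.sum_congr rfl fun a' _ => by ring
  rw [Finset.sum_congr rfl fun s' _ => h s', Finset.sum_sub_distrib, ← Finset.sum_mul, M.P_sum,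
    one_mul, ← Finset.mul_sum, sub_right_comm]
  rfl

lemma hasSum_roundProb_Fhat (hf : p.f ∈ Set.Icc (0 : ℝ) 1) (hS : p.epsS ∈ Set.Icc (0 : ℝ) 1)
    {x : S} (hx : HasSum (roundProb M π p x) 1) (Φ : Matrix (S × A) (Fin d) ℝ) (θ : Fin d → ℝ)
    (i : Fin d) :
    HasSum (fun b => roundProb M π p x b * Fhat M Φ θ b i)
      (meanF M π p Φ (kappaTrunc M π p p.m) θ i) := by
  have h := hasSum_roundProb (M := M) (π := π) hf hS hx (f := fun b => Fhat M Φ θ b i) (f₀ := 0)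
    (F := fun s a s' a' => (Φ (s, a) ⬝ᵥ θ - M.cost (s, a) - M.γ * (Φ (s', a') ⬝ᵥ θ)) * Φ (s, a) i)
    (fun _ => rfl) (fun _ _ _ _ _ _ => rfl)
  convert h using 1
  rw [mul_zero, zero_add, meanF]
  rw [Matrix.mulVec, dotProduct, Fintype.sum_prod_type]
  refine Finset.sum_congr rfl fun s _ => ?_
  simp only [sampleMean, sampleTerm, Fintype.sum_prod_type]
  rw [Finset.mul_sum]
  refine Finset.sum_congr rfl fun a _ => ?_
  rw [bell_sub_eq_sum]
  simp only [pairWeight, Finset.mul_sum, Matrix.transpose_apply]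
  exact Finset.sum_congr rfl fun s' _ => Finset.sum_congr rfl fun a' _ => by
    simp only [Matrix.mulVec]
    ring

end round

end CTD

/-! ### Expected iterates along a run -/

namespace CTD

open scoped Matrix
open MeasureTheory

set_option linter.unusedSectionVars false

section countable

variable {Ω α β : Type*} [MeasurableSpace Ω] {μ : Measure Ω}
  [Countable α] [MeasurableSpace α] [MeasurableSingletonClass α]
  [Countable β] [MeasurableSpace β] [MeasurableSingletonClass β]

lemma hasSum_integral_comp {Y : Ω → α} (hY : Measurable Y) {f : α → ℝ}
    (hf : Integrable (fun ω => f (Y ω)) μ) :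
    HasSum (fun a => μ.real {ω | Y ω = a} * f a) (∫ ω, f (Y ω) ∂μ) := by
  have hm : ∀ a, MeasurableSet {ω | Y ω = a} := fun a => hY (measurableSet_singleton a)
  have h := hasSum_integral_iUnion (μ := μ) (f := fun ω => f (Y ω)) hm
    (fun a b hab => Set.disjoint_left.2 fun ω ha hb => hab (ha.symm.trans hb)) hf.integrableOn
  have hU : (⋃ a, {ω | Y ω = a}) = Set.univ := by ext; simp
  rw [hU, Measure.restrict_univ] at h
  refine h.congr_fun fun a => ?_
  rw [setIntegral_congr_fun (g := fun _ => f a) (hm a) fun ω hω => congrArg f hω,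
    setIntegral_const, smul_eq_mul]

/-- If `q a` is the law of `Y` given `H = a`, then the integral of a function of `H` and `Y` is
computed by first averaging over `Y`. -/
lemma integral_comp_eq_of_law [IsFiniteMeasure μ] {H : Ω → α} {Y : Ω → β} (hH : Measurable H)
    (hY : Measurable Y) {q : α → β → ℝ}
    (hlaw : ∀ a b, μ.real {ω | H ω = a ∧ Y ω = b} = μ.real {ω | H ω = a} * q a b)
    {G : α → β → ℝ} {m : α → ℝ} (hG : Integrable (fun ω => G (H ω) (Y ω)) μ)
    (hm : Integrable (fun ω => m (H ω)) μ)
    (hq : ∀ a, HasSum (q a) 1 → HasSum (fun b => q a b * G a b) (m a)) :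
    ∫ ω, G (H ω) (Y ω) ∂μ = ∫ ω, m (H ω) ∂μ := by
  have h1 := hasSum_integral_comp (μ := μ) (hH.prodMk hY) (f := fun x : α × β => G x.1 x.2) hG
  refine (h1.prod_fiberwise fun a => ?_).unique (hasSum_integral_comp hH hm)
  have h2 : ∀ b, μ.real {ω | (H ω, Y ω) = (a, b)} = μ.real {ω | H ω = a} * q a b := fun b => by
    simpa only [Prod.mk.injEq] using hlaw a b
  simp only [h2]
  rcases eq_or_ne (μ.real {ω | H ω = a}) 0 with h0 | h0
  · simp only [h0, zero_mul]
    exact hasSum_zero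
  -- On an atom of positive mass `Y` takes some value, so its conditional law has total mass 1. This
  -- is why `hq` may assume that sum.
  · have h3 := hasSum_integral_comp (μ := μ.restrict {ω | H ω = a}) hY (f := fun _ => 1)
      (integrable_const 1)
    have h4 : ∀ b, (μ.restrict {ω | H ω = a}).real {ω | Y ω = b} =
        μ.real {ω | H ω = a} * q a b := fun b => by
      have hb : MeasurableSet {ω | Y ω = b} := hY (measurableSet_singleton b)
      rw [← hlaw, measureReal_restrict_apply hb, Set.inter_comm]
      rfl
    simp only [h4, mul_one, integral_const, measureReal_restrict_apply_univ, smul_eq_mul] at h3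
    have h5 := h3.mul_left (μ.real {ω | H ω = a})⁻¹
    simp only [inv_mul_cancel_left₀ h0, inv_mul_cancel₀ h0] at h5
    simpa only [mul_assoc] using (hq a h5).mul_left (μ.real {ω | H ω = a})

end countable

variable {S A : Type*} [Fintype S] [Fintype A] [DecidableEq S] [DecidableEq A] {d : ℕ}

instance : Inhabited (Round S A) := ⟨.skip 0⟩

instance : Countable (Round S A) := by
  let F : Round S A → ℕ ⊕ (S × List (A × S) × List (A × S) × A × S × A) := fun b =>
    match b with
    | .skip t => .inl t
    | .full g e l a s a' => .inr (g, e, l, a, s, a')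
  refine Function.Injective.countable (f := F) fun b b' h => ?_
  cases b <;> cases b' <;> simp_all [F]

instance : MeasurableSpace (Round S A) := ⊤

instance : DiscreteMeasurableSpace (Round S A) := ⟨fun _ => trivial⟩

section bounded

variable (M : MDP S A) (Φ : Matrix (S × A) (Fin d) ℝ)

/-- The operator depends on the round only through two state-action pairs, of which there are
finitely many. A uniform bound follows although there are infinitely many rounds. -/
lemma exists_norm_Fhat_le (C : ℝ) :
    ∃ D, ∀ θ : Fin d → ℝ, ‖θ‖ ≤ C → ∀ b, ‖Fhat M Φ θ b‖ ≤ D := by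
  have h : ∀ zz : (S × A) × (S × A), ∃ D, ∀ θ : Fin d → ℝ, ‖θ‖ ≤ C →
      ‖(Φ zz.1 ⬝ᵥ θ - M.cost zz.1 - M.γ * (Φ zz.2 ⬝ᵥ θ)) • Φ zz.1‖ ≤ D := by
    intro zz
    obtain ⟨D, hD⟩ := (isCompact_closedBall (0 : Fin d → ℝ) C).exists_bound_of_continuousOn
      (f := fun θ => (Φ zz.1 ⬝ᵥ θ - M.cost zz.1 - M.γ * (Φ zz.2 ⬝ᵥ θ)) • Φ zz.1)
      (by unfold dotProduct; fun_prop)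
    exact ⟨D, fun θ hθ => hD θ (by simpa using hθ)⟩
  choose D hD using h
  refine ⟨∑ zz, |D zz|, fun θ hθ b => ?_⟩
  have hsum : ∀ zz, |D zz| ≤ ∑ zz, |D zz| := fun zz =>
    Finset.single_le_sum (f := fun zz => |D zz|) (fun _ _ => abs_nonneg _) (Finset.mem_univ zz)
  cases b with
  | skip t =>
    rw [Fhat, norm_zero]
    exact Finset.sum_nonneg fun _ _ => abs_nonneg _
  | full g e l a s a' =>
    exact (hD ((endState g l, a), (s, a')) θ hθ).trans ((le_abs_self _).trans (hsum _))

lemma exists_norm_iterate_le (ι : ℝ) (k : ℕ) : ∃ C, ∀ b, ‖iterate M Φ ι b k‖ ≤ C := by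
  induction k with
  | zero => exact ⟨0, fun b => by simp [iterate]⟩
  | succ k ih =>
    obtain ⟨C, hC⟩ := ih
    obtain ⟨D, hD⟩ := exists_norm_Fhat_le M Φ C
    refine ⟨C + |ι| * D, fun b => (norm_sub_le _ _).trans (add_le_add (hC b) ?_)⟩
    rw [norm_smul, Real.norm_eq_abs]
    exact mul_le_mul_of_nonneg_left (hD _ (hC b) _) (abs_nonneg _)

lemma iterate_congr (ι : ℝ) {b b' : ℕ → Round S A} {k : ℕ} (h : ∀ i < k, b i = b' i) :
    iterate M Φ ι b k = iterate M Φ ι b' k := by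
  induction k with
  | zero => rfl
  | succ k ih =>
    rw [iterate, iterate, ih fun i hi => h i (hi.trans k.lt_succ_self), h k k.lt_succ_self]

end bounded

lemma integral_mulVec {Ω : Type*} [MeasurableSpace Ω] {μ : Measure Ω} {m n : Type*} [Fintype m]
    [Fintype n] (G : Matrix m n ℝ) {θ : Ω → n → ℝ} (hθ : Integrable θ μ) :
    Integrable (fun ω => G *ᵥ θ ω) μ ∧ ∫ ω, G *ᵥ θ ω ∂μ = G *ᵥ ∫ ω, θ ω ∂μ :=
  ⟨(LinearMap.toContinuousLinearMap (Matrix.mulVecLin G)).integrable_comp hθ,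
    (LinearMap.toContinuousLinearMap (Matrix.mulVecLin G)).integral_comp_comm hθ⟩

/-- Expectation commutes with an affine map; this is what closes the recursion for the expected
iterates. -/
lemma integral_meanF {Ω : Type*} [MeasurableSpace Ω] {μ : Measure Ω} [IsProbabilityMeasure μ]
    (M : MDP S A) (π : Policy S A) (p : Params S) (Φ : Matrix (S × A) (Fin d) ℝ) (κ : S → ℝ)
    {θ : Ω → Fin d → ℝ} (hθ : Integrable θ μ) :
    Integrable (fun ω => meanF M π p Φ κ (θ ω)) μ ∧
      ∫ ω, meanF M π p Φ κ (θ ω) ∂μ = meanF M π p Φ κ (∫ ω, θ ω ∂μ) := by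
  have h : ∀ θ, meanF M π p Φ κ θ = bellMatrix M π p Φ κ *ᵥ θ + meanF M π p Φ κ 0 := fun θ => by
    rw [meanF_eq_add Φ κ θ 0, sub_zero, bellMatrix_mulVec]
  obtain ⟨h1, h2⟩ := integral_mulVec (bellMatrix M π p Φ κ) hθ
  rw [h (∫ ω, θ ω ∂μ), ← h2]
  simp only [h (θ _)]
  refine ⟨h1.add (integrable_const _), ?_⟩
  rw [integral_add h1 (integrable_const _), integral_const, probReal_univ, one_smul]

section run

variable {M : MDP S A} {π : Policy S A} {p : Params S} {Ω₀ : Type*} [MeasurableSpace Ω₀]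
  {μ : Measure Ω₀} {X : ℕ → Ω₀ → S} {B : ℕ → Ω₀ → Round S A}

/-- The starting states of rounds `0, …, k` and the rounds before round `k`. -/
def history (X : ℕ → Ω₀ → S) (B : ℕ → Ω₀ → Round S A) (k : ℕ) (ω : Ω₀) :
    (Fin (k + 1) → S) × (Fin k → Round S A) :=
  (fun i => X i ω, fun i => B i ω)

/-- A finite sequence of rounds, extended to an infinite one. -/
def extend {k : ℕ} (b : Fin k → Round S A) (i : ℕ) : Round S A :=
  if h : i < k then b ⟨i, h⟩ else default

lemma iterate_eq_history (Φ : Matrix (S × A) (Fin d) ℝ) (ι : ℝ) (k : ℕ) (ω : Ω₀) :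
    iterate M Φ ι (fun k => B k ω) k = iterate M Φ ι (extend (history X B k ω).2) k :=
  iterate_congr M Φ ι fun i hi => by simp [extend, history, hi]

namespace IsRun

lemma measurable_B (hrun : IsRun μ M π p X B) (k : ℕ) : Measurable (B k) :=
  measurable_to_countable' fun b => hrun.measurable_round k b

lemma law_history (hrun : IsRun μ M π p X B) (k : ℕ)
    (η : (Fin (k + 1) → S) × (Fin k → Round S A)) (b : Round S A) :
    μ.real {ω | history X B k ω = η ∧ B k ω = b} =
      μ.real {ω | history X B k ω = η} * roundProb M π p (η.1 (Fin.last k)) b := by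
  obtain ⟨x, r⟩ := η
  -- The law is stated for infinite sequences but reads only the indices up to `k`, so any extension
  -- of the finite history works.
  have h := hrun.law k (fun i => x (Fin.ofNat (k + 1) i))
    (fun i => if i = k then b else extend r i)
  have e : ∀ ω, history X B k ω = (x, r) ↔ (∀ i ≤ k, X i ω = x (Fin.ofNat (k + 1) i)) ∧
      ∀ i < k, B i ω = if i = k then b else extend r i := by
    intro ω
    rw [history, Prod.mk.injEq, funext_iff, funext_iff]
    refine and_congr ⟨fun h i hi => ?_, fun h i => ?_⟩ ⟨fun h i hi => ?_, fun h i => ?_⟩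
    · rw [← h]
      simp [Nat.mod_eq_of_lt (Nat.lt_succ_of_le hi)]
    · rw [h i (Nat.le_of_lt_succ i.2)]
      congr 1
      ext
      simp
    · rw [if_neg hi.ne, extend, dif_pos hi, ← h]
    · rw [h i i.2, if_neg i.2.ne, extend, dif_pos i.2]
  simp only [e]
  convert h using 3
  · ext ω
    simp only [and_assoc]
    refine and_congr_right fun _ => ⟨fun h i hi => ?_, fun h => ⟨fun i hi => h i hi.le, ?_⟩⟩
    · rcases hi.lt_or_eq with hi | rfl
      · exact h.1 i hi
      · simpa using h.2
    · simpa using h k le_rfl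
  · congr 1
    ext
    simp
  · simp

lemma measurable_history [MeasurableSpace S] [MeasurableSingletonClass S]
    (hrun : IsRun μ M π p X B) (k : ℕ) : Measurable (history X B k) := by
  have hX : Measurable fun ω (i : Fin (k + 1)) => X i ω := measurable_pi_lambda _ fun i =>
    measurable_to_countable' fun x => hrun.measurable_start i x
  have hB : Measurable fun ω (i : Fin k) => B i ω := measurable_pi_lambda _ fun i =>
    hrun.measurable_B i
  exact hX.prodMk hB

variable [IsProbabilityMeasure μ]

lemma integrable_iterate (hrun : IsRun μ M π p X B) (Φ : Matrix (S × A) (Fin d) ℝ) (ι : ℝ)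
    (k : ℕ) : Integrable (fun ω => iterate M Φ ι (fun k => B k ω) k) μ := by
  let _ : MeasurableSpace S := ⊤
  have : DiscreteMeasurableSpace S := ⟨fun _ => trivial⟩
  obtain ⟨C, hC⟩ := exists_norm_iterate_le M Φ ι k
  refine Integrable.of_bound ?_ C (Filter.Eventually.of_forall fun ω => hC _)
  have h : Measurable fun ω => iterate M Φ ι (extend (history X B k ω).2) k :=
    (Measurable.of_discrete (f := fun η : (Fin (k + 1) → S) × (Fin k → Round S A) =>
      iterate M Φ ι (extend η.2) k)).comp (hrun.measurable_history k)
  simp only [iterate_eq_history (M := M) (X := X) Φ ι k]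
  exact h.aestronglyMeasurable

lemma integral_iterate_succ (hrun : IsRun μ M π p X B) (hf : p.f ∈ Set.Icc (0 : ℝ) 1)
    (hS : p.epsS ∈ Set.Icc (0 : ℝ) 1) (Φ : Matrix (S × A) (Fin d) ℝ) {ι : ℝ} (hι : ι ≠ 0)
    (k : ℕ) :
    ∫ ω, iterate M Φ ι (fun k => B k ω) (k + 1) ∂μ =
      (∫ ω, iterate M Φ ι (fun k => B k ω) k ∂μ) -
        ι • meanF M π p Φ (kappaTrunc M π p p.m) (∫ ω, iterate M Φ ι (fun k => B k ω) k ∂μ) := by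
  let _ : MeasurableSpace S := ⊤
  have : DiscreteMeasurableSpace S := ⟨fun _ => trivial⟩
  have hk := hrun.integrable_iterate Φ ι k
  obtain ⟨hm, hmi⟩ := integral_meanF M π p Φ (kappaTrunc M π p p.m) hk
  have hF : Integrable
      (fun ω => Fhat M Φ (iterate M Φ ι (fun k => B k ω) k) (B k ω)) μ := by
    -- The sampled operator is the difference of two integrable iterates divided by `ι`, which is
    -- where `ι ≠ 0` enters.
    refine ((hk.sub (hrun.integrable_iterate Φ ι (k + 1))).smul ι⁻¹).congr
      (Filter.Eventually.of_forall fun ω => ?_)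
    simp [iterate, smul_smul, hι]
  have hmain : ∫ ω, Fhat M Φ (iterate M Φ ι (fun k => B k ω) k) (B k ω) ∂μ =
      ∫ ω, meanF M π p Φ (kappaTrunc M π p p.m) (iterate M Φ ι (fun k => B k ω) k) ∂μ := by
    funext i
    rw [eval_integral fun i => hF.eval i, eval_integral fun i => hm.eval i]
    have hFi := hF.eval i
    have hmi := hm.eval i
    simp only [iterate_eq_history (M := M) (X := X) Φ ι k] at hFi hmi ⊢
    exact integral_comp_eq_of_law (hrun.measurable_history k) (hrun.measurable_B k)
      (hrun.law_history k)
      (G := fun η b => Fhat M Φ (iterate M Φ ι (extend η.2) k) b i)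
      (m := fun η => meanF M π p Φ (kappaTrunc M π p p.m) (iterate M Φ ι (extend η.2) k) i)
      hFi hmi fun η hη => hasSum_roundProb_Fhat hf hS hη Φ _ i
  simp only [iterate]
  have hF' : Integrable (fun ω => ι • Fhat M Φ (iterate M Φ ι (fun k => B k ω) k) (B k ω)) μ :=
    hF.smul ι
  rw [integral_sub hk hF', integral_smul, hmain, hmi]

end IsRun

end run

end CTD

/-! ### The final estimate -/

namespace CTD

open scoped Matrix
open MeasureTheory

set_option linter.unusedSectionVars false

lemma mul_pow_le_of_logb_le {γ a r μ : ℝ} {m : ℕ} (hγ : 0 < γ) (hγ1 : γ < 1) (ha : 0 ≤ a)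
    (hr : 0 ≤ r) (hμ : 0 < μ) (h : Real.logb (1 / γ) ((a + 1) * r / μ) ≤ m) :
    r * a * γ ^ m ≤ μ := by
  rcases hr.eq_or_lt with rfl | hr
  · simpa using hμ.le
  have hy : 0 < (a + 1) * r / μ := by positivity
  have h1 : (a + 1) * r / μ ≤ (1 / γ) ^ (m : ℝ) :=
    (Real.logb_le_iff_le_rpow (one_lt_one_div hγ hγ1) hy).1 h
  have hpow : 0 < γ ^ m := pow_pos hγ m
  rw [Real.rpow_natCast, one_div, inv_pow, ← one_div, div_le_div_iff₀ hμ hpow] at h1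
  nlinarith [mul_pos hr hpow]

variable {S A : Type*} [Fintype S] [Fintype A] [DecidableEq S] [DecidableEq A] {d : ℕ}
  {M : MDP S A} {π : Policy S A} {p : Params S} {Ω₀ : Type*} [MeasurableSpace Ω₀]
  {μ : Measure Ω₀} [IsProbabilityMeasure μ] {X : ℕ → Ω₀ → S} {B : ℕ → Ω₀ → Round S A}

lemma IsRun.integral_output (hrun : IsRun μ M π p X B) (Φ : Matrix (S × A) (Fin d) ℝ) (ι : ℝ)
    (N : ℕ) :
    Integrable (fun ω => output M Φ ι N (fun k => B k ω)) μ ∧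
      ∫ ω, output M Φ ι N (fun k => B k ω) ∂μ = (N : ℝ)⁻¹ • ∑ t ∈ Finset.Ico N (2 * N),
        Φ *ᵥ ∫ ω, iterate M Φ ι (fun k => B k ω) t ∂μ := by
  have h := fun t => integral_mulVec Φ (hrun.integrable_iterate Φ ι t)
  simp only [output]
  refine ⟨(integrable_finsetSum _ fun t _ => (h t).1).smul (N : ℝ)⁻¹, ?_⟩
  rw [integral_smul, integral_finsetSum _ fun t _ => (h t).1]
  simp only [(h _).2]

end CTD

theorem mainTheorem7
    {S A : Type*} [Fintype S] [Fintype A] [DecidableEq S] [DecidableEq A] {d : ℕ}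
    (M : CTD.MDP S A) (π : CTD.Policy S A) (p : CTD.Params S)
    (Φ : Matrix (S × A) (Fin d) ℝ) (ι : ℝ)
    {Ω₀ : Type*} [MeasurableSpace Ω₀] (μ₀ : MeasureTheory.Measure Ω₀)
    [MeasureTheory.IsProbabilityMeasure μ₀]
    (X : ℕ → Ω₀ → S) (B : ℕ → Ω₀ → CTD.Round S A)
    (hγ : 0 < M.γ)
    (hd : 0 < d) (hΦ : Φ.rank = d)
    (hf : p.f ∈ Set.Icc (0 : ℝ) 1)
    (hepsS : p.epsS ∈ Set.Icc (0 : ℝ) 1)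
    (hκ : 0 < ⨅ s, CTD.kappaMix M π p s)
    (hepsA : p.epsA ∈ Set.Ioc (0 : ℝ) ((1 - M.γ) * (⨅ s, CTD.kappaMix M π p s) / 4))
    (hm : Real.logb (1 / M.γ)
        ((CTD.featNorm Φ ^ 2 + 1) * √(Fintype.card S : ℝ) / CTD.lamMin M π p Φ) ≤ (p.m : ℝ))
    (hι : 0 < ι) (hι' : ι ≤ (1 - M.γ) / (512 * CTD.featNorm Φ ^ 2))
    (hrun : CTD.IsRun μ₀ M π p X B) :
    ∃ Qbar : S × A → ℝ,
      (∀ Q : S × A → ℝ, CTD.ProjBellman M π p Φ Q ↔ Q = Qbar) ∧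
      ∀ N : ℕ, 1 ≤ N →
        MeasureTheory.Integrable (fun ω => CTD.output M Φ ι N (fun k => B k ω)) μ₀ ∧
        CTD.wNormSq M π p ((∫ ω, CTD.output M Φ ι N (fun k => B k ω) ∂μ₀) - Qbar) ≤
          (1 / 2 : ℝ) ^ (N / CTD.epochLen M π p Φ ι) * (16 * CTD.featNorm Φ ^ 2) /
              ((1 - M.γ) ^ 2 * CTD.lamMin M π p Φ) +
            786 * CTD.featNorm Φ ^ 2 * (CTD.epochLen M π p Φ ι : ℝ) ^ 2 * CTD.C2 M π p Φ ι /
              (1 - M.γ) ^ 2 ∧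
        (CTD.lamMin M π p Φ ≤ 1 →
          CTD.wNormSq M π p ((∫ ω, CTD.output M Φ ι N (fun k => B k ω) ∂μ₀) - Qbar) ≤
            (1 / 2 : ℝ) ^ (N / CTD.epochLen M π p Φ ι) * (16 * CTD.featNorm Φ ^ 2) /
                ((1 - M.γ) ^ 2 * CTD.lamMin M π p Φ) +
              786 * CTD.featNorm Φ ^ 2 * (CTD.epochLen M π p Φ ι : ℝ) ^ 2 * CTD.C2 M π p Φ ι /
                ((1 - M.γ) ^ 2 * CTD.lamMin M π p Φ)) := by
  have hg : 0 < 1 - M.γ := by linarith [M.γ_lt_one]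
  have hE : CTD.Exploring M π p (⨅ s, CTD.kappaMix M π p s) :=
    ⟨hf, hκ, fun s => ciInf_le (Set.finite_range _).bddBelow s, hepsA.1, hepsA.2⟩
  have hμ := hE.lamMin_pos hd hΦ
  have hΩ : 0 < CTD.featNorm Φ ^ 2 := hμ.trans_le (hE.lamMin_le hd Φ)
  have hιΩ : 512 * CTD.featNorm Φ ^ 2 * ι ≤ 1 - M.γ := by
    rw [le_div_iff₀ (by positivity)] at hι'
    linarith
  have hm' := CTD.mul_pow_le_of_logb_le hγ M.γ_lt_one hΩ.le (Real.sqrt_nonneg _) hμ hm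
  obtain ⟨θ₀, h0, huniq⟩ := CTD.exists_meanF_eq_zero hE hΦ
  refine ⟨Φ.mulVec θ₀, CTD.projBellman_iff hE hΦ h0 huniq, fun N hN => ?_⟩
  obtain ⟨hint, hout⟩ := hrun.integral_output Φ ι N
  have hcard : (Finset.Ico N (2 * N)).card = N := by rw [Nat.card_Ico]; omega
  have hne : (Finset.Ico N (2 * N)).Nonempty := Finset.nonempty_Ico.2 (by omega)
  -- The averaged iterates all have index at least `N`, so they share the bound with exponent `N /
  -- T`.
  have hbound := hE.wNormSq_average_le hne fun t ht =>
    hE.iterate_error_le hd hΦ hι hιΩ h0 hm'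
      (θ := fun t => ∫ ω, CTD.iterate M Φ ι (fun k => B k ω) t ∂μ₀)
      (by simp [CTD.iterate]) (hrun.integral_iterate_succ hf hepsS Φ hι.ne')
      (Finset.mem_Ico.1 ht).1
  rw [← CTD.mulVec_average_sub Φ _ θ₀ hne, hcard, ← hout] at hbound
  -- For `μ ≤ 1`, inserting `μ` in the denominator of the nonnegative second term only increases it.
  refine ⟨hint, hbound, fun hμ1 => hbound.trans (add_le_add_right ?_ _)⟩
  have hγm := pow_nonneg M.γ_nonneg p.m
  have hC2 : 0 ≤ CTD.C2 M π p Φ ι := by unfold CTD.C2; positivity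
  exact div_le_div_of_nonneg_left (by positivity) (by positivity)
    (mul_le_of_le_one_right (by positivity) hμ1)
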